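/- **Setting.** An episodic non-stationary MDP has a finite state set $\mathcal S$ with $|\mathcal S|=S$, a finite action set $\mathcal A$ with $|\mathcal A|=A$, and runs for $M$ episodes of $H$ steps; $T=MH$. At step $h$ of episode $m$, taking action $a$ in state $s$ yields a random reward in $[0,1]$ with mean $r_h^m(s,a)$ and a next state with law $P_h^m(\cdot\mid s,a)$ (reward and next state may be correlated; given $(m,h,s,a)$ they are independent of the past). The laws may depend arbitrarily on $m$ and $h$, and the initial states $s_1^1,\dots,s_1^M$ are arbitrary but fixed in advance. For a deterministic policy $\pi$ of episode $m$ let $V_1^{m,\pi}(s)$ be the expected total mean reward in episode $m$ from initial state $s$, and $V_1^{m,\star}(s)=\max_\pi V_1^{m,\pi}(s)$. Let $$\Delta=\sum_{m=1}^{M-1}\sum_{h=1}^{H}\Big(\max_{s,a}|r_h^m(s,a)-r_h^{m+1}(s,a)|+\max_{s,a}\|P_h^m(\cdot\mid s,a)-P_h^{m+1}(\cdot\mid s,a)\|_1\Big),$$ and assume $\Delta>0$. **Algorithm** (RestartQ-UCB with Hoeffding bonuses and no local budgets; inputs $D\in\{1,2,\dots\}$ and $\delta'\in(0,1)$). Put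 $\iota=\log(2/\delta')$, $K=\lceil M/D\rceil$, $e_1=H$, $e_{i+1}=\lfloor(1+\frac1H)e_i\rfloor$ and $\mathcal L=\{e_1+\dots+e_j: j\ge1\}$. At the beginning of episodes $1,K+1,2K+1,\dots$ reset, for all $(s,a,h)$, $V_h(s)=Q_h(s,a)=H-h+1$ and $N_h(s,a)=\check N_h(s,a)=\check r_h(s,a)=\check v_h(s,a)=0$; always $V_{H+1}=0$. At step $h$ of each episode, in state $s_h$, take $a_h\in\arg\max_a Q_h(s_h,a)$ (ties broken by any fixed measurable rule), receive the reward $R_h$, observe $s_{h+1}$, and, at the entry $(s_h,a_h)$, add $R_h$ to $\check r_h$, $V_{h+1}(s_{h+1})$ to $\check v_h$, and $1$ to $N_h$ and to $\check N_h$. If now $N_h(s_h,a_h)\in\mathcal L$, then with $\check n=\check N_h(s_h,a_h)$ set $$Q_h(s_h,a_h)\gets\min\Big\{\frac{\check r_h(s_h,a_h)}{\check n}+\frac{\check v_h(s_h,a_h)}{\check n}+\sqrt{\frac{H^2}{\check n}\iota}+\sqrt{\frac1{\check n}\iota},\ Q_h(s_h,a_h)\Big\},\qquad V_h(s_h)\gets\max_aQ_h(s_h,a),$$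 and reset $\check N_h,\check r_h,\check v_h$ to $0$ at $(s_h,a_h)$. If $\pi^m$ is the policy $(h,s)\mapsto\arg\max_aQ_h(s,a)$ played in episode $m$, the dynamic regret is $\mathcal R=\sum_{m=1}^M\big(V_1^{m,\star}(s_1^m)-V_1^{m,\pi^m}(s_1^m)\big)$. **Theorem.** There is an absolute constant $p\in\mathbb N$, and for every $c>0$ there is a constant $C>0$ depending only on $c$, such that the following holds for every such MDP, all initial states and every $\delta\in(0,1)$. Let $D^\star=S^{-1/3}A^{-1/3}\Delta^{2/3}H^{-2/3}T^{1/3}$ and suppose that $D^\star\ge1$ and $T\ge c\,SA\Delta H^2$. Run the algorithm with $D=\lceil D^\star\rceil$ and $\delta'=\delta/(8SAT)$. Then, with probability at least $1-\delta$, $$\mathcal R\le C\,\Big(\log\frac{SAT}{\delta}\Big)^{p}\,S^{1/3}A^{1/3}\Delta^{1/3}H^{5/3}T^{2/3}.$$ -/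

import Mathlib

open MeasureTheory

/-- An episodic non-stationary Markov decision process with `M` episodes of `H` steps (episodes and
steps are numbered from `0`). `law m h s a` is the joint law of the random reward and of the next
state when action `a` is taken in state `s` at step `h` of episode `m`. Rewards lie in `[0,1]`;
nothing is assumed about how the law depends on `m` and `h`. -/
structure NonstatMDP (S A : Type*) [MeasurableSpace S] (M H : ℕ) where
  law : Fin M → Fin H → S → A → Measure (ℝ × S)
  isProb : ∀ m h s a, IsProbabilityMeasure (law m h s a)
  reward_mem : ∀ m h s a, ∀ᵐ z ∂(law m h s a), z.1 ∈ Set.Icc (0 : ℝ) 1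

namespace NonstatMDP

variable {S A : Type*} [MeasurableSpace S] {M H : ℕ}

/-- The mean reward `r_h^m(s,a)`. -/
noncomputable def meanReward (E : NonstatMDP S A M H) (m : Fin M) (h : Fin H) (s : S) (a : A) : ℝ :=
  ∫ z, z.1 ∂(E.law m h s a)

/-- The transition probability `P_h^m(s' ∣ s,a)`. -/
noncomputable def trans (E : NonstatMDP S A M H) (m : Fin M) (h : Fin H) (s : S) (a : A)
    (s' : S) : ℝ :=
  (E.law m h s a).real (Prod.snd ⁻¹' {s'})

open Classical in
/-- `E.stateDist m π s₁ h s` is the probability that episode `m`, started in `s₁` and played with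
the policy `π`, is in state `s` at step `h`. -/
noncomputable def stateDist [Fintype S] (E : NonstatMDP S A M H) (m : Fin M) (π : Fin H → S → A)
    (s₁ : S) : ℕ → S → ℝ
  | 0, s => if s = s₁ then 1 else 0
  | h + 1, s =>
      if hh : h < H then
        ∑ x, E.stateDist m π s₁ h x * E.trans m ⟨h, hh⟩ x (π ⟨h, hh⟩ x) s
      else 0

/-- The value `V_1^{m,π}(s₁)`: the expected total mean reward collected in episode `m` by the policy
`π` from the initial state `s₁`. -/
noncomputable def value [Fintype S] (E : NonstatMDP S A M H) (m : Fin M) (π : Fin H → S → A)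
    (s₁ : S) : ℝ :=
  ∑ h : Fin H, ∑ s, E.stateDist m π s₁ h s * E.meanReward m h s (π h s)

/-- The optimal value `V_1^{m,⋆}(s₁)`, a supremum over all deterministic policies. -/
noncomputable def optValue [Fintype S] (E : NonstatMDP S A M H) (m : Fin M) (s₁ : S) : ℝ :=
  ⨆ π : Fin H → S → A, E.value m π s₁

/-- The variation `Δ_r` of the mean rewards over consecutive episodes. -/
noncomputable def rewardVariation (E : NonstatMDP S A M H) : ℝ :=
  ∑ m : Fin M, if hm : m.1 + 1 < M then
    ∑ h : Fin H, ⨆ x : S × A,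
      |E.meanReward m h x.1 x.2 - E.meanReward ⟨m.1 + 1, hm⟩ h x.1 x.2|
  else 0

/-- The variation `Δ_p` of the transition kernels over consecutive episodes, in `L¹`-norm. -/
noncomputable def transVariation [Fintype S] (E : NonstatMDP S A M H) : ℝ :=
  ∑ m : Fin M, if hm : m.1 + 1 < M then
    ∑ h : Fin H, ⨆ x : S × A,
      ∑ s' : S, |E.trans m h x.1 x.2 s' - E.trans ⟨m.1 + 1, hm⟩ h x.1 x.2 s'|
  else 0

/-- The total variation `Δ = Δ_r + Δ_p`. -/
noncomputable def variation [Fintype S] (E : NonstatMDP S A M H) : ℝ :=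
  E.rewardVariation + E.transVariation

/-- The law of the randomness of the environment. An outcome `ω` lists, for every time `(m,h)` and
every pair `(s,a)`, the reward `R_h^m(s,a)` and the next state that would result; these are
independent for different `(m,h,s,a)`. At each time only the entry of the current state and action
is revealed, so that, given the past, the reward and the next state have law `E.law m h s a`. -/
noncomputable def envMeasure [Fintype S] [Fintype A] (E : NonstatMDP S A M H) :
    Measure (Fin M × Fin H × S × A → ℝ × S) :=
  Measure.pi fun i => E.law i.1 i.2.1 i.2.2.1 i.2.2.2

end NonstatMDP

/-- A rule that picks a maximizing action, with an arbitrary (measurable) way to break ties. -/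
structure ArgmaxRule (A : Type*) where
  sel : (A → ℝ) → A
  le_sel : ∀ (q : A → ℝ) (a : A), q a ≤ q (sel q)
  measurableSet_sel : ∀ a : A, MeasurableSet {q : A → ℝ | sel q = a}

namespace RestartQ

/-- The stage lengths `e_1 = H`, `e_{i+1} = ⌊(1 + 1/H) e_i⌋` (numbered from `0` here). -/
def stageLength (H : ℕ) : ℕ → ℕ
  | 0 => H
  | i + 1 => ⌊(1 + 1 / (H : ℚ)) * (stageLength H i : ℚ)⌋₊

/-- The ending times `e_1 + ⋯ + e_j`, `j ≥ 1`, of the stages. -/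
def stageEnds (H : ℕ) : Set ℕ :=
  {n | ∃ j : ℕ, n = ∑ i ∈ Finset.range (j + 1), stageLength H i}

/-- The tables that the algorithm maintains: the optimistic `Q` and `V`, the numbers `N` of visits
in the epoch and `Nc` of visits in the current stage, and the sums `rc` of rewards and `vc` of
next-state values in the current stage. The table `V` has one more step, the end of the episode. -/
structure Tables (S A : Type*) (H : ℕ) where
  Q : Fin H → S → A → ℝ
  V : Fin (H + 1) → S → ℝ
  N : Fin H → S → A → ℕ
  Nc : Fin H → S → A → ℕ
  rc : Fin H → S → A → ℝ
  vc : Fin H → S → A → ℝ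

variable {S A : Type*} {M H : ℕ}

/-- The tables at the beginning of an epoch. With steps numbered from `0`, the number of steps to go
is `H - h`, and it is `0` at the end of the episode. -/
def initTables (S A : Type*) (H : ℕ) : Tables S A H where
  Q h _ _ := (H : ℝ) - (h : ℕ)
  V h _ := (H : ℝ) - (h : ℕ)
  N _ _ _ := 0
  Nc _ _ _ := 0
  rc _ _ _ := 0
  vc _ _ _ := 0

open Classical in
/-- Replace the entry `(h,s,a)` of a table. -/
noncomputable def setEntry {β : Type*} (f : Fin H → S → A → β) (h : Fin H) (s : S) (a : A) (x : β) :
    Fin H → S → A → β :=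
  fun h' s' a' => if h' = h ∧ s' = s ∧ a' = a then x else f h' s' a'

open Classical in
/-- Processing one step: at step `h`, action `a` was taken in state `s`, with reward `R` and next
state `s'`. At the end of a stage the `Q`-value is updated with the bonus
`b = √(H² ι / n) + √(ι / n)`, where `n` is the number of visits in the stage. -/
noncomputable def processStep (ι : ℝ) (σ : Tables S A H) (h : Fin H) (s : S) (a : A) (R : ℝ)
    (s' : S) : Tables S A H :=
  let r : ℝ := σ.rc h s a + R
  let v : ℝ := σ.vc h s a + σ.V h.succ s'
  let N : ℕ := σ.N h s a + 1
  let n : ℕ := σ.Nc h s a + 1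
  if N ∈ stageEnds H then
    let b : ℝ := Real.sqrt ((H : ℝ) ^ 2 / n * ι) + Real.sqrt (1 / n * ι)
    let Q' := setEntry σ.Q h s a (min (r / n + v / n + b) (σ.Q h s a))
    { Q := Q'
      V := fun h' x => if h' = h.castSucc ∧ x = s then ⨆ a', Q' h s a' else σ.V h' x
      N := setEntry σ.N h s a N
      Nc := setEntry σ.Nc h s a 0
      rc := setEntry σ.rc h s a 0
      vc := setEntry σ.vc h s a 0 }
  else
    { Q := σ.Q
      V := σ.V
      N := setEntry σ.N h s a N
      Nc := setEntry σ.Nc h s a n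
      rc := setEntry σ.rc h s a r
      vc := setEntry σ.vc h s a v }

/-- The tables and the current state after the first `h` steps of episode `m`, which starts with the
tables `σ` in state `s₁`. At every step the algorithm takes the action that maximizes `Q_h(s,·)`. -/
noncomputable def runEpisode (rule : ArgmaxRule A) (ι : ℝ) (ω : Fin M × Fin H × S × A → ℝ × S)
    (m : Fin M) (σ : Tables S A H) (s₁ : S) : ℕ → Tables S A H × S
  | 0 => (σ, s₁)
  | h + 1 =>
      let p := runEpisode rule ι ω m σ s₁ h
      if hh : h < H then
        let a := rule.sel (p.1.Q ⟨h, hh⟩ p.2)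
        let z := ω (m, ⟨h, hh⟩, p.2, a)
        (processStep ι p.1 ⟨h, hh⟩ p.2 a z.1 z.2, z.2)
      else p

/-- The tables at the beginning of episode `m`, in a run with confidence parameter `δ` and with
`D` epochs of `K = ⌈M / D⌉` episodes (the last may be shorter): here `ι = log (2 / δ)`, and the
tables are reset at the episodes `0, K, 2K, …`. -/
noncomputable def tablesAt (rule : ArgmaxRule A) (D : ℕ) (δ : ℝ) (s₁ : Fin M → S)
    (ω : Fin M × Fin H × S × A → ℝ × S) : ℕ → Tables S A H
  | 0 => initTables S A H
  | m + 1 =>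
      if (m + 1) % ⌈(M : ℚ) / D⌉₊ = 0 then initTables S A H
      else if hm : m < M then
        (runEpisode rule (Real.log (2 / δ)) ω ⟨m, hm⟩ (tablesAt rule D δ s₁ ω m) (s₁ ⟨m, hm⟩) H).1
      else initTables S A H

/-- The policy of the algorithm in episode `m`. (The row `Q_h` changes only at step `h`, after the
action has been taken, so these are the actions that `runEpisode` takes.) -/
noncomputable def policyAt (rule : ArgmaxRule A) (D : ℕ) (δ : ℝ) (s₁ : Fin M → S)
    (ω : Fin M × Fin H × S × A → ℝ × S) (m : Fin M) : Fin H → S → A :=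
  fun h s => rule.sel ((tablesAt rule D δ s₁ ω m).Q h s)

/-- The dynamic regret of the algorithm when the initial states are `s₁`. -/
noncomputable def dynamicRegret [Fintype S] [MeasurableSpace S] (E : NonstatMDP S A M H)
    (rule : ArgmaxRule A) (D : ℕ) (δ : ℝ) (s₁ : Fin M → S)
    (ω : Fin M × Fin H × S × A → ℝ × S) : ℝ :=
  ∑ m : Fin M, (E.optValue m (s₁ m) - E.value m (policyAt rule D δ s₁ ω m) (s₁ m))

/-- The prescribed number of epochs `S^{-1/3} A^{-1/3} Δ^{2/3} H^{-2/3} T^{1/3}`, before rounding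
to an integer. -/
noncomputable def epochNumber (S A Δ H T : ℝ) : ℝ :=
  S ^ (-(1 / 3) : ℝ) * A ^ (-(1 / 3) : ℝ) * Δ ^ (2 / 3 : ℝ) * H ^ (-(2 / 3) : ℝ) * T ^ (1 / 3 : ℝ)

end RestartQ

set_option linter.unusedSectionVars false

/-! The difficulty is that inside an epoch the optimal values drift while the bonuses contain no
allowance for drift, so the tables need not dominate any episode's optimal value. The analysis
therefore uses one deterministic pessimistic benchmark for the whole epoch: `lowQ` is defined by
backward induction, taking at each step the minimum of the one-step lookaheads over all episodes of
the epoch, and `lowV` is its maximum over actions.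

Two facts make the benchmark work. Every episode's lookahead of `lowV` is at least `lowQ`, so
Hoeffding bonuses alone give `lowQ ≤ Q` throughout the epoch (`lowQ_le_Q`). Conversely, such a
lookahead exceeds `lowQ` by at most the variation of the epoch at that step
(`lookahead_le_lowQ_add`), so the optimal value of any episode exceeds `lowV` by at most the total
variation of the epoch (`policyValue_le_lowV_add`). Because `lowV` is not random, the data of a
stage are compared with a fixed function, and no union bound over value functions is needed.

For the played policy, the performance difference along the observed path bounds `lowV` minus its
value by the sum of `lowV - lowQ` at the played pairs plus martingale noise
(`NonstatMDP.lowGap_le_sum`). Since the played action attains `V`, the optimism `V - lowV` plus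
`lowV - lowQ` equals `Q - lowQ`. A visit in one stage uses the average from the preceding stage, and
consecutive stage lengths have ratio at most `1 + 1/H`. Hence the summed optimism at step `h` is at
most `1 + 1/H` times that at step `h + 1`, plus first-stage, variation and deviation terms
(`sum_gap_le`, `phi_add_gap_le`). Unrolling over `H` steps costs a factor below 3
(`sum_le_three_mul_sum`), which gives `epoch_regret_le`.

Both random fluctuations are sums over coordinates of a product measure, each chosen before it is
revealed. They are controlled by an exponential supermartingale built directly by resampling
coordinates (`measure_le_sum_le`). Summing over epochs with Cauchy–Schwarz gives
`GoodEvent.dynamicRegret_le`, and `error_terms_le` inserts the prescribed number of epochs. -/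

namespace RestartQ

/-! ### Stage lengths -/

/-- The number of visits in the first `j` stages. -/
def stageSum (H j : ℕ) : ℕ := ∑ i ∈ Finset.range j, stageLength H i

@[simp] theorem stageSum_zero (H : ℕ) : stageSum H 0 = 0 := rfl

theorem stageSum_succ (H j : ℕ) : stageSum H (j + 1) = stageSum H j + stageLength H j :=
  Finset.sum_range_succ _ _

theorem stageLength_succ (H j : ℕ) :
    stageLength H (j + 1) = stageLength H j + stageLength H j / H := by
  rw [stageLength]
  have : (1 + 1 / (H : ℚ)) * (stageLength H j : ℚ)
      = ((stageLength H j : ℕ) : ℚ) + (stageLength H j : ℚ) / (H : ℚ) := by ring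
  rw [this, add_comm, Nat.floor_add_natCast (by positivity), Nat.floor_div_eq_div, add_comm]

variable {H : ℕ}

theorem le_stageLength (j : ℕ) : H ≤ stageLength H j := by
  induction j with
  | zero => exact le_rfl
  | succ j ih => rw [stageLength_succ]; exact ih.trans (Nat.le_add_right _ _)

theorem stageLength_pos (hH : 0 < H) (j : ℕ) : 0 < stageLength H j :=
  hH.trans_le (le_stageLength j)

/-- This ratio is the source of the factor `1 + 1/H` lost at each step of the episode. -/
theorem mul_stageLength_succ_le (j : ℕ) :
    H * stageLength H (j + 1) ≤ (H + 1) * stageLength H j := by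
  rw [stageLength_succ]
  have := Nat.mul_div_le (stageLength H j) H
  nlinarith

/-- Since every length is at least `H`, the floor keeps at least half of `e_j / H`. So the lengths
grow by at least the factor `1 + 1/(2H)`, and all earlier stages together last at most `2H` times
the current one. -/
theorem stageSum_le (hH : 0 < H) (j : ℕ) : stageSum H j ≤ 2 * H * stageLength H j := by
  induction j with
  | zero => simp
  | succ j ih =>
    rw [stageSum_succ, stageLength_succ]
    have h1 : 1 ≤ stageLength H j / H := (Nat.one_le_div_iff hH).2 (le_stageLength j)
    have h2 := Nat.lt_mul_div_succ (stageLength H j) hH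
    nlinarith

/-- During stage `j + 1` the freshest estimate comes from stage `j`; this bounds the visit count by
the sample size of that estimate. -/
theorem stageSum_add_two_le (hH : 0 < H) (j : ℕ) :
    stageSum H (j + 2) ≤ 5 * H * stageLength H j := by
  rw [stageSum_succ, stageSum_succ, stageLength_succ]
  have h1 := stageSum_le hH j
  have h2 : stageLength H j / H ≤ stageLength H j := Nat.div_le_self _ _
  nlinarith

theorem stageSum_strictMono (hH : 0 < H) : StrictMono (stageSum H) :=
  strictMono_nat_of_lt_succ fun j => by
    rw [stageSum_succ]; have := stageLength_pos hH j; omega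

theorem exists_stage (hH : 0 < H) (n : ℕ) : ∃ j, stageSum H j ≤ n ∧ n < stageSum H (j + 1) := by
  induction n with
  | zero => exact ⟨0, by simp, by rw [stageSum_succ]; simpa using stageLength_pos hH 0⟩
  | succ n ih =>
    obtain ⟨j, h1, h2⟩ := ih
    rcases (Nat.succ_le_of_lt h2).lt_or_eq with h | h
    · exact ⟨j, by omega, h⟩
    · exact ⟨j + 1, h.ge, h.trans_lt (stageSum_strictMono hH (Nat.lt_succ_self (j + 1)))⟩

theorem stage_unique (hH : 0 < H) {n i j : ℕ} (hi : stageSum H i ≤ n ∧ n < stageSum H (i + 1))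
    (hj : stageSum H j ≤ n ∧ n < stageSum H (j + 1)) : i = j := by
  have h1 := (stageSum_strictMono hH).lt_iff_lt.1 (hi.1.trans_lt hj.2)
  have h2 := (stageSum_strictMono hH).lt_iff_lt.1 (hj.1.trans_lt hi.2)
  omega

theorem succ_mem_stageEnds_iff (hH : 0 < H) {n j : ℕ}
    (hj : stageSum H j ≤ n ∧ n < stageSum H (j + 1)) :
    n + 1 ∈ stageEnds H ↔ n + 1 = stageSum H (j + 1) := by
  refine ⟨?_, fun h => ⟨j, h⟩⟩
  rintro ⟨i, hi⟩
  change n + 1 = stageSum H (i + 1) at hi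
  have : stageSum H i < stageSum H (i + 1) := stageSum_strictMono hH (Nat.lt_succ_self i)
  rw [stage_unique hH (n := n) (i := i) (j := j) ⟨by omega, by omega⟩ hj] at hi
  exact hi

/-! ### A single entry of the tables -/

/-- What the tables record about one triple `(h,s,a)`. -/
@[ext] structure Entry where
  Q : ℝ
  N : ℕ
  Nc : ℕ
  rc : ℝ
  vc : ℝ

/-- The bonus for a stage with `n` visits. -/
noncomputable def bonus (H : ℕ) (ι : ℝ) (n : ℕ) : ℝ :=
  Real.sqrt ((H : ℝ) ^ 2 / n * ι) + Real.sqrt (1 / n * ι)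

open Classical in
/-- The update of an entry upon a visit with reward `R` and next-state value `v`. -/
noncomputable def Entry.step (H : ℕ) (ι : ℝ) (x : Entry) (R v : ℝ) : Entry :=
  if x.N + 1 ∈ stageEnds H then
    { Q := min ((x.rc + R) / ((x.Nc + 1 : ℕ) : ℝ) + (x.vc + v) / ((x.Nc + 1 : ℕ) : ℝ)
        + bonus H ι (x.Nc + 1)) x.Q
      N := x.N + 1, Nc := 0, rc := 0, vc := 0 }
  else { Q := x.Q, N := x.N + 1, Nc := x.Nc + 1, rc := x.rc + R, vc := x.vc + v }

section Visits

open Classical in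
/-- The number of visits before time `k`. -/
noncomputable def visitCount (vis : ℕ → Prop) (k : ℕ) : ℕ := {i ∈ Finset.range k | vis i}.card

open Classical in
/-- The visits before time `L` which belong to stage `j`. -/
noncomputable def stageVisits (H : ℕ) (vis : ℕ → Prop) (L j : ℕ) : Finset ℕ :=
  {i ∈ Finset.range L | vis i ∧ stageSum H j ≤ visitCount vis i ∧
    visitCount vis i < stageSum H (j + 1)}

variable {vis : ℕ → Prop}

@[simp] theorem visitCount_zero : visitCount vis 0 = 0 := by simp [visitCount]

open Classical in
theorem visitCount_succ (k : ℕ) :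
    visitCount vis (k + 1) = visitCount vis k + if vis k then 1 else 0 := by
  unfold visitCount
  rw [Finset.range_add_one, Finset.filter_insert]
  split_ifs with h <;> simp

theorem visitCount_mono : Monotone (visitCount vis) :=
  monotone_nat_of_le_succ fun k => by rw [visitCount_succ]; omega

theorem visitCount_le (k : ℕ) : visitCount vis k ≤ k := by
  classical
  simpa [visitCount] using Finset.card_filter_le (Finset.range k) (fun i => vis i)

-- Along the visits the counter takes each value below its final one exactly once, so it can serve
-- as summation index.
open Classical in
theorem sum_visits {β : Type*} [AddCommMonoid β] (f : ℕ → β) (k : ℕ) :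
    ∑ i ∈ Finset.range k with vis i, f (visitCount vis i)
      = ∑ c ∈ Finset.range (visitCount vis k), f c := by
  induction k with
  | zero => simp
  | succ k ih =>
    rw [Finset.sum_filter, Finset.sum_range_succ, ← Finset.sum_filter, ih, visitCount_succ]
    split_ifs with h
    · rw [Finset.sum_range_succ]
    · simp

theorem card_stageVisits (L j : ℕ) : (stageVisits H vis L j).card =
    {c ∈ Finset.range (visitCount vis L) | stageSum H j ≤ c ∧ c < stageSum H (j + 1)}.card := by
  classical
  rw [Finset.card_filter, ← sum_visits, stageVisits, ← Finset.filter_filter, Finset.card_filter]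

theorem card_stageVisits_le (L j : ℕ) : (stageVisits H vis L j).card ≤ stageLength H j := by
  rw [card_stageVisits]
  calc _ ≤ (Finset.Ico (stageSum H j) (stageSum H (j + 1))).card := by
        apply Finset.card_le_card; intro c; simp
    _ = stageLength H j := by rw [Nat.card_Ico, stageSum_succ]; omega

theorem card_stageVisits_eq {L j : ℕ} (h : stageSum H (j + 1) ≤ visitCount vis L) :
    (stageVisits H vis L j).card = stageLength H j := by
  rw [card_stageVisits]
  have : {c ∈ Finset.range (visitCount vis L) | stageSum H j ≤ c ∧ c < stageSum H (j + 1)}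
      = Finset.Ico (stageSum H j) (stageSum H (j + 1)) := by
    ext c; simp; omega
  rw [this, Nat.card_Ico, stageSum_succ]; omega

theorem stageVisits_stable {k L j : ℕ} (hkL : k ≤ L)
    (h : stageSum H (j + 1) ≤ visitCount vis k) :
    stageVisits H vis L j = stageVisits H vis k j := by
  ext i
  simp only [stageVisits, Finset.mem_filter, Finset.mem_range]
  constructor
  · rintro ⟨h1, h2, h3, h4⟩
    refine ⟨?_, h2, h3, h4⟩
    by_contra hc
    have := visitCount_mono (vis := vis) (not_lt.1 hc)
    omega
  · rintro ⟨h1, h2⟩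
    exact ⟨by omega, h2⟩

theorem stageVisits_succ_of_visit {k j : ℕ} (hv : vis k)
    (h : stageSum H j ≤ visitCount vis k ∧ visitCount vis k < stageSum H (j + 1)) :
    stageVisits H vis (k + 1) j = insert k (stageVisits H vis k j) := by
  classical
  simp only [stageVisits]
  rw [Finset.range_add_one, Finset.filter_insert, if_pos ⟨hv, h⟩]

theorem stageVisits_succ_of_not {k j : ℕ} (hv : ¬ vis k) :
    stageVisits H vis (k + 1) j = stageVisits H vis k j := by
  classical
  simp only [stageVisits]
  rw [Finset.range_add_one, Finset.filter_insert, if_neg (fun h => hv h.1)]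

theorem notMem_stageVisits {k j : ℕ} : k ∉ stageVisits H vis k j := by simp [stageVisits]

theorem stageVisits_eq_empty {k j : ℕ} (h : visitCount vis k ≤ stageSum H j) :
    stageVisits H vis k j = ∅ := by
  rw [← Finset.card_eq_zero, card_stageVisits, Finset.card_eq_zero]
  ext c; simp; omega

/-- The optimistic estimate computed from stage `j`. -/
noncomputable def stageValue (H : ℕ) (ι : ℝ) (vis : ℕ → Prop) (R v : ℕ → ℝ) (k j : ℕ) : ℝ :=
  (∑ i ∈ stageVisits H vis k j, (R i + v i)) / stageLength H j + bonus H ι (stageLength H j)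

/-- What an entry contains when the count is in stage `j`. -/
structure EntryInv (H : ℕ) (ι q₀ : ℝ) (vis : ℕ → Prop) (R v : ℕ → ℝ) (k : ℕ) (x : Entry)
    (j : ℕ) : Prop where
  count : x.N = visitCount vis k
  stage : stageSum H j ≤ x.N ∧ x.N < stageSum H (j + 1)
  stageCount : x.Nc + stageSum H j = x.N
  rc : x.rc = ∑ i ∈ stageVisits H vis k j, R i
  vc : x.vc = ∑ i ∈ stageVisits H vis k j, v i
  le_init : x.Q ≤ q₀
  le_value : ∀ i < j, x.Q ≤ stageValue H ι vis R v k i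
  ge : ∀ y ≤ q₀, (∀ i < j, y ≤ stageValue H ι vis R v k i) → y ≤ x.Q

/-- The fields `le_value` and `ge` of the invariant together say that `Q` is the minimum of the
initial value and the estimates of the completed stages. Time counts episodes from the start of an
epoch. Nothing is assumed about the tables after the last of its `L` episodes, where they may be
reset. -/
theorem entryInv (hH : 0 < H) {ι q₀ : ℝ} {R v : ℕ → ℝ} {x : ℕ → Entry} {L : ℕ}
    (h0 : x 0 = ⟨q₀, 0, 0, 0, 0⟩)
    (hstep : ∀ k, k + 1 < L → vis k → x (k + 1) = (x k).step H ι (R k) (v k))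
    (hstay : ∀ k, k + 1 < L → ¬ vis k → x (k + 1) = x k) (k : ℕ) (hk : k < L) :
    ∃ j, EntryInv H ι q₀ vis R v k (x k) j := by
  induction k with
  | zero =>
    refine ⟨0, ?_⟩
    rw [h0]
    refine ⟨by simp, ?_, by simp, ?_, ?_, le_rfl, by simp, fun y hy _ => hy⟩
    · simpa [stageSum_succ] using stageLength_pos hH 0
    · rw [stageVisits_eq_empty (by simp)]; simp
    · rw [stageVisits_eq_empty (by simp)]; simp
  | succ k ih =>
    obtain ⟨j, I⟩ := ih (by omega)
    by_cases hv : vis k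
    · have hc : visitCount vis (k + 1) = visitCount vis k + 1 := by
        rw [visitCount_succ, if_pos hv]
      have hst := I.stage
      rw [I.count] at hst
      have hins := stageVisits_succ_of_visit (H := H) hv hst
      -- The sample of a completed stage is frozen.
      have hval : ∀ i < j, stageValue H ι vis R v (k + 1) i = stageValue H ι vis R v k i := by
        intro i hi
        unfold stageValue
        rw [stageVisits_stable (Nat.le_succ k)]
        exact ((stageSum_strictMono hH).monotone (show i + 1 ≤ j from hi)).trans hst.1
      rw [hstep k hk hv]
      unfold Entry.step
      have hiff := succ_mem_stageEnds_iff hH I.stage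
      by_cases hend : (x k).N + 1 ∈ stageEnds H
      · rw [if_pos hend]
        rw [hiff] at hend
        -- At the end of a stage the algorithm divides by exactly the stage length.
        have hNc : (x k).Nc + 1 = stageLength H j := by
          have := I.stageCount
          rw [stageSum_succ] at hend
          omega
        have hnew : (((x k).rc + R k) / (((x k).Nc + 1 : ℕ) : ℝ)
            + ((x k).vc + v k) / (((x k).Nc + 1 : ℕ) : ℝ)
            + bonus H ι ((x k).Nc + 1)) = stageValue H ι vis R v (k + 1) j := by
          rw [hNc, stageValue, hins, Finset.sum_insert notMem_stageVisits, I.rc, I.vc,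
            Finset.sum_add_distrib]
          ring
        rw [hnew]
        refine ⟨j + 1, by simp [I.count, hc], ?_, ?_, ?_, ?_, ?_, ?_, ?_⟩
        · dsimp only
          rw [hend]
          exact ⟨le_rfl, stageSum_strictMono hH (Nat.lt_succ_self _)⟩
        · dsimp only; omega
        · dsimp only
          rw [stageVisits_eq_empty (by rw [hc, ← I.count, hend])]; simp
        · dsimp only
          rw [stageVisits_eq_empty (by rw [hc, ← I.count, hend])]; simp
        · exact (min_le_right _ _).trans I.le_init
        · intro i hi
          rcases (Nat.lt_succ_iff.1 hi).lt_or_eq with h | h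
          · rw [hval i h]; exact (min_le_right _ _).trans (I.le_value i h)
          · subst h; exact min_le_left _ _
        · intro y hy h
          refine le_min (h j (Nat.lt_succ_self j)) (I.ge y hy fun i hi => ?_)
          rw [← hval i hi]; exact h i (by omega)
      · rw [if_neg hend]
        rw [hiff] at hend
        refine ⟨j, by simp [I.count, hc], ?_, ?_, ?_, ?_, I.le_init, ?_, ?_⟩
        · have := I.stage; dsimp only; omega
        · have := I.stageCount; dsimp only; omega
        · dsimp only
          rw [hins, Finset.sum_insert notMem_stageVisits, I.rc]; ring
        · dsimp only
          rw [hins, Finset.sum_insert notMem_stageVisits, I.vc]; ring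
        · intro i hi; rw [hval i hi]; exact I.le_value i hi
        · intro y hy h
          exact I.ge y hy fun i hi => by rw [← hval i hi]; exact h i hi
    · rw [hstay k hk hv]
      have hc : visitCount vis (k + 1) = visitCount vis k := by rw [visitCount_succ, if_neg hv]; rfl
      have hS : ∀ i, stageVisits H vis (k + 1) i = stageVisits H vis k i := fun i =>
        stageVisits_succ_of_not hv
      refine ⟨j, by rw [hc, I.count], I.stage, I.stageCount, by rw [hS, I.rc], by rw [hS, I.vc],
        I.le_init, ?_, ?_⟩
      · intro i hi; unfold stageValue; rw [hS]; exact I.le_value i hi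
      · intro y hy h
        refine I.ge y hy fun i hi => ?_
        have := h i hi
        unfold stageValue at this; rwa [hS] at this

end Visits

end RestartQ

/-! ### One entry during an epoch: optimism, gap after a stage, and sum of gaps. -/

namespace RestartQ

variable {H : ℕ} {vis : ℕ → Prop}

/-- The first summand of the bonus already covers the Hoeffding deviation of reward plus next value;
the second is overhead. -/
theorem mul_sqrt_le_bonus (H : ℕ) {ι : ℝ} (n : ℕ) :
    (H : ℝ) * Real.sqrt (ι / n) ≤ bonus H ι n := by
  have : Real.sqrt ((H : ℝ) ^ 2 / n * ι) = H * Real.sqrt (ι / n) := by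
    rw [← Real.sqrt_sq (Nat.cast_nonneg (α := ℝ) H), ← Real.sqrt_mul (by positivity),
      Real.sqrt_sq (Nat.cast_nonneg (α := ℝ) H)]
    congr 1; ring
  rw [bonus, this]
  have := Real.sqrt_nonneg (1 / n * ι)
  linarith

theorem bonus_le (hH : 0 < H) (ι : ℝ) (n : ℕ) :
    bonus H ι n ≤ 2 * (H * Real.sqrt (ι / n)) := by
  have h1 : Real.sqrt ((H : ℝ) ^ 2 / n * ι) = H * Real.sqrt (ι / n) := by
    rw [← Real.sqrt_sq (Nat.cast_nonneg (α := ℝ) H), ← Real.sqrt_mul (by positivity),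
      Real.sqrt_sq (Nat.cast_nonneg (α := ℝ) H)]
    congr 1; ring
  have h2 : Real.sqrt (1 / n * ι) = Real.sqrt (ι / n) := by congr 1; ring
  rw [bonus, h1, h2]
  have h3 : (1 : ℝ) ≤ H := by exact_mod_cast hH
  nlinarith [Real.sqrt_nonneg (ι / n)]

/-- Concentration of the data of every stage of an entry. -/
def StageConc (H : ℕ) (ι : ℝ) (vis : ℕ → Prop) (L : ℕ) (X : ℕ → ℝ) : Prop :=
  ∀ i < L, |∑ l ∈ stageVisits H vis L i, X l|
    ≤ stageLength H i * (H * Real.sqrt (ι / stageLength H i))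

section

variable {ι q₀ : ℝ} {R v u y : ℕ → ℝ} {k L j : ℕ} {x : Entry}

theorem EntryInv.lt_of_stage (hH : 0 < H) (I : EntryInv H ι q₀ vis R v k x j) (hk : k < L)
    {i : ℕ} (hi : i < j) : i < L := by
  have h1 := (stageSum_strictMono hH).le_apply (x := j)
  have h2 := I.stage.1
  have h3 := I.count
  have h4 := visitCount_le (vis := vis) k
  omega

theorem EntryInv.stageVisits_eq (hH : 0 < H) (I : EntryInv H ι q₀ vis R v k x j) (hk : k < L)
    {i : ℕ} (hi : i < j) : stageVisits H vis L i = stageVisits H vis k i ∧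
      (stageVisits H vis L i).card = stageLength H i := by
  have h : stageSum H (i + 1) ≤ visitCount vis k :=
    ((stageSum_strictMono hH).monotone (show i + 1 ≤ j from hi)).trans
      (I.stage.1.trans I.count.le)
  exact ⟨stageVisits_stable hk.le h,
    card_stageVisits_eq (h.trans (visitCount_mono hk.le))⟩

theorem vis_of_mem_stageVisits {l i : ℕ} (h : l ∈ stageVisits H vis L i) : vis l := by
  classical
  exact (Finset.mem_filter.1 h).2.1

theorem lt_of_mem_stageVisits {l i : ℕ} (h : l ∈ stageVisits H vis L i) : l < L := by
  classical
  exact Finset.mem_range.1 (Finset.mem_filter.1 h).1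

/-- In each completed stage the average of `R + u` is, up to the deviation covered by the bonus, at
least the average of the means `y`, hence at least `q`. Replacing `u` by the larger table values `v`
only helps. The comparison of `u` and `v` is needed at earlier times only, which permits an
induction over episodes. -/
theorem EntryInv.optimistic (hH : 0 < H) (I : EntryInv H ι q₀ vis R v k x j) (hk : k < L)
    {q : ℝ} (hq : q ≤ q₀) (huv : ∀ l < k, vis l → u l ≤ v l) (hy : ∀ l < L, vis l → q ≤ y l)
    (hc : StageConc H ι vis L fun l => R l + u l - y l) : q ≤ x.Q := by
  refine I.ge q hq fun i hi => ?_
  obtain ⟨hS, hcard⟩ := I.stageVisits_eq hH hk hi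
  have hn : (0 : ℝ) < stageLength H i := by exact_mod_cast stageLength_pos hH i
  have h1 := (abs_le.1 (hc i (I.lt_of_stage hH hk hi))).1
  have h2 : ∑ l ∈ stageVisits H vis L i, (R l + u l - y l)
      ≤ ∑ l ∈ stageVisits H vis k i, (R l + v l) - stageLength H i * q := by
    rw [hS] at hcard ⊢
    rw [← hcard, ← nsmul_eq_mul, ← Finset.sum_const, ← Finset.sum_sub_distrib]
    refine Finset.sum_le_sum fun l hl => ?_
    have := huv l (lt_of_mem_stageVisits hl) (vis_of_mem_stageVisits hl)
    have := hy l ((lt_of_mem_stageVisits hl).trans hk) (vis_of_mem_stageVisits hl)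
    linarith
  have h3 := mul_sqrt_le_bonus H (ι := ι) (stageLength H i)
  have h4 : q - H * Real.sqrt (ι / stageLength H i)
      ≤ (∑ l ∈ stageVisits H vis k i, (R l + v l)) / stageLength H i := by
    rw [le_div_iff₀ hn]; nlinarith
  rw [stageValue]
  linarith

/-- Only the most recent completed stage is used. The constant 3 counts one deviation of the sample
and a bonus of at most two deviations; `ε` is the drift of the means. -/
theorem EntryInv.gap_le (hH : 0 < H) (I : EntryInv H ι q₀ vis R v k x (j + 1)) (hk : k < L)
    {q ε : ℝ} (hy : ∀ l < L, vis l → y l ≤ q + ε)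
    (hc : StageConc H ι vis L fun l => R l + u l - y l) :
    x.Q - q ≤ (∑ l ∈ stageVisits H vis L j, (v l - u l)) / stageLength H j + ε
      + 3 * (H * Real.sqrt (ι / stageLength H j)) := by
  obtain ⟨hS, hcard⟩ := I.stageVisits_eq hH hk (Nat.lt_succ_self j)
  have hn : (0 : ℝ) < stageLength H j := by exact_mod_cast stageLength_pos hH j
  have h0 := I.le_value j (Nat.lt_succ_self j)
  have h1 := (abs_le.1 (hc j (I.lt_of_stage hH hk (Nat.lt_succ_self j)))).2
  have h2 : ∑ l ∈ stageVisits H vis k j, (R l + v l)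
      ≤ ∑ l ∈ stageVisits H vis L j, (R l + u l - y l)
        + ∑ l ∈ stageVisits H vis L j, (v l - u l) + stageLength H j * (q + ε) := by
    rw [← hcard, ← hS, ← nsmul_eq_mul, ← Finset.sum_const, ← Finset.sum_add_distrib,
      ← Finset.sum_add_distrib]
    refine Finset.sum_le_sum fun l hl => ?_
    have := hy l (lt_of_mem_stageVisits hl) (vis_of_mem_stageVisits hl)
    linarith
  have h3 := bonus_le hH ι (stageLength H j)
  have h4 : (∑ l ∈ stageVisits H vis k j, (R l + v l)) / stageLength H j
      ≤ (∑ l ∈ stageVisits H vis L j, (v l - u l)) / stageLength H j + (q + ε)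
        + H * Real.sqrt (ι / stageLength H j) := by
    rw [div_le_iff₀ hn, add_mul, add_mul, div_mul_cancel₀ _ hn.ne']
    linarith
  rw [stageValue] at h0
  linarith

end

theorem sum_inv_sqrt_le (n : ℕ) :
    ∑ c ∈ Finset.range n, 1 / Real.sqrt ((c : ℝ) + 1) ≤ 2 * Real.sqrt n := by
  induction n with
  | zero => simp
  | succ n ih =>
    rw [Finset.sum_range_succ]
    have hp : 0 < Real.sqrt ((n : ℝ) + 1) := Real.sqrt_pos.2 (by positivity)
    have h1 : Real.sqrt ((n : ℝ) + 1) ^ 2 = n + 1 := Real.sq_sqrt (by positivity)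
    have h2 : Real.sqrt (n : ℝ) ^ 2 = n := Real.sq_sqrt (by positivity)
    have h3 : 1 / Real.sqrt ((n : ℝ) + 1) ≤ 2 * Real.sqrt ((n : ℝ) + 1) - 2 * Real.sqrt n := by
      rw [div_le_iff₀ hp]
      nlinarith [sq_nonneg (Real.sqrt ((n : ℝ) + 1) - Real.sqrt n)]
    push_cast
    linarith

/-- Trades the stage length for the visit count through `c + 1 ≤ 5 H e_j`, so that the deviations
can be summed over visits; 7 exceeds `3√5`. -/
theorem mul_sqrt_div_stageLength_le (hH : 0 < H) {ι : ℝ} (hι : 0 ≤ ι) {c j : ℕ}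
    (hc : c < stageSum H (j + 2)) :
    3 * (H * Real.sqrt (ι / stageLength H j))
      ≤ 7 * (H * Real.sqrt H * Real.sqrt ι) * (1 / Real.sqrt ((c : ℝ) + 1)) := by
  have hn : (0 : ℝ) < stageLength H j := by exact_mod_cast stageLength_pos hH j
  have h1 : (c : ℝ) + 1 ≤ 5 * H * stageLength H j := by
    exact_mod_cast (Nat.succ_le_of_lt hc).trans (stageSum_add_two_le hH j)
  have hp : 0 < Real.sqrt ((c : ℝ) + 1) := Real.sqrt_pos.2 (by positivity)
  have h2 : Real.sqrt (ι / stageLength H j) * Real.sqrt ((c : ℝ) + 1)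
      ≤ 7 / 3 * (Real.sqrt H * Real.sqrt ι) := by
    rw [← Real.sqrt_mul (by positivity), ← Real.sqrt_mul (by positivity)]
    have : (7 / 3 : ℝ) = Real.sqrt ((7 / 3) ^ 2) := by rw [Real.sqrt_sq (by norm_num)]
    rw [this, ← Real.sqrt_mul (by positivity)]
    apply Real.sqrt_le_sqrt
    rw [div_mul_eq_mul_div, div_le_iff₀ hn]
    have : ι * ((c : ℝ) + 1) ≤ ι * (5 * H * stageLength H j) := mul_le_mul_of_nonneg_left h1 hι
    have h5 : 0 ≤ ι * (H * stageLength H j : ℝ) := by positivity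
    nlinarith
  rw [mul_one_div, le_div_iff₀ hp]
  have hH0 : (0 : ℝ) ≤ H := by positivity
  nlinarith [mul_le_mul_of_nonneg_left h2 hH0]

open Classical in
/-- The sum over the visits of the gaps of an entry. -/
theorem sum_gap_le (hH : 0 < H) {ι ε : ℝ} (hι : 0 ≤ ι) {L : ℕ} {gap φ : ℕ → ℝ}
    (hφ : ∀ l < L, vis l → 0 ≤ φ l)
    (h0 : ∀ k < L, vis k → visitCount vis k < stageSum H 1 → gap k ≤ H + ε)
    (h1 : ∀ k < L, vis k → ∀ j, stageSum H (j + 1) ≤ visitCount vis k →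
      visitCount vis k < stageSum H (j + 2) →
      gap k ≤ (∑ l ∈ stageVisits H vis L j, φ l) / stageLength H j + ε
        + 3 * (H * Real.sqrt (ι / stageLength H j))) :
    ∑ k ∈ Finset.range L with vis k, gap k ≤
      H * H + (1 + 1 / H) * ∑ k ∈ Finset.range L with vis k, φ k + visitCount vis L * ε
        + 14 * (H * Real.sqrt H * Real.sqrt ι) * Real.sqrt (visitCount vis L) := by
  have hH' : (0 : ℝ) < H := by exact_mod_cast hH
  set B : ℝ := 7 * (H * Real.sqrt H * Real.sqrt ι) with hB
  have hB0 : 0 ≤ B := by positivity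
  set a : ℕ → ℝ := fun j => (∑ l ∈ stageVisits H vis L j, φ l) / stageLength H j with ha
  have hs : ∀ j, 0 ≤ ∑ l ∈ stageVisits H vis L j, φ l := fun j =>
    Finset.sum_nonneg fun l hl => hφ l (lt_of_mem_stageVisits hl) (vis_of_mem_stageVisits hl)
  have ha0 : ∀ j, 0 ≤ a j := fun j => div_nonneg (hs j) (by positivity)
  -- The part of the bound that depends on the counter alone: the trivial bound `H` on the first `H`
  -- visits, when no stage is complete, and the deviation.
  let f : ℕ → ℝ := fun c => (if c < H then (H : ℝ) else 0) + B * (1 / Real.sqrt ((c : ℝ) + 1))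
  have hsum2 : ∀ k, 0 ≤ ∑ j ∈ Finset.range L,
      if k ∈ stageVisits H vis L (j + 1) then a j else 0 := fun k =>
    Finset.sum_nonneg fun j _ => by split_ifs <;> simp [ha0]
  -- A visit in stage `j + 1` pays the average of `φ` over stage `j`. Writing this as a sum over all
  -- `j` prepares the exchange of summations.
  have key : ∀ k ∈ ({k ∈ Finset.range L | vis k} : Finset ℕ), gap k ≤ f (visitCount vis k)
      + (∑ j ∈ Finset.range L, if k ∈ stageVisits H vis L (j + 1) then a j else 0) + ε := by
    intro k hk
    rw [Finset.mem_filter, Finset.mem_range] at hk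
    obtain ⟨j, hj⟩ := exists_stage hH (visitCount vis k)
    cases j with
    | zero =>
      have h := h0 k hk.1 hk.2 hj.2
      have hlt : visitCount vis k < H := by simpa [stageSum_succ, stageLength] using hj.2
      have : f (visitCount vis k) = H + B * (1 / Real.sqrt ((visitCount vis k : ℝ) + 1)) := by
        simp only [f, if_pos hlt]
      have h2 : 0 ≤ B * (1 / Real.sqrt ((visitCount vis k : ℝ) + 1)) := by positivity
      linarith [hsum2 k]
    | succ j =>
      have h := h1 k hk.1 hk.2 j hj.1 hj.2
      have hmem : k ∈ stageVisits H vis L (j + 1) :=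
        Finset.mem_filter.2 ⟨Finset.mem_range.2 hk.1, hk.2, hj⟩
      have hjL : j < L := by
        have := (stageSum_strictMono hH).le_apply (x := j + 1)
        have := visitCount_le (vis := vis) k
        omega
      have h2 : a j ≤ ∑ j ∈ Finset.range L,
          if k ∈ stageVisits H vis L (j + 1) then a j else 0 := by
        have := Finset.single_le_sum
          (f := fun j => if k ∈ stageVisits H vis L (j + 1) then a j else 0)
          (fun i _ => by split_ifs <;> simp [ha0]) (Finset.mem_range.2 hjL)
        simpa only [if_pos hmem] using this
      have h3 := mul_sqrt_div_stageLength_le hH hι hj.2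
      have h4 : B * (1 / Real.sqrt ((visitCount vis k : ℝ) + 1)) ≤ f (visitCount vis k) := by
        simp only [f]; split_ifs <;> linarith
      linarith
  refine (Finset.sum_le_sum key).trans ?_
  rw [Finset.sum_add_distrib, Finset.sum_add_distrib, sum_visits, Finset.sum_const, nsmul_eq_mul]
  have e1 : ∑ c ∈ Finset.range (visitCount vis L), f c
      ≤ H * H + 2 * B * Real.sqrt (visitCount vis L) := by
    simp only [f]
    rw [Finset.sum_add_distrib, ← Finset.mul_sum]
    have := mul_le_mul_of_nonneg_left (sum_inv_sqrt_le (visitCount vis L)) hB0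
    have h2 : ∑ c ∈ Finset.range (visitCount vis L), (if c < H then (H : ℝ) else 0) ≤ H * H := by
      rw [← Finset.sum_filter, Finset.sum_const, nsmul_eq_mul]
      refine mul_le_mul_of_nonneg_right ?_ hH'.le
      have : ({c ∈ Finset.range (visitCount vis L) | c < H} : Finset ℕ).card
          ≤ (Finset.range H).card := Finset.card_le_card (by intro c; simp)
      rw [Finset.card_range] at this
      exact_mod_cast this
    linarith
  -- Stage `j + 1` has at most `(1 + 1/H) e_j` visits, each paying `1/e_j` of the sum over stage
  -- `j`. The stages are disjoint, so every `φ l` is paid at most `1 + 1/H` times.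
  have e2 : ∑ k ∈ Finset.range L with vis k, (∑ j ∈ Finset.range L,
      if k ∈ stageVisits H vis L (j + 1) then a j else 0)
      ≤ (1 + 1 / H) * ∑ k ∈ Finset.range L with vis k, φ k := by
    rw [Finset.sum_comm]
    have h5 : ∀ j ∈ Finset.range L, ∑ k ∈ Finset.range L with vis k,
        (if k ∈ stageVisits H vis L (j + 1) then a j else 0)
        ≤ (1 + 1 / H) * ∑ l ∈ stageVisits H vis L j, φ l := by
      intro j _
      rw [← Finset.sum_filter, Finset.sum_const, nsmul_eq_mul]
      have hn : (0 : ℝ) < stageLength H j := by exact_mod_cast stageLength_pos hH j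
      have hcard : ((({k ∈ ({k ∈ Finset.range L | vis k} : Finset ℕ) |
          k ∈ stageVisits H vis L (j + 1)} : Finset ℕ).card : ℕ) : ℝ)
          ≤ (1 + 1 / H) * stageLength H j := by
        have h6 : ({k ∈ ({k ∈ Finset.range L | vis k} : Finset ℕ) |
            k ∈ stageVisits H vis L (j + 1)} : Finset ℕ).card ≤ stageLength H (j + 1) :=
          (Finset.card_le_card (by intro c; simp)).trans (card_stageVisits_le (vis := vis) L (j + 1))
        have h7 : (H : ℝ) * stageLength H (j + 1) ≤ (H + 1) * stageLength H j := by
          exact_mod_cast mul_stageLength_succ_le j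
        have h8 : ((stageLength H (j + 1) : ℕ) : ℝ) ≤ (1 + 1 / H) * stageLength H j := by
          rw [show (1 + 1 / (H : ℝ)) = (H + 1) / H by field_simp, div_mul_eq_mul_div,
            le_div_iff₀ hH']
          linarith
        exact le_trans (by exact_mod_cast h6) h8
      calc _ ≤ (1 + 1 / H) * stageLength H j * a j := mul_le_mul_of_nonneg_right hcard (ha0 j)
        _ = _ := by simp only [ha]; field_simp
    refine (Finset.sum_le_sum h5).trans ?_
    rw [← Finset.mul_sum]
    refine mul_le_mul_of_nonneg_left ?_ (by positivity)
    rw [← Finset.sum_biUnion]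
    · refine Finset.sum_le_sum_of_subset_of_nonneg ?_ ?_
      · intro l hl
        obtain ⟨j, _, hj⟩ := Finset.mem_biUnion.1 hl
        exact Finset.mem_filter.2 ⟨Finset.mem_range.2 (lt_of_mem_stageVisits hj),
          vis_of_mem_stageVisits hj⟩
      · intro l hl _
        rw [Finset.mem_filter, Finset.mem_range] at hl
        exact hφ l hl.1 hl.2
    · intro i _ j _ hij
      rw [Function.onFun, Finset.disjoint_left]
      intro l hi hj
      exact hij (stage_unique hH (Finset.mem_filter.1 hi).2.2 (Finset.mem_filter.1 hj).2.2)
  have hcard : (({k ∈ Finset.range L | vis k} : Finset ℕ).card : ℝ) = visitCount vis L := rfl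
  rw [hcard]
  have : 2 * B = 14 * (H * Real.sqrt H * Real.sqrt ι) := by rw [hB]; ring
  rw [← this]
  linarith

end RestartQ

/-! ### From runs of the algorithm to the history of single entries. -/

namespace RestartQ

variable {S A : Type*} {M H : ℕ}

/-- The entry of the tables at `(h,s,a)`. -/
def Tables.entry (σ : Tables S A H) (h : Fin H) (s : S) (a : A) : Entry :=
  ⟨σ.Q h s a, σ.N h s a, σ.Nc h s a, σ.rc h s a, σ.vc h s a⟩

-- Each triple can be followed in isolation: other entries act on it only through the next-state
-- value passed to `Entry.step`.
open Classical in
theorem entry_processStep (ι : ℝ) (σ : Tables S A H) (h : Fin H) (s : S) (a : A) (R : ℝ) (s' : S)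
    (h' : Fin H) (x : S) (b : A) :
    (processStep ι σ h s a R s').entry h' x b =
      if h' = h ∧ x = s ∧ b = a then (σ.entry h s a).step H ι R (σ.V h.succ s')
      else σ.entry h' x b := by
  unfold processStep Entry.step Tables.entry bonus setEntry
  by_cases hN : σ.N h s a + 1 ∈ stageEnds H <;> by_cases hh : h' = h ∧ x = s ∧ b = a <;>
    simp only [hN, hh, if_true, if_false, and_self]

open Classical in
theorem processStep_V_of_ne (ι : ℝ) (σ : Tables S A H) (h : Fin H) (s : S) (a : A) (R : ℝ) (s' : S)
    {h' : Fin (H + 1)} (hne : h' ≠ h.castSucc) :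
    (processStep ι σ h s a R s').V h' = σ.V h' := by
  unfold processStep
  dsimp only
  split_ifs
  · funext x
    simp [hne]
  · rfl

/-- The values are the maxima of the `Q`-values, and vanish at the end of the episode. -/
structure Tables.Greedy (σ : Tables S A H) : Prop where
  V_eq : ∀ h s, σ.V (Fin.castSucc h) s = ⨆ a, σ.Q h s a
  V_last : ∀ s, σ.V (Fin.last H) s = 0

theorem greedy_initTables [Nonempty A] : (initTables S A H).Greedy :=
  ⟨fun h s => by simp [initTables], fun s => by simp [initTables]⟩

theorem Tables.Greedy.processStep {σ : Tables S A H} (hσ : σ.Greedy) (ι : ℝ) (h : Fin H) (s : S)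
    (a : A) (R : ℝ) (s' : S) : (processStep ι σ h s a R s').Greedy := by
  constructor
  · intro h' x
    unfold RestartQ.processStep
    dsimp only
    split_ifs with hN
    · dsimp only
      split_ifs with hx
      · obtain ⟨h1, rfl⟩ := hx
        obtain rfl := Fin.castSucc_injective _ h1
        rfl
      · rw [hσ.V_eq]
        congr 1; funext b
        rw [setEntry, if_neg]
        rintro ⟨rfl, rfl, -⟩
        exact hx ⟨rfl, rfl⟩
    · exact hσ.V_eq h' x
  · intro x
    rw [processStep_V_of_ne _ _ _ _ _ _ _ (Fin.castSucc_lt_last h).ne', hσ.V_last]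

section Episode

variable (rule : ArgmaxRule A) (ι : ℝ) (ω : Fin M × Fin H × S × A → ℝ × S) (m : Fin M)
  (σ : Tables S A H) (s₁ : S)

theorem runEpisode_succ {h : ℕ} (hh : h < H) :
    runEpisode rule ι ω m σ s₁ (h + 1) =
      (processStep ι (runEpisode rule ι ω m σ s₁ h).1 ⟨h, hh⟩ (runEpisode rule ι ω m σ s₁ h).2
        (rule.sel ((runEpisode rule ι ω m σ s₁ h).1.Q ⟨h, hh⟩ (runEpisode rule ι ω m σ s₁ h).2))
        (ω (m, ⟨h, hh⟩, (runEpisode rule ι ω m σ s₁ h).2, rule.sel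
          ((runEpisode rule ι ω m σ s₁ h).1.Q ⟨h, hh⟩ (runEpisode rule ι ω m σ s₁ h).2))).1
        (ω (m, ⟨h, hh⟩, (runEpisode rule ι ω m σ s₁ h).2, rule.sel
          ((runEpisode rule ι ω m σ s₁ h).1.Q ⟨h, hh⟩ (runEpisode rule ι ω m σ s₁ h).2))).2,
       (ω (m, ⟨h, hh⟩, (runEpisode rule ι ω m σ s₁ h).2, rule.sel
          ((runEpisode rule ι ω m σ s₁ h).1.Q ⟨h, hh⟩ (runEpisode rule ι ω m σ s₁ h).2))).2) := by
  rw [runEpisode, dif_pos hh]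

theorem greedy_runEpisode (hσ : σ.Greedy) (h : ℕ) : (runEpisode rule ι ω m σ s₁ h).1.Greedy := by
  induction h with
  | zero => exact hσ
  | succ h ih =>
    by_cases hh : h < H
    · rw [runEpisode_succ _ _ _ _ _ _ hh]; exact ih.processStep _ _ _ _ _ _
    · rw [runEpisode, dif_neg hh]; exact ih

theorem runEpisode_entry_of_le (h : ℕ) (h' : Fin H) (hle : h ≤ h') :
    (runEpisode rule ι ω m σ s₁ h).1.entry h' = σ.entry h' := by
  induction h with
  | zero => rfl
  | succ h ih =>
    have hh : h < H := by omega
    rw [runEpisode_succ _ _ _ _ _ _ hh, ← ih (by omega)]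
    funext x b
    rw [entry_processStep, if_neg]
    rintro ⟨h1, -⟩
    rw [h1] at hle
    simp at hle

/-- The row of `V` read at step `h` is that of step `h + 1`, which has not been rewritten yet; so
all values read during an episode date from its start. -/
theorem runEpisode_V_of_le (h : ℕ) (h' : Fin (H + 1)) (hle : h ≤ h') :
    (runEpisode rule ι ω m σ s₁ h).1.V h' = σ.V h' := by
  induction h with
  | zero => rfl
  | succ h ih =>
    have hh : h < H := by omega
    rw [runEpisode_succ _ _ _ _ _ _ hh, ← ih (by omega)]
    refine processStep_V_of_ne _ _ _ _ _ _ _ ?_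
    intro h1
    rw [h1] at hle
    simp at hle

theorem runEpisode_Q_eq (h : Fin H) : (runEpisode rule ι ω m σ s₁ h).1.Q h = σ.Q h := by
  have := runEpisode_entry_of_le rule ι ω m σ s₁ h h le_rfl
  funext s a
  exact congrArg Entry.Q (congrFun (congrFun this s) a)

theorem runEpisode_snd_succ (h : Fin H) :
    (runEpisode rule ι ω m σ s₁ (h + 1)).2 = (ω (m, h, (runEpisode rule ι ω m σ s₁ h).2,
      rule.sel (σ.Q h (runEpisode rule ι ω m σ s₁ h).2))).2 := by
  rw [runEpisode_succ _ _ _ _ _ _ h.2]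
  simp only [Fin.eta, runEpisode_Q_eq]

open Classical in
theorem runEpisode_entry_of_lt (h : Fin H) (s : S) (a : A) (h' : ℕ) (hlt : (h : ℕ) < h')
    (hle : h' ≤ H) :
    (runEpisode rule ι ω m σ s₁ h').1.entry h s a =
      if (runEpisode rule ι ω m σ s₁ h).2 = s ∧
          rule.sel (σ.Q h (runEpisode rule ι ω m σ s₁ h).2) = a then
        (σ.entry h s a).step H ι (ω (m, h, s, a)).1
          (σ.V h.succ (runEpisode rule ι ω m σ s₁ (h + 1)).2)
      else σ.entry h s a := by
  induction h', hlt using Nat.le_induction with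
  | base =>
    rw [runEpisode_snd_succ]
    rw [runEpisode_succ _ _ _ _ _ _ h.2, entry_processStep]
    simp only [Fin.eta, runEpisode_Q_eq, true_and]
    rw [runEpisode_entry_of_le _ _ _ _ _ _ _ _ le_rfl, runEpisode_V_of_le _ _ _ _ _ _ _ _ (by simp)]
    by_cases hc : (runEpisode rule ι ω m σ s₁ h).2 = s ∧
          rule.sel (σ.Q h (runEpisode rule ι ω m σ s₁ h).2) = a
    · rw [if_pos hc, if_pos ⟨hc.1.symm, hc.2.symm⟩]
      obtain ⟨h1, h2⟩ := hc
      rw [h1] at h2 ⊢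
      rw [h2]
    · rw [if_neg hc, if_neg (fun h => hc ⟨h.1.symm, h.2.symm⟩)]
  | succ h' hlt ih =>
    have hh : h' < H := by omega
    rw [← ih (by omega), runEpisode_succ _ _ _ _ _ _ hh, entry_processStep, if_neg]
    rintro ⟨h1, -⟩
    rw [h1] at hlt
    simp at hlt

theorem runEpisode_congr {ω ω' : Fin M × Fin H × S × A → ℝ × S} (h : ℕ)
    (hω : ∀ h' : Fin H, (h' : ℕ) < h → ∀ s a, ω (m, h', s, a) = ω' (m, h', s, a)) :
    runEpisode rule ι ω m σ s₁ h = runEpisode rule ι ω' m σ s₁ h := by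
  induction h with
  | zero => rfl
  | succ h ih =>
    by_cases hh : h < H
    · rw [runEpisode_succ _ _ _ _ _ _ hh, runEpisode_succ _ _ _ _ _ _ hh,
        ih fun h' hlt => hω h' (by omega), hω ⟨h, hh⟩ (Nat.lt_succ_self h)]
    · rw [runEpisode, runEpisode, dif_neg hh, dif_neg hh, ih fun h' hlt => hω h' (by omega)]

end Episode

section Run

variable [NeZero M] (rule : ArgmaxRule A) (D : ℕ) (δ : ℝ) (s₁ : Fin M → S)
  (ω : Fin M × Fin H × S × A → ℝ × S)

/-- Episodes are indexed by natural numbers through `Fin.ofNat`, so that `m₀ + k` needs no proof of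
a bound; below `M` the wrap-around is invisible. -/
theorem ofNat_eq {m : ℕ} (hm : m < M) : Fin.ofNat M m = ⟨m, hm⟩ :=
  Fin.ext (Nat.mod_eq_of_lt hm)

/-- The number of episodes of an epoch. -/
def epochLength (M D : ℕ) : ℕ := ⌈(M : ℚ) / D⌉₊

/-- The state at step `h` of episode `m`. -/
noncomputable def runState (m h : ℕ) : S :=
  (runEpisode rule (Real.log (2 / δ)) ω (Fin.ofNat M m) (tablesAt rule D δ s₁ ω m)
    (s₁ (Fin.ofNat M m)) h).2

/-- The action at step `h` of episode `m`. -/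
noncomputable def runAction (m : ℕ) (h : Fin H) : A :=
  rule.sel ((tablesAt rule D δ s₁ ω m).Q h (runState rule D δ s₁ ω m h))

theorem runState_zero (m : ℕ) : runState rule D δ s₁ ω m 0 = s₁ (Fin.ofNat M m) := rfl

theorem runState_succ (m : ℕ) (h : Fin H) : runState rule D δ s₁ ω m (h + 1) =
    (ω (Fin.ofNat M m, h, runState rule D δ s₁ ω m h, runAction rule D δ s₁ ω m h)).2 :=
  runEpisode_snd_succ _ _ _ _ _ _ h

theorem runAction_eq_policyAt (m : ℕ) (hm : m < M) (h : Fin H) : runAction rule D δ s₁ ω m h =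
    policyAt rule D δ s₁ ω ⟨m, hm⟩ h (runState rule D δ s₁ ω m h) := rfl

theorem greedy_tablesAt [Nonempty A] (m : ℕ) : (tablesAt rule D δ s₁ ω m).Greedy := by
  induction m with
  | zero => exact greedy_initTables
  | succ m ih =>
    rw [tablesAt]
    split_ifs
    · exact greedy_initTables
    · exact greedy_runEpisode _ _ _ _ _ _ ih _
    · exact greedy_initTables

theorem tablesAt_epoch_start {m : ℕ} (hm : m % epochLength M D = 0) :
    tablesAt rule D δ s₁ ω m = initTables S A H := by
  cases m with
  | zero => rfl
  | succ m => rw [tablesAt]; exact if_pos hm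

/-- Episode `m` visits the pair `(s,a)` at step `h`. -/
def Visits (h : Fin H) (s : S) (a : A) (m : ℕ) : Prop :=
  runState rule D δ s₁ ω m h = s ∧ runAction rule D δ s₁ ω m h = a

open Classical in
theorem entry_tablesAt_succ {m : ℕ} (hm : m + 1 < M) (hK : (m + 1) % epochLength M D ≠ 0)
    (h : Fin H) (s : S) (a : A) :
    (tablesAt rule D δ s₁ ω (m + 1)).entry h s a =
      if Visits rule D δ s₁ ω h s a m then
        ((tablesAt rule D δ s₁ ω m).entry h s a).step H (Real.log (2 / δ))
          (ω (Fin.ofNat M m, h, s, a)).1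
          ((tablesAt rule D δ s₁ ω m).V h.succ (runState rule D δ s₁ ω m (h + 1)))
      else (tablesAt rule D δ s₁ ω m).entry h s a := by
  have hm' : m < M := by omega
  unfold epochLength at hK
  rw [tablesAt, if_neg hK, dif_pos hm', ← ofNat_eq hm']
  rw [runEpisode_entry_of_lt _ _ _ _ _ _ h s a H h.2 le_rfl]
  exact if_congr Iff.rfl rfl rfl

theorem tablesAt_congr {ω ω' : Fin M × Fin H × S × A → ℝ × S} (m : ℕ)
    (hω : ∀ m' : Fin M, (m' : ℕ) < m → ∀ h s a, ω (m', h, s, a) = ω' (m', h, s, a)) :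
    tablesAt rule D δ s₁ ω m = tablesAt rule D δ s₁ ω' m := by
  induction m with
  | zero => rfl
  | succ m ih =>
    rw [tablesAt, tablesAt, ih fun m' hm' => hω m' (by omega)]
    split_ifs with h1 h2
    · rfl
    · rw [runEpisode_congr]
      intro h' _ s a
      exact hω ⟨m, h2⟩ (Nat.lt_succ_self m) h' s a
    · rfl

/-- Non-anticipation: the current state depends only on coordinates of earlier times. This is what
later makes the visited coordinates predictable. -/
theorem runState_congr {ω ω' : Fin M × Fin H × S × A → ℝ × S} {m h : ℕ} (hm : m < M)
    (h1 : ∀ m' : Fin M, (m' : ℕ) < m → ∀ h s a, ω (m', h, s, a) = ω' (m', h, s, a))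
    (h2 : ∀ h' : Fin H, (h' : ℕ) < h → ∀ s a, ω (⟨m, hm⟩, h', s, a) = ω' (⟨m, hm⟩, h', s, a)) :
    runState rule D δ s₁ ω m h = runState rule D δ s₁ ω' m h := by
  unfold runState
  rw [tablesAt_congr rule D δ s₁ m h1, ofNat_eq hm, runEpisode_congr _ _ _ _ _ _ h2]

end Run

/-! ### Measurability of the tables, the states and the policies. -/

section Measurability

variable {Ω : Type*} [MeasurableSpace Ω] [MeasurableSpace S]

/-- All components of random tables are measurable. -/
structure TablesMeasurable (σ : Ω → Tables S A H) : Prop where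
  Q : ∀ h s a, Measurable fun x => (σ x).Q h s a
  V : ∀ h s, Measurable fun x => (σ x).V h s
  N : ∀ h s a, Measurable fun x => (σ x).N h s a
  Nc : ∀ h s a, Measurable fun x => (σ x).Nc h s a
  rc : ∀ h s a, Measurable fun x => (σ x).rc h s a
  vc : ∀ h s a, Measurable fun x => (σ x).vc h s a

theorem tablesMeasurable_const (σ : Tables S A H) : TablesMeasurable fun _ : Ω => σ :=
  ⟨fun _ _ _ => measurable_const, fun _ _ => measurable_const, fun _ _ _ => measurable_const,
    fun _ _ _ => measurable_const, fun _ _ _ => measurable_const, fun _ _ _ => measurable_const⟩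

/-- States and actions enter the tables as random indices with countably many values; freezing the
index reduces measurability to fixed entries. -/
theorem measurable_piecewise {κ β : Type*} [Countable κ] [MeasurableSpace β] {g : Ω → κ}
    (hg : ∀ k, MeasurableSet {x | g x = k}) {f : κ → Ω → β} (hf : ∀ k, Measurable (f k)) :
    Measurable fun x => f (g x) x := by
  intro U hU
  have : (fun x => f (g x) x) ⁻¹' U = ⋃ k, {x | g x = k} ∩ f k ⁻¹' U := by
    ext x
    simp only [Set.mem_preimage, Set.mem_iUnion, Set.mem_inter_iff, Set.mem_ofPred_eq]
    constructor
    · intro h; exact ⟨g x, rfl, h⟩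
    · rintro ⟨k, rfl, h⟩; exact h
  rw [this]
  exact MeasurableSet.iUnion fun k => (hg k).inter (hf k hU)

theorem TablesMeasurable.piecewise {κ : Type*} [Countable κ] {g : Ω → κ}
    (hg : ∀ k, MeasurableSet {x | g x = k}) {σ : κ → Ω → Tables S A H}
    (hσ : ∀ k, TablesMeasurable (σ k)) : TablesMeasurable fun x => σ (g x) x :=
  ⟨fun h s a => measurable_piecewise hg fun k => (hσ k).Q h s a,
    fun h s => measurable_piecewise hg fun k => (hσ k).V h s,
    fun h s a => measurable_piecewise hg fun k => (hσ k).N h s a,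
    fun h s a => measurable_piecewise hg fun k => (hσ k).Nc h s a,
    fun h s a => measurable_piecewise hg fun k => (hσ k).rc h s a,
    fun h s a => measurable_piecewise hg fun k => (hσ k).vc h s a⟩

open Classical in
theorem TablesMeasurable.ite {p : Ω → Prop} (hp : MeasurableSet {x | p x})
    {σ σ' : Ω → Tables S A H} (h : TablesMeasurable σ) (h' : TablesMeasurable σ') :
    TablesMeasurable fun x => if p x then σ x else σ' x := by
  have hg : ∀ k : Bool, MeasurableSet {x | decide (p x) = k} := by
    rintro (_ | _)
    · simp only [decide_eq_false_iff_not]; exact hp.compl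
    · simpa using hp
  have := TablesMeasurable.piecewise (σ := fun k x => if k = true then σ x else σ' x) hg
    (by rintro (_ | _) <;> simpa)
  simpa using this

theorem measurable_setEntry {β : Type*} [MeasurableSpace β] {f : Ω → Fin H → S → A → β}
    (hf : ∀ h s a, Measurable fun x => f x h s a) {y : Ω → β} (hy : Measurable y) (h : Fin H)
    (s : S) (a : A) (h' : Fin H) (s' : S) (a' : A) :
    Measurable fun x => setEntry (f x) h s a (y x) h' s' a' := by
  unfold setEntry
  split_ifs
  · exact hy
  · exact hf _ _ _

theorem tablesMeasurable_processStep [Finite A] (ι : ℝ) {σ : Ω → Tables S A H}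
    (hσ : TablesMeasurable σ) (h : Fin H) (s : S) (a : A) {R : Ω → ℝ} (hR : Measurable R) (s' : S) :
    TablesMeasurable fun x => processStep ι (σ x) h s a (R x) s' := by
  have hc : MeasurableSet {x | (σ x).N h s a + 1 ∈ stageEnds H} :=
    (hσ.N h s a) (show MeasurableSet {n : ℕ | n + 1 ∈ stageEnds H} from trivial)
  have hr : Measurable fun x => (σ x).rc h s a + R x := (hσ.rc h s a).add hR
  have hv : Measurable fun x => (σ x).vc h s a + (σ x).V h.succ s' :=
    (hσ.vc h s a).add (hσ.V _ _)
  have hN : Measurable fun x => (σ x).N h s a + 1 := (hσ.N h s a).add_const 1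
  have hn : Measurable fun x => (σ x).Nc h s a + 1 := (hσ.Nc h s a).add_const 1
  have hn' : Measurable fun x => (((σ x).Nc h s a + 1 : ℕ) : ℝ) := measurable_from_top.comp hn
  have hb : Measurable fun x => min (((σ x).rc h s a + R x) / (((σ x).Nc h s a + 1 : ℕ) : ℝ)
      + ((σ x).vc h s a + (σ x).V h.succ s') / (((σ x).Nc h s a + 1 : ℕ) : ℝ)
      + (Real.sqrt ((H : ℝ) ^ 2 / (((σ x).Nc h s a + 1 : ℕ) : ℝ) * ι)
        + Real.sqrt (1 / (((σ x).Nc h s a + 1 : ℕ) : ℝ) * ι))) ((σ x).Q h s a) := by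
    have h1 : Measurable fun x => Real.sqrt ((H : ℝ) ^ 2 / (((σ x).Nc h s a + 1 : ℕ) : ℝ) * ι) :=
      ((measurable_const.div hn').mul_const ι).sqrt
    have h2 : Measurable fun x => Real.sqrt (1 / (((σ x).Nc h s a + 1 : ℕ) : ℝ) * ι) :=
      ((measurable_const.div hn').mul_const ι).sqrt
    exact (((hr.div hn').add (hv.div hn')).add (h1.add h2)).min (hσ.Q h s a)
  have hQ := fun h' x b => measurable_setEntry hσ.Q hb h s a h' x b
  unfold processStep
  refine TablesMeasurable.ite hc ⟨hQ, ?_, measurable_setEntry hσ.N hN h s a,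
      measurable_setEntry hσ.Nc measurable_const h s a,
      measurable_setEntry hσ.rc measurable_const h s a,
      measurable_setEntry hσ.vc measurable_const h s a⟩
    ⟨hσ.Q, hσ.V, measurable_setEntry hσ.N hN h s a, measurable_setEntry hσ.Nc hn h s a,
      measurable_setEntry hσ.rc hr h s a, measurable_setEntry hσ.vc hv h s a⟩
  intro h' x
  dsimp only
  split_ifs
  · exact Measurable.iSup fun b => hQ h s b
  · exact hσ.V _ _

variable [Finite S] [MeasurableSingletonClass S] [Finite A]

theorem measurableSet_sel_eq (rule : ArgmaxRule A) {q : Ω → A → ℝ}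
    (hq : ∀ a, Measurable fun x => q x a) (a : A) : MeasurableSet {x | rule.sel (q x) = a} :=
  (measurable_pi_lambda q hq) (rule.measurableSet_sel a)

theorem measurable_runEpisode (rule : ArgmaxRule A) (ι : ℝ) (m : Fin M) (s₁ : S)
    {σ : (Fin M × Fin H × S × A → ℝ × S) → Tables S A H} (hσ : TablesMeasurable σ) (h : ℕ) :
    TablesMeasurable (fun ω => (runEpisode rule ι ω m (σ ω) s₁ h).1) ∧
      Measurable fun ω => (runEpisode rule ι ω m (σ ω) s₁ h).2 := by
  induction h with
  | zero => exact ⟨hσ, measurable_const⟩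
  | succ h ih =>
    by_cases hh : h < H
    swap
    · simp only [runEpisode, dif_neg hh]; exact ih
    have hs : ∀ s : S, MeasurableSet {ω | (runEpisode rule ι ω m (σ ω) s₁ h).2 = s} := fun s =>
      ih.2 (measurableSet_singleton s)
    have ha : ∀ a : A, MeasurableSet {ω | rule.sel ((runEpisode rule ι ω m (σ ω) s₁ h).1.Q ⟨h, hh⟩
        (runEpisode rule ι ω m (σ ω) s₁ h).2) = a} := fun a =>
      measurableSet_sel_eq rule (fun a => measurable_piecewise
        (f := fun s ω => (runEpisode rule ι ω m (σ ω) s₁ h).1.Q ⟨h, hh⟩ s a) hs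
        fun s => ih.1.Q _ s a) a
    have hsa : ∀ p : S × A, MeasurableSet {ω | ((runEpisode rule ι ω m (σ ω) s₁ h).2,
        rule.sel ((runEpisode rule ι ω m (σ ω) s₁ h).1.Q ⟨h, hh⟩
        (runEpisode rule ι ω m (σ ω) s₁ h).2)) = p} := by
      intro p
      simp only [Prod.ext_iff]
      exact (hs p.1).inter (ha p.2)
    have h2 : Measurable fun ω : Fin M × Fin H × S × A → ℝ × S =>
        (ω (m, ⟨h, hh⟩, (runEpisode rule ι ω m (σ ω) s₁ h).2,
        rule.sel ((runEpisode rule ι ω m (σ ω) s₁ h).1.Q ⟨h, hh⟩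
        (runEpisode rule ι ω m (σ ω) s₁ h).2))).2 :=
      measurable_piecewise (f := fun (p : S × A) (ω : Fin M × Fin H × S × A → ℝ × S) =>
        (ω (m, ⟨h, hh⟩, p.1, p.2)).2) hsa
        fun p => measurable_snd.comp (measurable_pi_apply _)
    simp only [runEpisode_succ _ _ _ _ _ _ hh]
    refine ⟨?_, h2⟩
    refine TablesMeasurable.piecewise (g := fun ω : Fin M × Fin H × S × A → ℝ × S =>
        ((runEpisode rule ι ω m (σ ω) s₁ h).2,
        rule.sel ((runEpisode rule ι ω m (σ ω) s₁ h).1.Q ⟨h, hh⟩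
        (runEpisode rule ι ω m (σ ω) s₁ h).2)))
      (σ := fun (p : S × A) ω => processStep ι (runEpisode rule ι ω m (σ ω) s₁ h).1 ⟨h, hh⟩ p.1 p.2
        (ω (m, ⟨h, hh⟩, p.1, p.2)).1 (ω (m, ⟨h, hh⟩, p.1, p.2)).2) hsa fun p => ?_
    have h3 : Measurable fun ω : Fin M × Fin H × S × A → ℝ × S => (ω (m, ⟨h, hh⟩, p.1, p.2)).2 :=
      measurable_snd.comp (measurable_pi_apply _)
    -- The next state is an index of the table `V`, so it has to be frozen as well.
    refine TablesMeasurable.piecewise (g := fun ω : Fin M × Fin H × S × A → ℝ × S =>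
        (ω (m, ⟨h, hh⟩, p.1, p.2)).2)
      (σ := fun s' ω => processStep ι (runEpisode rule ι ω m (σ ω) s₁ h).1 ⟨h, hh⟩ p.1 p.2
        (ω (m, ⟨h, hh⟩, p.1, p.2)).1 s') (fun s' => h3 (measurableSet_singleton s')) fun s' => ?_
    exact tablesMeasurable_processStep ι ih.1 _ _ _
      (measurable_fst.comp (measurable_pi_apply _)) s'

variable [NeZero M] (rule : ArgmaxRule A) (D : ℕ) (δ : ℝ) (s₁ : Fin M → S)

theorem tablesMeasurable_tablesAt (m : ℕ) :
    TablesMeasurable fun ω : Fin M × Fin H × S × A → ℝ × S => tablesAt rule D δ s₁ ω m := by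
  induction m with
  | zero => exact tablesMeasurable_const _
  | succ m ih =>
    simp only [tablesAt]
    split_ifs
    · exact tablesMeasurable_const _
    · exact (measurable_runEpisode _ _ _ _ ih _).1
    · exact tablesMeasurable_const _

theorem measurableSet_runState_eq (m h : ℕ) (s : S) : MeasurableSet
    {ω : Fin M × Fin H × S × A → ℝ × S | runState rule D δ s₁ ω m h = s} :=
  (measurable_runEpisode _ _ _ _ (tablesMeasurable_tablesAt rule D δ s₁ m) h).2
    (measurableSet_singleton s)

theorem measurableSet_policyAt_eq (m : Fin M) (π : Fin H → S → A) : MeasurableSet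
    {ω : Fin M × Fin H × S × A → ℝ × S | policyAt rule D δ s₁ ω m = π} := by
  have : {ω : Fin M × Fin H × S × A → ℝ × S | policyAt rule D δ s₁ ω m = π} =
      ⋂ h, ⋂ s, {ω | rule.sel ((tablesAt rule D δ s₁ ω m).Q h s) = π h s} := by
    ext ω
    simp [funext_iff, policyAt]
  rw [this]
  exact MeasurableSet.iInter fun h => MeasurableSet.iInter fun s =>
    measurableSet_sel_eq rule (fun a => (tablesMeasurable_tablesAt rule D δ s₁ m).Q h s a) _

theorem measurableSet_visits (h : Fin H) (s : S) (a : A) (m : ℕ) : MeasurableSet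
    {ω : Fin M × Fin H × S × A → ℝ × S | Visits rule D δ s₁ ω h s a m} := by
  have : {ω : Fin M × Fin H × S × A → ℝ × S | Visits rule D δ s₁ ω h s a m} =
      {ω | runState rule D δ s₁ ω m h = s} ∩
        {ω | rule.sel ((tablesAt rule D δ s₁ ω m).Q h s) = a} := by
    ext ω
    simp only [Visits, runAction, Set.mem_ofPred_eq, Set.mem_inter_iff]
    constructor
    · rintro ⟨rfl, h2⟩; exact ⟨rfl, h2⟩
    · rintro ⟨rfl, h2⟩; exact ⟨rfl, h2⟩
  rw [this]
  exact (measurableSet_runState_eq rule D δ s₁ m h s).inter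
    (measurableSet_sel_eq rule (fun a => (tablesMeasurable_tablesAt rule D δ s₁ m).Q h s a) _)

end Measurability

end RestartQ

/-! ### Backward induction and policy values. -/

namespace RestartQ

variable {S A : Type*} {M H : ℕ}

/-- Backward induction: `backward F h = F_h (F_{h+1} (⋯ 0))`. -/
noncomputable def backward (F : Fin H → (S → ℝ) → S → ℝ) (h : ℕ) : S → ℝ :=
  if hh : h < H then F ⟨h, hh⟩ (backward F (h + 1)) else 0
termination_by H - h

theorem backward_fin (F : Fin H → (S → ℝ) → S → ℝ) (h : Fin H) :
    backward F h = F h (backward F (h + 1)) := by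
  rw [backward, dif_pos h.2]

theorem backward_end (F : Fin H → (S → ℝ) → S → ℝ) : backward F H = 0 := by
  rw [backward, dif_neg (lt_irrefl H)]

theorem induction_down {P : ℕ → Prop} (h0 : P H) (ih : ∀ h : Fin H, P (h + 1) → P h) {h : ℕ}
    (hh : h ≤ H) : P h := by
  induction hh using Nat.decreasingInduction with
  | of_succ k hk h => exact ih ⟨k, hk⟩ h
  | self => exact h0

end RestartQ

namespace NonstatMDP

open RestartQ

variable {S A : Type*} {M H : ℕ} [MeasurableSpace S] (E : NonstatMDP S A M H)

theorem meanReward_mem (m : Fin M) (h : Fin H) (s : S) (a : A) :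
    E.meanReward m h s a ∈ Set.Icc (0 : ℝ) 1 := by
  have := E.isProb m h s a
  have h1 := E.reward_mem m h s a
  refine ⟨integral_nonneg_of_ae (h1.mono fun z hz => hz.1), ?_⟩
  have h2 : ∀ᵐ z ∂(E.law m h s a), ‖z.1‖ ≤ 1 := h1.mono fun z hz => by
    rw [Real.norm_of_nonneg hz.1]; exact hz.2
  have := norm_integral_le_of_norm_le_const h2
  simp only [probReal_univ, mul_one] at this
  exact (le_abs_self _).trans this

theorem trans_nonneg (m : Fin M) (h : Fin H) (s : S) (a : A) (s' : S) : 0 ≤ E.trans m h s a s' :=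
  measureReal_nonneg

variable [Fintype S]

/-- The value of action `a` if the rest of the episode is worth `W` in the next state. -/
noncomputable def lookahead (m : Fin M) (h : Fin H) (W : S → ℝ) (s : S) (a : A) : ℝ :=
  E.meanReward m h s a + ∑ s', E.trans m h s a s' * W s'

theorem lookahead_mono (m : Fin M) (h : Fin H) {W W' : S → ℝ} (hW : ∀ s, W s ≤ W' s) (s : S)
    (a : A) : E.lookahead m h W s a ≤ E.lookahead m h W' s a :=
  add_le_add_right (Finset.sum_le_sum fun s' _ =>
    mul_le_mul_of_nonneg_left (hW s') (E.trans_nonneg m h s a s')) _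

/-- The value of the policy `π` from step `h` on. -/
noncomputable def policyValue (m : Fin M) (π : Fin H → S → A) : ℕ → S → ℝ :=
  backward fun h W s => E.lookahead m h W s (π h s)

theorem policyValue_fin (m : Fin M) (π : Fin H → S → A) (h : Fin H) (s : S) :
    E.policyValue m π h s = E.lookahead m h (E.policyValue m π (h + 1)) s (π h s) := by
  rw [policyValue, backward_fin]

theorem policyValue_end (m : Fin M) (π : Fin H → S → A) (s : S) : E.policyValue m π H s = 0 := by
  rw [policyValue, backward_end]; rfl

/-- Pairing the Bellman equation of the policy with its state distribution makes the expected
rewards telescope over the steps, from the point mass at `s₁` to the zero value at the end. -/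
theorem value_eq_policyValue (m : Fin M) (π : Fin H → S → A) (s₁ : S) :
    E.value m π s₁ = E.policyValue m π 0 s₁ := by
  have key : ∀ h : Fin H, ∑ s, E.stateDist m π s₁ h s * E.meanReward m h s (π h s)
      = (∑ s, E.stateDist m π s₁ h s * E.policyValue m π h s)
        - ∑ s, E.stateDist m π s₁ (h + 1) s * E.policyValue m π (h + 1) s := by
    intro h
    have h1 : ∑ s, E.stateDist m π s₁ (h + 1) s * E.policyValue m π (h + 1) s
        = ∑ x, E.stateDist m π s₁ h x *
          ∑ s, E.trans m h x (π h x) s * E.policyValue m π (h + 1) s := by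
      simp only [stateDist, dif_pos h.2, Finset.sum_mul, Finset.mul_sum]
      rw [Finset.sum_comm]
      simp only [Fin.eta, mul_assoc]
    rw [h1, ← Finset.sum_sub_distrib]
    refine Finset.sum_congr rfl fun s _ => ?_
    rw [policyValue_fin, lookahead]
    ring
  rw [value, Finset.sum_congr rfl fun h _ => key h,
    Fin.sum_univ_eq_sum_range (fun h => (∑ s, E.stateDist m π s₁ h s * E.policyValue m π h s)
        - ∑ s, E.stateDist m π s₁ (h + 1) s * E.policyValue m π (h + 1) s) H,
    Finset.sum_range_sub']
  simp only [stateDist, policyValue_end, mul_zero, Finset.sum_const_zero, sub_zero]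
  rw [Finset.sum_eq_single s₁] <;> simp +contextual

variable [MeasurableSingletonClass S]

theorem sum_trans (m : Fin M) (h : Fin H) (s : S) (a : A) : ∑ s', E.trans m h s a s' = 1 := by
  have := E.isProb m h s a
  have h1 := sum_measureReal_preimage_singleton (μ := E.law m h s a) (f := Prod.snd)
    (Finset.univ : Finset S) (fun y _ => measurable_snd (measurableSet_singleton y))
  simpa [trans] using h1

theorem lookahead_add_const (m : Fin M) (h : Fin H) (W : S → ℝ) (c : ℝ) (s : S) (a : A) :
    E.lookahead m h (fun s' => W s' + c) s a = E.lookahead m h W s a + c := by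
  simp only [lookahead, mul_add, Finset.sum_add_distrib, ← Finset.sum_mul, sum_trans]
  ring

theorem lookahead_mem {m : Fin M} {h : Fin H} {W : S → ℝ} {c : ℝ}
    (hW : ∀ s, W s ∈ Set.Icc 0 c) (s : S) (a : A) :
    E.lookahead m h W s a ∈ Set.Icc 0 (1 + c) := by
  have hr := E.meanReward_mem m h s a
  have h1 : 0 ≤ ∑ s', E.trans m h s a s' * W s' :=
    Finset.sum_nonneg fun s' _ => mul_nonneg (E.trans_nonneg _ _ _ _ _) (hW s').1
  have h2 : ∑ s', E.trans m h s a s' * W s' ≤ c := by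
    calc _ ≤ ∑ s', E.trans m h s a s' * c := Finset.sum_le_sum fun s' _ =>
          mul_le_mul_of_nonneg_left (hW s').2 (E.trans_nonneg m h s a s')
      _ = c := by rw [← Finset.sum_mul, sum_trans, one_mul]
  exact ⟨add_nonneg hr.1 h1, add_le_add hr.2 h2⟩

theorem policyValue_mem (m : Fin M) (π : Fin H → S → A) {h : ℕ} (hh : h ≤ H) :
    ∀ s, E.policyValue m π h s ∈ Set.Icc (0 : ℝ) (H - h) := by
  refine induction_down (P := fun h => ∀ s, E.policyValue m π h s ∈ Set.Icc (0 : ℝ) (H - h))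
    (fun s => by simp [policyValue_end]) (fun h ih s => ?_) hh
  have := E.lookahead_mem (m := m) (h := h) ih s (π h s)
  rw [← policyValue_fin] at this
  convert this using 2
  push_cast; ring

/-! ### The pessimistic benchmark of an epoch and its distance to the true values. -/

section Epoch

variable [NeZero M]

/-- The variation between the episodes `m` and `m + 1` at step `h`, with transitions weighted
by `H`. -/
noncomputable def stepVariation (m : ℕ) (h : Fin H) : ℝ :=
  (⨆ x : S × A, |E.meanReward (Fin.ofNat M m) h x.1 x.2
      - E.meanReward (Fin.ofNat M (m + 1)) h x.1 x.2|)
    + H * ⨆ x : S × A, ∑ s' : S, |E.trans (Fin.ofNat M m) h x.1 x.2 s'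
      - E.trans (Fin.ofNat M (m + 1)) h x.1 x.2 s'|

theorem stepVariation_nonneg (m : ℕ) (h : Fin H) : 0 ≤ E.stepVariation m h :=
  add_nonneg (Real.iSup_nonneg fun _ => abs_nonneg _) (mul_nonneg (Nat.cast_nonneg _)
    (Real.iSup_nonneg fun _ => Finset.sum_nonneg fun _ _ => abs_nonneg _))

/-- The variation at step `h` within the episodes `m₀, …, m₀ + L - 1`. -/
noncomputable def epochVariation (m₀ L : ℕ) (h : Fin H) : ℝ :=
  ∑ k ∈ Finset.range (L - 1), E.stepVariation (m₀ + k) h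

theorem epochVariation_nonneg (m₀ L : ℕ) (h : Fin H) : 0 ≤ E.epochVariation m₀ L h :=
  Finset.sum_nonneg fun _ _ => E.stepVariation_nonneg _ _

/-- The smallest lookahead over the episodes `m₀, …, m₀ + L - 1`. -/
noncomputable def lowLookahead (m₀ L : ℕ) (h : Fin H) (W : S → ℝ) (s : S) (a : A) : ℝ :=
  ⨅ k : Fin L, E.lookahead (Fin.ofNat M (m₀ + k)) h W s a

/-- The pessimistic value for the episodes `m₀, …, m₀ + L - 1`. -/
noncomputable def lowV (m₀ L : ℕ) : ℕ → S → ℝ :=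
  backward fun h W s => ⨆ a, E.lowLookahead m₀ L h W s a

/-- The pessimistic action value for the episodes `m₀, …, m₀ + L - 1`. -/
noncomputable def lowQ (m₀ L : ℕ) (h : Fin H) (s : S) (a : A) : ℝ :=
  E.lowLookahead m₀ L h (E.lowV m₀ L (h + 1)) s a

theorem lowV_fin (m₀ L : ℕ) (h : Fin H) (s : S) :
    E.lowV m₀ L h s = ⨆ a, E.lowQ m₀ L h s a := by
  rw [lowV, backward_fin]; rfl

theorem lowV_end (m₀ L : ℕ) (s : S) : E.lowV m₀ L H s = 0 := by
  rw [lowV, backward_end]; rfl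

theorem lowQ_le_lookahead (m₀ : ℕ) {L k : ℕ} (hk : k < L) (h : Fin H) (s : S) (a : A) :
    E.lowQ m₀ L h s a ≤ E.lookahead (Fin.ofNat M (m₀ + k)) h (E.lowV m₀ L (h + 1)) s a :=
  ciInf_le (Set.finite_range _).bddBelow (⟨k, hk⟩ : Fin L)

/-- The minimum is attained, so range and variation bounds for lookaheads pass to `lowQ`. The
minimizing episode may differ from one triple `(h,s,a)` to the next. -/
theorem exists_lowQ_eq (m₀ : ℕ) {L : ℕ} (hL : 0 < L) (h : Fin H) (s : S) (a : A) :
    ∃ k < L, E.lowQ m₀ L h s a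
      = E.lookahead (Fin.ofNat M (m₀ + k)) h (E.lowV m₀ L (h + 1)) s a := by
  have : Nonempty (Fin L) := ⟨⟨0, hL⟩⟩
  obtain ⟨k, hk⟩ := exists_eq_ciInf_of_finite
    (f := fun k : Fin L => E.lookahead (Fin.ofNat M (m₀ + k)) h (E.lowV m₀ L (h + 1)) s a)
  exact ⟨k, k.2, hk.symm⟩

variable [Finite A]

theorem lowQ_le_lowV (m₀ L : ℕ) (h : Fin H) (s : S) (a : A) :
    E.lowQ m₀ L h s a ≤ E.lowV m₀ L h s := by
  rw [lowV_fin]; exact le_ciSup (Set.finite_range _).bddAbove a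

theorem lowV_mem [Nonempty A] (m₀ : ℕ) {L : ℕ} (hL : 0 < L) {h : ℕ} (hh : h ≤ H) :
    ∀ s, E.lowV m₀ L h s ∈ Set.Icc (0 : ℝ) (H - h) := by
  refine induction_down (P := fun h => ∀ s, E.lowV m₀ L h s ∈ Set.Icc (0 : ℝ) (H - h))
    (fun s => by simp [lowV_end]) (fun h ih s => ?_) hh
  obtain ⟨a, ha⟩ := exists_eq_ciSup_of_finite (f := fun a => E.lowQ m₀ L h s a)
  obtain ⟨k, -, hk⟩ := E.exists_lowQ_eq m₀ hL h s a
  have := E.lookahead_mem (m := Fin.ofNat M (m₀ + k)) (h := h) ih s a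
  rw [← hk, ha, ← lowV_fin] at this
  convert this using 2
  push_cast; ring

theorem lowQ_mem [Nonempty A] (m₀ : ℕ) {L : ℕ} (hL : 0 < L) (h : Fin H) (s : S) (a : A) :
    E.lowQ m₀ L h s a ∈ Set.Icc (0 : ℝ) (H - h) := by
  obtain ⟨k, -, hk⟩ := E.exists_lowQ_eq m₀ hL h s a
  have := E.lookahead_mem (m := Fin.ofNat M (m₀ + k)) (h := h)
    (E.lowV_mem m₀ hL (h := h + 1) h.2) s a
  rw [hk]
  convert this using 2
  push_cast; ring

/-- Pairing an `L¹` change of the kernel with values in `[0,H]` explains the weight `H` in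
`stepVariation`. -/
theorem abs_lookahead_sub_le (m : ℕ) (h : Fin H) {W : S → ℝ}
    (hW : ∀ s, W s ∈ Set.Icc (0 : ℝ) H) (s : S) (a : A) :
    |E.lookahead (Fin.ofNat M m) h W s a - E.lookahead (Fin.ofNat M (m + 1)) h W s a|
      ≤ E.stepVariation m h := by
  have h1 : |E.meanReward (Fin.ofNat M m) h s a - E.meanReward (Fin.ofNat M (m + 1)) h s a|
      ≤ ⨆ x : S × A, |E.meanReward (Fin.ofNat M m) h x.1 x.2
      - E.meanReward (Fin.ofNat M (m + 1)) h x.1 x.2| :=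
    le_ciSup (f := fun x : S × A => |E.meanReward (Fin.ofNat M m) h x.1 x.2
      - E.meanReward (Fin.ofNat M (m + 1)) h x.1 x.2|) (Set.finite_range _).bddAbove (s, a)
  have h2 : ∑ s' : S, |E.trans (Fin.ofNat M m) h s a s' - E.trans (Fin.ofNat M (m + 1)) h s a s'|
      ≤ ⨆ x : S × A, ∑ s' : S, |E.trans (Fin.ofNat M m) h x.1 x.2 s'
      - E.trans (Fin.ofNat M (m + 1)) h x.1 x.2 s'| :=
    le_ciSup (f := fun x : S × A => ∑ s' : S, |E.trans (Fin.ofNat M m) h x.1 x.2 s'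
      - E.trans (Fin.ofNat M (m + 1)) h x.1 x.2 s'|) (Set.finite_range _).bddAbove (s, a)
  have h3 : |∑ s' : S, (E.trans (Fin.ofNat M m) h s a s'
      - E.trans (Fin.ofNat M (m + 1)) h s a s') * W s'|
      ≤ H * ∑ s' : S, |E.trans (Fin.ofNat M m) h s a s'
        - E.trans (Fin.ofNat M (m + 1)) h s a s'| := by
    refine (Finset.abs_sum_le_sum_abs _ _).trans ?_
    rw [Finset.mul_sum]
    refine Finset.sum_le_sum fun s' _ => ?_
    rw [abs_mul, abs_of_nonneg (hW s').1, mul_comm]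
    exact mul_le_mul_of_nonneg_right (hW s').2 (abs_nonneg _)
  have h4 : E.lookahead (Fin.ofNat M m) h W s a - E.lookahead (Fin.ofNat M (m + 1)) h W s a
      = (E.meanReward (Fin.ofNat M m) h s a - E.meanReward (Fin.ofNat M (m + 1)) h s a)
        + ∑ s' : S, (E.trans (Fin.ofNat M m) h s a s'
          - E.trans (Fin.ofNat M (m + 1)) h s a s') * W s' := by
    simp only [lookahead, sub_mul, Finset.sum_sub_distrib]; ring
  rw [h4]
  refine (abs_add_le _ _).trans (add_le_add h1 (h3.trans ?_))
  exact mul_le_mul_of_nonneg_left h2 (Nat.cast_nonneg _)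

theorem abs_lookahead_sub_le_epochVariation (m₀ : ℕ) {L i j : ℕ} (hij : i ≤ j) (hj : j < L)
    (h : Fin H) {W : S → ℝ} (hW : ∀ s, W s ∈ Set.Icc (0 : ℝ) H) (s : S) (a : A) :
    |E.lookahead (Fin.ofNat M (m₀ + i)) h W s a - E.lookahead (Fin.ofNat M (m₀ + j)) h W s a|
      ≤ E.epochVariation m₀ L h := by
  have := dist_le_Ico_sum_dist (fun k => E.lookahead (Fin.ofNat M (m₀ + k)) h W s a) hij
  rw [Real.dist_eq] at this
  refine this.trans ((Finset.sum_le_sum fun k _ => ?_).trans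
    (Finset.sum_le_sum_of_subset_of_nonneg (t := Finset.range (L - 1))
      (f := fun k => E.stepVariation (m₀ + k) h) ?_ fun k _ _ => E.stepVariation_nonneg _ _))
  · rw [Real.dist_eq]; exact E.abs_lookahead_sub_le (m₀ + k) h hW s a
  · intro k hk
    rw [Finset.mem_Ico] at hk
    rw [Finset.mem_range]; omega

/-- Episode `k` and the minimizing episode lie in the same epoch, so their lookaheads of the same
function differ by at most the variation accumulated there. -/
theorem lookahead_le_lowQ_add [Nonempty A] (m₀ : ℕ) {L k : ℕ} (hk : k < L) (h : Fin H) (s : S)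
    (a : A) : E.lookahead (Fin.ofNat M (m₀ + k)) h (E.lowV m₀ L (h + 1)) s a
      ≤ E.lowQ m₀ L h s a + E.epochVariation m₀ L h := by
  obtain ⟨i, hi, hQ⟩ := E.exists_lowQ_eq m₀ (by omega : 0 < L) h s a
  have hW : ∀ s, E.lowV m₀ L (h + 1) s ∈ Set.Icc (0 : ℝ) H := fun s => by
    have := E.lowV_mem m₀ (by omega : 0 < L) (h := h + 1) h.2 s
    refine ⟨this.1, this.2.trans ?_⟩
    push_cast
    have : (0 : ℝ) ≤ (h : ℕ) := Nat.cast_nonneg _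
    linarith
  rw [hQ]
  rcases le_total i k with hik | hik
  · have := (abs_le.1 (E.abs_lookahead_sub_le_epochVariation m₀ hik hk h hW s a)).1
    linarith
  · have := (abs_le.1 (E.abs_lookahead_sub_le_epochVariation m₀ hik hi h hW s a)).2
    linarith

/-- The drift is paid once per step: transition probabilities sum to one, so the error inherited
from later steps passes through the lookahead unchanged. The bound holds for every policy, hence for
the optimal value. -/
theorem policyValue_le_lowV_add [Nonempty A] (m₀ : ℕ) {L k : ℕ} (hk : k < L)
    (π : Fin H → S → A) (s : S) : E.policyValue (Fin.ofNat M (m₀ + k)) π 0 s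
      ≤ E.lowV m₀ L 0 s + ∑ h, E.epochVariation m₀ L h := by
  let ε : ℕ → ℝ := fun h => if hh : h < H then E.epochVariation m₀ L ⟨h, hh⟩ else 0
  have key : ∀ s, E.policyValue (Fin.ofNat M (m₀ + k)) π 0 s
      ≤ E.lowV m₀ L 0 s + ∑ h ∈ Finset.Ico 0 H, ε h := by
    refine induction_down (P := fun h => ∀ s, E.policyValue (Fin.ofNat M (m₀ + k)) π h s
      ≤ E.lowV m₀ L h s + ∑ h' ∈ Finset.Ico h H, ε h') ?_ ?_ (Nat.zero_le H)
    · intro s; simp [policyValue_end, lowV_end]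
    · intro h ih s
      rw [policyValue_fin]
      have h1 := E.lookahead_mono (Fin.ofNat M (m₀ + k)) h ih s (π h s)
      rw [lookahead_add_const] at h1
      have h2 := E.lookahead_le_lowQ_add m₀ hk h s (π h s)
      have h3 := E.lowQ_le_lowV m₀ L h s (π h s)
      have h4 : ε h = E.epochVariation m₀ L h := by simp [ε]
      rw [Finset.sum_eq_sum_Ico_succ_bot h.2, h4]
      linarith
  have h5 : ∑ h, E.epochVariation m₀ L h = ∑ h ∈ Finset.Ico 0 H, ε h := by
    rw [← Finset.range_eq_Ico, ← Fin.sum_univ_eq_sum_range]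
    exact Finset.sum_congr rfl fun h _ => by simp [ε]
  rw [h5]
  exact key s

/-- The difference between the pessimistic value and the value of a policy. -/
noncomputable def lowGap (m₀ L : ℕ) (m : Fin M) (π : Fin H → S → A) (h : ℕ) (s : S) : ℝ :=
  E.lowV m₀ L h s - E.policyValue m π h s

theorem abs_lowGap_le [Nonempty A] (m₀ : ℕ) {L : ℕ} (hL : 0 < L) (m : Fin M)
    (π : Fin H → S → A) {h : ℕ} (hh : h ≤ H) (s : S) : |E.lowGap m₀ L m π h s| ≤ H := by
  have h1 := E.lowV_mem m₀ hL hh s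
  have h2 := E.policyValue_mem m π hh s
  have h3 : (0 : ℝ) ≤ h := Nat.cast_nonneg _
  rw [lowGap, abs_le]
  constructor <;> linarith [h1.1, h1.2, h2.1, h2.2]

/-- Performance difference along an arbitrary path. -/
theorem lowGap_le_sum (m₀ : ℕ) {L k : ℕ} (hk : k < L) (π : Fin H → S → A) (st : ℕ → S) :
    E.lowGap m₀ L (Fin.ofNat M (m₀ + k)) π 0 (st 0) ≤
      ∑ h : Fin H, (E.lowV m₀ L h (st h) - E.lowQ m₀ L h (st h) (π h (st h)))
      + ∑ h : Fin H, (∑ s', E.trans (Fin.ofNat M (m₀ + k)) h (st h) (π h (st h)) s' *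
            E.lowGap m₀ L (Fin.ofNat M (m₀ + k)) π (h + 1) s'
          - E.lowGap m₀ L (Fin.ofNat M (m₀ + k)) π (h + 1) (st (h + 1))) := by
  set m := Fin.ofNat M (m₀ + k)
  -- Telescoping along the path; both values vanish at the end of the episode. The only inequality
  -- below is pessimism, `lowQ ≤ lookahead`.
  have h1 : E.lowGap m₀ L m π 0 (st 0) = ∑ h : Fin H,
      (E.lowGap m₀ L m π h (st h) - E.lowGap m₀ L m π (h + 1) (st (h + 1))) := by
    rw [Fin.sum_univ_eq_sum_range (fun h =>
      E.lowGap m₀ L m π h (st h) - E.lowGap m₀ L m π (h + 1) (st (h + 1))), Finset.sum_range_sub']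
    simp [lowGap, lowV_end, policyValue_end]
  rw [h1, ← Finset.sum_add_distrib]
  refine Finset.sum_le_sum fun h _ => ?_
  have h2 := E.lowQ_le_lookahead m₀ hk h (st h) (π h (st h))
  have h3 : E.lowGap m₀ L m π h (st h)
      = E.lowV m₀ L h (st h) - E.lookahead m h (E.policyValue m π (h + 1)) (st h) (π h (st h)) := by
    rw [lowGap, policyValue_fin]
  have h4 : ∑ s', E.trans m h (st h) (π h (st h)) s' * E.lowGap m₀ L m π (h + 1) s'
      = E.lookahead m h (E.lowV m₀ L (h + 1)) (st h) (π h (st h))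
        - E.lookahead m h (E.policyValue m π (h + 1)) (st h) (π h (st h)) := by
    simp only [lowGap, lookahead, mul_sub, Finset.sum_sub_distrib]; ring
  rw [h3, h4]
  linarith

end Epoch

end NonstatMDP

/-! ### Unrolling the recursion over the steps of an episode. -/

namespace RestartQ

theorem one_add_inv_pow_le_three {H : ℕ} (hH : 0 < H) {n : ℕ} (hn : n ≤ H) :
    (1 + 1 / (H : ℝ)) ^ n ≤ 3 := by
  have hH' : (0 : ℝ) < H := by exact_mod_cast hH
  have h0 : (0 : ℝ) < 1 / H := by positivity
  calc (1 + 1 / (H : ℝ)) ^ n ≤ (1 + 1 / (H : ℝ)) ^ H := pow_le_pow_right₀ (by linarith) hn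
    _ ≤ (Real.exp (1 / H)) ^ H := by
        refine pow_le_pow_left₀ (by linarith) ?_ _
        linarith [Real.add_one_le_exp (1 / (H : ℝ))]
    _ = Real.exp 1 := by rw [← Real.exp_nat_mul]; congr 1; field_simp
    _ ≤ 3 := by linarith [Real.exp_one_lt_d9]

/-- Backward induction keeps the terms `G` already collected on the left beside `Φ`; the accumulated
factor is at most `(1 + 1/H)^H ≤ e < 3`, and the first `Φ` is dropped at the end. -/
theorem sum_le_three_mul_sum {H : ℕ} (hH : 0 < H) {Φ : Fin (H + 1) → ℝ} {G B : Fin H → ℝ}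
    (hΦ : ∀ h, 0 ≤ Φ h) (hG : ∀ h, 0 ≤ G h) (hB : ∀ h, 0 ≤ B h) (hend : Φ (Fin.last H) = 0)
    (hrec : ∀ h : Fin H, Φ h.castSucc + G h ≤ (1 + 1 / H) * Φ h.succ + B h) :
    ∑ h, G h ≤ 3 * ∑ h, B h := by
  let ext : (Fin H → ℝ) → ℕ → ℝ := fun f h => if hh : h < H then f ⟨h, hh⟩ else 0
  have hext : ∀ (f : Fin H → ℝ) (h : Fin H), ext f h = f h := fun f h => by simp [ext]
  have hext0 : ∀ f : Fin H → ℝ, (∀ h, 0 ≤ f h) → ∀ h, 0 ≤ ext f h := fun f hf h => by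
    simp only [ext]; split_ifs; exacts [hf _, le_rfl]
  have hH' : (0 : ℝ) < H := by exact_mod_cast hH
  have h1 : (1 : ℝ) ≤ 1 + 1 / H := by
    have : (0 : ℝ) < 1 / H := by positivity
    linarith
  have hsum : ∀ f : Fin H → ℝ, ∑ h, f h = ∑ h ∈ Finset.Ico 0 H, ext f h := fun f => by
    rw [← Finset.range_eq_Ico, ← Fin.sum_univ_eq_sum_range]
    exact Finset.sum_congr rfl fun h _ => (hext f h).symm
  have key : (if hh : 0 < H + 1 then Φ ⟨0, hh⟩ else 0) + ∑ i ∈ Finset.Ico 0 H, ext G i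
      ≤ (1 + 1 / H) ^ (H - 0) * ∑ i ∈ Finset.Ico 0 H, ext B i := by
    refine induction_down (P := fun h => (if hh : h < H + 1 then Φ ⟨h, hh⟩ else 0)
      + ∑ i ∈ Finset.Ico h H, ext G i
      ≤ (1 + 1 / H) ^ (H - h) * ∑ i ∈ Finset.Ico h H, ext B i) ?_ ?_ (Nat.zero_le H)
    · simp only [lt_add_iff_pos_right, zero_lt_one, dif_pos, Finset.Ico_self, Finset.sum_empty,
        add_zero, mul_zero]
      exact hend.le
    · intro h ih
      have e1 : (h : ℕ) < H + 1 := by omega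
      have e2 : (h : ℕ) + 1 < H + 1 := by omega
      rw [dif_pos e2] at ih
      rw [dif_pos e1, Finset.sum_eq_sum_Ico_succ_bot h.2, Finset.sum_eq_sum_Ico_succ_bot h.2,
        hext, hext]
      have hr := hrec h
      have e3 : Φ ⟨h, e1⟩ = Φ h.castSucc := rfl
      have e4 : Φ ⟨h + 1, e2⟩ = Φ h.succ := rfl
      have e5 : H - (h : ℕ) = (H - (h + 1)) + 1 := by omega
      rw [e3]
      rw [e4] at ih
      rw [e5, pow_succ]
      have hG0 : 0 ≤ ∑ i ∈ Finset.Ico ((h : ℕ) + 1) H, ext G i :=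
        Finset.sum_nonneg fun i _ => hext0 G hG i
      have hp : (1 : ℝ) ≤ (1 + 1 / H) ^ (H - (h + 1)) * (1 + 1 / H) := by
        rw [← pow_succ]; exact one_le_pow₀ h1
      have hB' := mul_le_mul_of_nonneg_right hp (hB h)
      have ih' := mul_le_mul_of_nonneg_left ih (by linarith : (0 : ℝ) ≤ 1 + 1 / H)
      have hG1 := mul_le_mul_of_nonneg_right h1 hG0
      nlinarith
  rw [hsum, hsum]
  have h0 : 0 ≤ (if hh : 0 < H + 1 then Φ ⟨0, hh⟩ else 0) := by
    split_ifs; exacts [hΦ _, le_rfl]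
  have hBs : 0 ≤ ∑ i ∈ Finset.Ico 0 H, ext B i := Finset.sum_nonneg fun i _ => hext0 B hB i
  have := mul_le_mul_of_nonneg_right (one_add_inv_pow_le_three hH (Nat.sub_le H 0)) hBs
  linarith

theorem sum_sqrt_le {κ : Type*} [Fintype κ] (f : κ → ℕ) :
    ∑ i, Real.sqrt (f i) ≤ Real.sqrt (Fintype.card κ * ∑ i, (f i : ℝ)) := by
  apply Real.le_sqrt_of_sq_le
  have := sq_sum_le_card_mul_sum_sq (s := (Finset.univ : Finset κ)) (f := fun i => Real.sqrt (f i))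
  simpa [Real.sq_sqrt] using this

/-! ### Regret of one epoch when its samples concentrate. -/

section Epoch

variable {S A : Type*} {M H : ℕ} [MeasurableSpace S] [Fintype S] [MeasurableSingletonClass S]
  [Fintype A] [NeZero M]

/-- The data of all stages in the epoch `m₀, …, m₀ + L - 1` concentrate. -/
def EpochConc (E : NonstatMDP S A M H) (rule : ArgmaxRule A) (D : ℕ) (δ : ℝ) (s₁ : Fin M → S)
    (ω : Fin M × Fin H × S × A → ℝ × S) (m₀ L : ℕ) : Prop :=
  ∀ h s a, StageConc H (Real.log (2 / δ)) (fun k => Visits rule D δ s₁ ω h s a (m₀ + k)) L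
    fun k => (ω (Fin.ofNat M (m₀ + k), h, s, a)).1
      + E.lowV m₀ L (h + 1) (ω (Fin.ofNat M (m₀ + k), h, s, a)).2
      - E.lookahead (Fin.ofNat M (m₀ + k)) h (E.lowV m₀ L (h + 1)) s a

/-- The difference between the mean and the realization of the next-state gap. -/
noncomputable def pathNoise (E : NonstatMDP S A M H) (rule : ArgmaxRule A) (D : ℕ) (δ : ℝ)
    (s₁ : Fin M → S) (ω : Fin M × Fin H × S × A → ℝ × S) (m₀ L m : ℕ) (h : Fin H) : ℝ :=
  ∑ s', E.trans (Fin.ofNat M m) h (runState rule D δ s₁ ω m h) (runAction rule D δ s₁ ω m h) s' *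
      E.lowGap m₀ L (Fin.ofNat M m) (policyAt rule D δ s₁ ω (Fin.ofNat M m)) (h + 1) s'
    - E.lowGap m₀ L (Fin.ofNat M m) (policyAt rule D δ s₁ ω (Fin.ofNat M m)) (h + 1)
      (runState rule D δ s₁ ω m (h + 1))

variable {E : NonstatMDP S A M H} {rule : ArgmaxRule A} {D : ℕ} {δ : ℝ} {s₁ : Fin M → S}
  {ω : Fin M × Fin H × S × A → ℝ × S} {m₀ L : ℕ}

/-- The epoch starts from fresh tables and there is no reset before its last episode, so `entryInv`
applies to every triple. -/
theorem exists_entryInv (hH : 0 < H) (hm₀ : m₀ % epochLength M D = 0)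
    (hLK : L ≤ epochLength M D) (hLM : m₀ + L ≤ M) (h : Fin H) (s : S) (a : A) {k : ℕ}
    (hk : k < L) :
    ∃ j, EntryInv H (Real.log (2 / δ)) ((H : ℝ) - (h : ℕ))
      (fun k => Visits rule D δ s₁ ω h s a (m₀ + k))
      (fun k => (ω (Fin.ofNat M (m₀ + k), h, s, a)).1)
      (fun k => (tablesAt rule D δ s₁ ω (m₀ + k)).V h.succ
        (runState rule D δ s₁ ω (m₀ + k) (h + 1))) k
      ((tablesAt rule D δ s₁ ω (m₀ + k)).entry h s a) j := by
  have hne : ∀ k, k + 1 < L → (m₀ + k + 1) % epochLength M D ≠ 0 := by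
    intro k hk
    rw [add_assoc, Nat.add_mod, hm₀, zero_add, Nat.mod_mod, Nat.mod_eq_of_lt (by omega)]
    omega
  refine entryInv (x := fun k => (tablesAt rule D δ s₁ ω (m₀ + k)).entry h s a) hH ?_ ?_ ?_ k hk
  · simp only [add_zero]
    rw [tablesAt_epoch_start _ _ _ _ _ hm₀]
    rfl
  · intro k hk hv
    rw [← add_assoc, entry_tablesAt_succ _ _ _ _ _ (by omega) (hne k hk), if_pos hv]
  · intro k hk hv
    rw [← add_assoc, entry_tablesAt_succ _ _ _ _ _ (by omega) (hne k hk), if_neg hv]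

theorem runState_succ_of_visits {h : Fin H} {s : S} {a : A} {m : ℕ}
    (hv : Visits rule D δ s₁ ω h s a m) :
    runState rule D δ s₁ ω m (h + 1) = (ω (Fin.ofNat M m, h, s, a)).2 := by
  rw [runState_succ, hv.1, hv.2]

theorem lowV_le_V [Nonempty A] {σ : Tables S A H} (hσ : σ.Greedy)
    (hQ : ∀ h s a, E.lowQ m₀ L h s a ≤ σ.Q h s a) (h : Fin (H + 1)) (s : S) :
    E.lowV m₀ L h s ≤ σ.V h s := by
  induction h using Fin.lastCases with
  | last => simp [hσ.V_last, E.lowV_end]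
  | cast h =>
    rw [hσ.V_eq, Fin.val_castSucc, E.lowV_fin]
    exact ciSup_mono (Set.finite_range _).bddAbove fun a => hQ h s a

theorem nonempty_action (rule : ArgmaxRule A) : Nonempty A := ⟨rule.sel fun _ => 0⟩

/-- The induction runs over episodes, simultaneously for all steps: estimates in the tables use only
next-state values read in earlier episodes of the epoch, which already dominate `lowV`. -/
theorem lowQ_le_Q (hH : 0 < H) (hm₀ : m₀ % epochLength M D = 0)
    (hLK : L ≤ epochLength M D) (hLM : m₀ + L ≤ M) (hc : EpochConc E rule D δ s₁ ω m₀ L)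
    {k : ℕ} (hk : k < L) (h : Fin H) (s : S) (a : A) :
    E.lowQ m₀ L h s a ≤ (tablesAt rule D δ s₁ ω (m₀ + k)).Q h s a := by
  have := nonempty_action rule
  induction k using Nat.strong_induction_on generalizing h s a with
  | _ k ih =>
    obtain ⟨j, I⟩ := exists_entryInv (rule := rule) (δ := δ) (s₁ := s₁) (ω := ω) hH hm₀ hLK hLM
      h s a hk
    refine I.optimistic hH hk (E.lowQ_mem m₀ (by omega) h s a).2 ?_ ?_ (hc h s a)
    · intro l hl hv
      rw [runState_succ_of_visits hv, ← Fin.val_succ]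
      exact lowV_le_V (greedy_tablesAt _ _ _ _ _ _) (fun h s a => ih l hl (by omega) h s a) _ _
    · intro l hl _
      exact E.lowQ_le_lookahead m₀ hl h s a

/-- The optimism of the value of the next state. -/
noncomputable def phi (E : NonstatMDP S A M H) (rule : ArgmaxRule A) (D : ℕ) (δ : ℝ)
    (s₁ : Fin M → S) (ω : Fin M × Fin H × S × A → ℝ × S) (m₀ L : ℕ) (h : Fin (H + 1)) (k : ℕ) : ℝ :=
  (tablesAt rule D δ s₁ ω (m₀ + k)).V h (runState rule D δ s₁ ω (m₀ + k) h)
    - E.lowV m₀ L h (runState rule D δ s₁ ω (m₀ + k) h)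

theorem phi_nonneg (hH : 0 < H) (hm₀ : m₀ % epochLength M D = 0)
    (hLK : L ≤ epochLength M D) (hLM : m₀ + L ≤ M) (hc : EpochConc E rule D δ s₁ ω m₀ L)
    {k : ℕ} (hk : k < L) (h : Fin (H + 1)) : 0 ≤ phi E rule D δ s₁ ω m₀ L h k := by
  have := nonempty_action rule
  exact sub_nonneg.2 (lowV_le_V (greedy_tablesAt _ _ _ _ _ _)
    (fun h s a => lowQ_le_Q hH hm₀ hLK hLM hc hk h s a) _ _)

theorem V_castSucc_runState (m : ℕ) (h : Fin H) :
    (tablesAt rule D δ s₁ ω m).V h.castSucc (runState rule D δ s₁ ω m h) =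
      (tablesAt rule D δ s₁ ω m).Q h (runState rule D δ s₁ ω m h)
        (runAction rule D δ s₁ ω m h) := by
  have := nonempty_action rule
  rw [(greedy_tablesAt _ _ _ _ _ _).V_eq]
  exact le_antisymm (ciSup_le fun a => rule.le_sel _ a)
    (le_ciSup (Set.finite_range _).bddAbove (runAction rule D δ s₁ ω m h))

-- `sum_gap_le` with `φ` the table value minus `lowV` at the next state; the drift `ε` is the
-- variation of the epoch at step `h`.
open Classical in
theorem sum_visits_gap_le (hH : 0 < H) (hm₀ : m₀ % epochLength M D = 0)
    (hLK : L ≤ epochLength M D) (hLM : m₀ + L ≤ M) (hι : 0 ≤ Real.log (2 / δ))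
    (hc : EpochConc E rule D δ s₁ ω m₀ L) (h : Fin H) (s : S) (a : A) :
    ∑ k ∈ Finset.range L with Visits rule D δ s₁ ω h s a (m₀ + k),
        ((tablesAt rule D δ s₁ ω (m₀ + k)).Q h s a - E.lowQ m₀ L h s a) ≤
      H * H + (1 + 1 / H) * ∑ k ∈ Finset.range L with Visits rule D δ s₁ ω h s a (m₀ + k),
          phi E rule D δ s₁ ω m₀ L h.succ k
        + visitCount (fun k => Visits rule D δ s₁ ω h s a (m₀ + k)) L * E.epochVariation m₀ L h
        + 14 * (H * Real.sqrt H * Real.sqrt (Real.log (2 / δ)))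
          * Real.sqrt (visitCount (fun k => Visits rule D δ s₁ ω h s a (m₀ + k)) L) := by
  have := nonempty_action rule
  refine sum_gap_le hH hι (fun l hl _ => phi_nonneg hH hm₀ hLK hLM hc hl h.succ) ?_ ?_
  · intro k hk _ _
    obtain ⟨j, I⟩ := exists_entryInv (rule := rule) (δ := δ) (s₁ := s₁) (ω := ω) hH hm₀ hLK hLM
      h s a hk
    have h1 : (tablesAt rule D δ s₁ ω (m₀ + k)).Q h s a ≤ (H : ℝ) - (h : ℕ) := I.le_init
    have h2 := (E.lowQ_mem m₀ (by omega : 0 < L) h s a).1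
    have h3 : (0 : ℝ) ≤ (h : ℕ) := Nat.cast_nonneg _
    have h4 := E.epochVariation_nonneg m₀ L h
    linarith
  · intro k hk _ j hj1 hj2
    obtain ⟨i, I⟩ := exists_entryInv (rule := rule) (δ := δ) (s₁ := s₁) (ω := ω) hH hm₀ hLK hLM
      h s a hk
    have hst := I.stage
    rw [I.count] at hst
    obtain rfl := stage_unique hH hst ⟨hj1, hj2⟩
    have h1 := I.gap_le (q := E.lowQ m₀ L h s a) hH hk
      (fun l hl _ => E.lookahead_le_lowQ_add m₀ hl h s a) (hc h s a)
    refine h1.trans_eq ?_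
    congr 3
    refine Finset.sum_congr rfl fun l hl => ?_
    have hv : Visits rule D δ s₁ ω h s a (m₀ + l) :=
      vis_of_mem_stageVisits (vis := fun k => Visits rule D δ s₁ ω h s a (m₀ + k)) hl
    rw [phi, Fin.val_succ, runState_succ_of_visits hv]

-- At a given step each episode visits exactly one pair.
open Classical in
theorem sum_visits_eq_sum (h : Fin H) (f : ℕ → S → A → ℝ) :
    ∑ x : S × A, ∑ k ∈ Finset.range L with Visits rule D δ s₁ ω h x.1 x.2 (m₀ + k), f k x.1 x.2
      = ∑ k ∈ Finset.range L, f k (runState rule D δ s₁ ω (m₀ + k) h)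
          (runAction rule D δ s₁ ω (m₀ + k) h) := by
  rw [← Finset.sum_fiberwise (Finset.range L) (fun k => (runState rule D δ s₁ ω (m₀ + k) h,
    runAction rule D δ s₁ ω (m₀ + k) h))]
  refine Finset.sum_congr rfl fun x _ => ?_
  have : ({k ∈ Finset.range L | Visits rule D δ s₁ ω h x.1 x.2 (m₀ + k)} : Finset ℕ)
      = {k ∈ Finset.range L | (runState rule D δ s₁ ω (m₀ + k) h,
    runAction rule D δ s₁ ω (m₀ + k) h) = x} := by
    refine Finset.filter_congr fun k _ => ?_
    rw [Prod.ext_iff]; rfl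
  rw [this]
  refine Finset.sum_congr rfl fun k hk => ?_
  rw [← (Finset.mem_filter.1 hk).2]

theorem sum_visitCount (h : Fin H) :
    ∑ x : S × A, (visitCount (fun k => Visits rule D δ s₁ ω h x.1 x.2 (m₀ + k)) L : ℝ) = L := by
  classical
  have := sum_visits_eq_sum (rule := rule) (D := D) (δ := δ) (s₁ := s₁) (ω := ω) (m₀ := m₀)
    (L := L) h fun _ _ _ => 1
  simpa [visitCount] using this

/-- The played action attains `V`, so the two terms on the left add up to `Q - lowQ` at the visited
pair. Summing the entry bounds over pairs gives the recursion in `h`, with Cauchy–Schwarz for the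
square roots of the visit counts. -/
theorem phi_add_gap_le (hH : 0 < H) (hm₀ : m₀ % epochLength M D = 0)
    (hLK : L ≤ epochLength M D) (hLM : m₀ + L ≤ M) (hι : 0 ≤ Real.log (2 / δ))
    (hc : EpochConc E rule D δ s₁ ω m₀ L) (h : Fin H) :
    ∑ k ∈ Finset.range L, phi E rule D δ s₁ ω m₀ L h.castSucc k
      + ∑ k ∈ Finset.range L, (E.lowV m₀ L h (runState rule D δ s₁ ω (m₀ + k) h)
        - E.lowQ m₀ L h (runState rule D δ s₁ ω (m₀ + k) h)
          (runAction rule D δ s₁ ω (m₀ + k) h)) ≤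
      (1 + 1 / H) * ∑ k ∈ Finset.range L, phi E rule D δ s₁ ω m₀ L h.succ k
        + (Fintype.card S * Fintype.card A * (H * H) + L * E.epochVariation m₀ L h
          + 14 * (H * Real.sqrt H * Real.sqrt (Real.log (2 / δ)))
            * Real.sqrt (Fintype.card S * Fintype.card A * L)) := by
  classical
  have h1 : ∑ k ∈ Finset.range L, phi E rule D δ s₁ ω m₀ L h.castSucc k
      + ∑ k ∈ Finset.range L, (E.lowV m₀ L h (runState rule D δ s₁ ω (m₀ + k) h)
        - E.lowQ m₀ L h (runState rule D δ s₁ ω (m₀ + k) h)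
          (runAction rule D δ s₁ ω (m₀ + k) h))
      = ∑ x : S × A, ∑ k ∈ Finset.range L with Visits rule D δ s₁ ω h x.1 x.2 (m₀ + k),
        ((tablesAt rule D δ s₁ ω (m₀ + k)).Q h x.1 x.2 - E.lowQ m₀ L h x.1 x.2) := by
    rw [sum_visits_eq_sum h fun k s a =>
      (tablesAt rule D δ s₁ ω (m₀ + k)).Q h s a - E.lowQ m₀ L h s a, ← Finset.sum_add_distrib]
    refine Finset.sum_congr rfl fun k _ => ?_
    rw [phi, Fin.val_castSucc, V_castSucc_runState]
    ring
  rw [h1]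
  refine (Finset.sum_le_sum fun x _ =>
    sum_visits_gap_le hH hm₀ hLK hLM hι hc h x.1 x.2).trans ?_
  simp only [Finset.sum_add_distrib, ← Finset.mul_sum, ← Finset.sum_mul]
  rw [sum_visitCount, sum_visits_eq_sum h fun k _ _ => phi E rule D δ s₁ ω m₀ L h.succ k]
  simp only [Finset.sum_const, nsmul_eq_mul, Finset.card_univ, Fintype.card_prod]
  have h2 := sum_sqrt_le fun x : S × A =>
    visitCount (fun k => Visits rule D δ s₁ ω h x.1 x.2 (m₀ + k)) L
  rw [sum_visitCount, Fintype.card_prod] at h2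
  have h3 := mul_le_mul_of_nonneg_left h2
    (by positivity : 0 ≤ 14 * (H * Real.sqrt H * Real.sqrt (Real.log (2 / δ))))
  push_cast at h3 ⊢
  linarith

/-- The variation appears once in comparing the optimal value with `lowV` and three times through
the recursion, which gives the 4. The other constants are 3 times those of `phi_add_gap_le`, summed
over `H` steps. -/
theorem epoch_regret_le (hH : 0 < H) (hm₀ : m₀ % epochLength M D = 0)
    (hLK : L ≤ epochLength M D) (hLM : m₀ + L ≤ M) (hι : 0 ≤ Real.log (2 / δ))
    (hc : EpochConc E rule D δ s₁ ω m₀ L) :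
    ∑ k ∈ Finset.range L, (E.optValue (Fin.ofNat M (m₀ + k)) (s₁ (Fin.ofNat M (m₀ + k)))
        - E.value (Fin.ofNat M (m₀ + k)) (policyAt rule D δ s₁ ω (Fin.ofNat M (m₀ + k)))
          (s₁ (Fin.ofNat M (m₀ + k)))) ≤
      4 * (L * ∑ h, E.epochVariation m₀ L h) + 3 * (Fintype.card S * Fintype.card A * H ^ 3)
        + 42 * (H ^ 2 * Real.sqrt H * Real.sqrt (Real.log (2 / δ)))
            * Real.sqrt (Fintype.card S * Fintype.card A * L)
        + ∑ k ∈ Finset.range L, ∑ h, pathNoise E rule D δ s₁ ω m₀ L (m₀ + k) h := by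
  have := nonempty_action rule
  set G : Fin H → ℝ := fun h => ∑ k ∈ Finset.range L,
    (E.lowV m₀ L h (runState rule D δ s₁ ω (m₀ + k) h)
        - E.lowQ m₀ L h (runState rule D δ s₁ ω (m₀ + k) h)
          (runAction rule D δ s₁ ω (m₀ + k) h)) with hG
  have h1 : ∑ h, G h ≤ 3 * ∑ h : Fin H, (Fintype.card S * Fintype.card A * (H * H)
      + L * E.epochVariation m₀ L h
          + 14 * (H * Real.sqrt H * Real.sqrt (Real.log (2 / δ)))
            * Real.sqrt (Fintype.card S * Fintype.card A * L)) := by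
    refine sum_le_three_mul_sum hH
      (Φ := fun h => ∑ k ∈ Finset.range L, phi E rule D δ s₁ ω m₀ L h k) ?_ ?_ ?_ ?_ ?_
    · exact fun h => Finset.sum_nonneg fun k hk =>
        phi_nonneg hH hm₀ hLK hLM hc (Finset.mem_range.1 hk) h
    · exact fun h => Finset.sum_nonneg fun k _ => sub_nonneg.2 (E.lowQ_le_lowV _ _ _ _ _)
    · intro h
      have := E.epochVariation_nonneg m₀ L h
      positivity
    · refine Finset.sum_eq_zero fun k _ => ?_
      simp [phi, (greedy_tablesAt rule D δ s₁ ω (m₀ + k)).V_last, E.lowV_end]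
    · exact fun h => phi_add_gap_le hH hm₀ hLK hLM hι hc h
  have h2 : ∀ k ∈ Finset.range L, E.optValue (Fin.ofNat M (m₀ + k)) (s₁ (Fin.ofNat M (m₀ + k)))
        - E.value (Fin.ofNat M (m₀ + k)) (policyAt rule D δ s₁ ω (Fin.ofNat M (m₀ + k)))
          (s₁ (Fin.ofNat M (m₀ + k)))
      ≤ ∑ h, E.epochVariation m₀ L h
        + ∑ h : Fin H, (E.lowV m₀ L h (runState rule D δ s₁ ω (m₀ + k) h)
        - E.lowQ m₀ L h (runState rule D δ s₁ ω (m₀ + k) h)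
          (runAction rule D δ s₁ ω (m₀ + k) h))
        + ∑ h, pathNoise E rule D δ s₁ ω m₀ L (m₀ + k) h := by
    intro k hk
    rw [Finset.mem_range] at hk
    have e1 : E.optValue (Fin.ofNat M (m₀ + k)) (s₁ (Fin.ofNat M (m₀ + k)))
        ≤ E.lowV m₀ L 0 (s₁ (Fin.ofNat M (m₀ + k))) + ∑ h, E.epochVariation m₀ L h := by
      refine ciSup_le fun π => ?_
      rw [E.value_eq_policyValue]
      exact E.policyValue_le_lowV_add m₀ hk π _
    have e2 := E.lowGap_le_sum m₀ hk (policyAt rule D δ s₁ ω (Fin.ofNat M (m₀ + k)))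
      (runState rule D δ s₁ ω (m₀ + k))
    have e3 : ∀ h, policyAt rule D δ s₁ ω (Fin.ofNat M (m₀ + k)) h
        (runState rule D δ s₁ ω (m₀ + k) h) = runAction rule D δ s₁ ω (m₀ + k) h := by
      intro h
      rw [runAction_eq_policyAt _ _ _ _ _ _ (by omega : m₀ + k < M), ofNat_eq]
    simp only [e3] at e2
    rw [E.value_eq_policyValue]
    rw [NonstatMDP.lowGap, runState_zero] at e2
    simp only [pathNoise]
    linarith
  refine (Finset.sum_le_sum h2).trans ?_
  have h3 : ∑ k ∈ Finset.range L, ∑ h : Fin H,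
      (E.lowV m₀ L h (runState rule D δ s₁ ω (m₀ + k) h)
        - E.lowQ m₀ L h (runState rule D δ s₁ ω (m₀ + k) h)
          (runAction rule D δ s₁ ω (m₀ + k) h)) = ∑ h, G h := Finset.sum_comm
  rw [Finset.sum_add_distrib, Finset.sum_add_distrib, h3, Finset.sum_const, Finset.card_range,
    nsmul_eq_mul]
  rw [Finset.sum_add_distrib, Finset.sum_add_distrib] at h1
  simp only [Finset.sum_const, Finset.card_univ, Fintype.card_fin, nsmul_eq_mul] at h1
  rw [← Finset.mul_sum] at h1
  nlinarith

end Epoch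

end RestartQ

/-! ### Exponential inequality for predictably chosen coordinates of a product measure. -/

namespace RestartQ

section Product

variable {I X κ : Type*} [Fintype I] [DecidableEq I] [MeasurableSpace X] (ν : I → Measure X)
  [∀ i, IsProbabilityMeasure (ν i)]

/-- Resampling one coordinate from its own law preserves the product measure. This replaces
conditional expectations below. -/
theorem lintegral_pi_update {f : (I → X) → ENNReal} (hf : Measurable f) (j : I) :
    ∫⁻ ω, f ω ∂Measure.pi ν = ∫⁻ ω, ∫⁻ z, f (Function.update ω j z) ∂ν j ∂Measure.pi ν := by
  have hne : Nonempty X := (ν j).nonempty_of_neZero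
  have hg : Measurable fun ω => ∫⁻ z, f (Function.update ω j z) ∂ν j :=
    Measurable.lintegral_prod_right' (f := fun p : (I → X) × X => f (Function.update p.1 j p.2))
      (hf.comp measurable_update')
  obtain ⟨x⟩ : Nonempty (I → X) := inferInstance
  rw [lintegral_eq_lmarginal_univ x, lintegral_eq_lmarginal_univ x,
    lmarginal_erase' _ hf (Finset.mem_univ j), lmarginal_erase' _ hg (Finset.mem_univ j)]
  simp

variable [Finite κ]

/-- Split by the finitely many values of `J`. On `J = k` neither `J` nor `Z` depends on coordinate
`c k`, so resampling it integrates `W k` on its own. -/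
theorem lintegral_mul_le {Z : (I → X) → ENNReal} (hZ : Measurable Z) {J : (I → X) → κ}
    (hJ : ∀ k, MeasurableSet {ω | J ω = k}) {c : κ → I} {W : κ → X → ENNReal}
    (hW : ∀ k, Measurable (W k)) (hW1 : ∀ k, ∫⁻ z, W k z ∂ν (c k) ≤ 1)
    (hZc : ∀ k ω z, Z (Function.update ω (c k) z) = Z ω)
    (hJc : ∀ k ω z, J (Function.update ω (c k) z) = J ω) :
    ∫⁻ ω, Z ω * W (J ω) (ω (c (J ω))) ∂Measure.pi ν ≤ ∫⁻ ω, Z ω ∂Measure.pi ν := by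
  classical
  have := Fintype.ofFinite κ
  have hsplit : ∀ F : κ → (I → X) → ENNReal, ∀ ω, F (J ω) ω = ∑ k, {ω | J ω = k}.indicator (F k) ω :=
    fun F ω => by
      rw [Finset.sum_eq_single (J ω)]
      · simp
      · intro k _ hk; simp [Set.indicator, hk.symm]
      · simp
  have hm : ∀ k, Measurable ({ω | J ω = k}.indicator fun ω => Z ω * W k (ω (c k))) := fun k =>
    (hZ.mul ((hW k).comp (measurable_pi_apply _))).indicator (hJ k)
  calc ∫⁻ ω, Z ω * W (J ω) (ω (c (J ω))) ∂Measure.pi ν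
      = ∑ k, ∫⁻ ω, {ω | J ω = k}.indicator (fun ω => Z ω * W k (ω (c k))) ω ∂Measure.pi ν := by
        rw [← lintegral_finsetSum _ fun k _ => hm k]
        exact lintegral_congr fun ω => hsplit (fun k ω => Z ω * W k (ω (c k))) ω
    _ ≤ ∑ k, ∫⁻ ω, {ω | J ω = k}.indicator Z ω ∂Measure.pi ν := by
        refine Finset.sum_le_sum fun k _ => ?_
        rw [lintegral_pi_update ν (hm k) (c k)]
        refine lintegral_mono fun ω => ?_
        simp only [Set.indicator, Set.mem_ofPred_eq, hJc, hZc, Function.update_self]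
        split_ifs
        · rw [lintegral_const_mul _ (hW k)]
          exact mul_le_of_le_one_right' (hW1 k)
        · simp
    _ = ∫⁻ ω, Z ω ∂Measure.pi ν := by
        rw [← lintegral_finsetSum _ fun k _ => hZ.indicator (hJ k)]
        exact lintegral_congr fun ω => (hsplit (fun _ => Z) ω).symm

/-- A sequence of choices of coordinates, each made before that coordinate is revealed. -/
structure Predictable (N : ℕ) (J : ℕ → (I → X) → κ) (c : ℕ → κ → I) : Prop where
  measurable : ∀ t < N, ∀ k, MeasurableSet {ω | J t ω = k}
  choice_update : ∀ t t', t ≤ t' → t' < N → ∀ k ω z, J t (Function.update ω (c t' k) z) = J t ω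
  coord_ne : ∀ t t', t < t' → t' < N → ∀ k k', c t k ≠ c t' k'

/-- The supermartingale property of the exponential product. Earlier factors neither choose nor read
the coordinate revealed at time `n`, so it can be integrated out. -/
theorem lintegral_prod_le_one {N : ℕ} {J : ℕ → (I → X) → κ} {c : ℕ → κ → I}
    (hJ : Predictable N J c) {W : ℕ → κ → X → ENNReal}
    (hW : ∀ t < N, ∀ k, Measurable (W t k)) (hW1 : ∀ t < N, ∀ k, ∫⁻ z, W t k z ∂ν (c t k) ≤ 1)
    (n : ℕ) (hn : n ≤ N) :
    Measurable (fun ω => ∏ t ∈ Finset.range n, W t (J t ω) (ω (c t (J t ω)))) ∧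
    ∫⁻ ω, ∏ t ∈ Finset.range n, W t (J t ω) (ω (c t (J t ω))) ∂Measure.pi ν ≤ 1 := by
  induction n with
  | zero => simp
  | succ n ih =>
    obtain ⟨h1, h2⟩ := ih (by omega)
    simp only [Finset.prod_range_succ]
    refine ⟨h1.mul (measurable_piecewise (f := fun k ω => W n k (ω (c n k)))
      (hJ.measurable n (by omega)) fun k => (hW n (by omega) k).comp (measurable_pi_apply _)), ?_⟩
    refine (lintegral_mul_le ν h1 (hJ.measurable n (by omega)) (hW n (by omega))
      (hW1 n (by omega)) ?_ fun k ω z => hJ.choice_update n n le_rfl (by omega) k ω z).trans h2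
    intro k ω z
    refine Finset.prod_congr rfl fun t ht => ?_
    rw [Finset.mem_range] at ht
    rw [hJ.choice_update t n ht.le (by omega), Function.update_of_ne
      (hJ.coord_ne t n ht (by omega) _ _)]

/-- Markov's inequality for the exponential product. Compensators are part of `f`, so they may
depend on the random choice. -/
theorem measure_le_sum_le {N : ℕ} {J : ℕ → (I → X) → κ} {c : ℕ → κ → I}
    (hJ : Predictable N J c) {f : ℕ → κ → X → ℝ} (hf : ∀ t < N, ∀ k, Measurable (f t k))
    (hf1 : ∀ t < N, ∀ k, ∫⁻ z, ENNReal.ofReal (Real.exp (f t k z)) ∂ν (c t k) ≤ 1) (u : ℝ) :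
    Measure.pi ν {ω | u ≤ ∑ t ∈ Finset.range N, f t (J t ω) (ω (c t (J t ω)))}
      ≤ ENNReal.ofReal (Real.exp (-u)) := by
  obtain ⟨h1, h2⟩ := lintegral_prod_le_one ν hJ
    (W := fun t k z => ENNReal.ofReal (Real.exp (f t k z)))
    (fun t ht k => (Real.measurable_exp.comp (hf t ht k)).ennreal_ofReal) hf1 N le_rfl
  have h3 := meas_ge_le_lintegral_div h1.aemeasurable (μ := Measure.pi ν)
    (ε := ENNReal.ofReal (Real.exp u)) (by simp [Real.exp_pos]) ENNReal.ofReal_ne_top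
  have h4 : {ω | u ≤ ∑ t ∈ Finset.range N, f t (J t ω) (ω (c t (J t ω)))}
      = {ω | ENNReal.ofReal (Real.exp u)
        ≤ ∏ t ∈ Finset.range N, ENNReal.ofReal (Real.exp (f t (J t ω) (ω (c t (J t ω)))))} := by
    ext ω
    simp only [Set.mem_ofPred_eq]
    rw [← ENNReal.ofReal_prod_of_nonneg fun _ _ => (Real.exp_pos _).le, ← Real.exp_sum,
      ENNReal.ofReal_le_ofReal_iff (Real.exp_pos _).le, Real.exp_le_exp]
  rw [h4]
  refine h3.trans ((ENNReal.div_le_div_right h2 _).trans ?_)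
  rw [Real.exp_neg, ENNReal.ofReal_inv_of_pos (Real.exp_pos _), one_div]

end Product

/-- Hoeffding's lemma. -/
theorem lintegral_exp_le_one {Ω : Type*} [MeasurableSpace Ω] (μ : Measure Ω)
    [IsProbabilityMeasure μ] {X : Ω → ℝ} (hX : Measurable X) {a b σ : ℝ} (hσ : 0 ≤ σ)
    (hab : b - a = 2 * σ) (hb : ∀ᵐ ω ∂μ, X ω ∈ Set.Icc a b) (t : ℝ) :
    ∫⁻ ω, ENNReal.ofReal (Real.exp (t * (X ω - ∫ x, X x ∂μ) - σ ^ 2 * t ^ 2 / 2)) ∂μ ≤ 1 := by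
  have h := ProbabilityTheory.hasSubgaussianMGF_of_mem_Icc hX.aemeasurable hb
  have h1 := h.mgf_le t
  have h2 := h.integrable_exp_mul t
  -- The variance proxy of a variable with range of length `2σ` is `σ²`.
  have hc : ((((‖b - a‖₊ / 2) ^ 2 : NNReal)) : ℝ) = σ ^ 2 := by
    push_cast
    rw [hab, Real.norm_of_nonneg (by positivity)]; ring
  rw [hc] at h1
  have h3 : ∀ ω, Real.exp (t * (X ω - ∫ x, X x ∂μ) - σ ^ 2 * t ^ 2 / 2)
      = Real.exp (t * (X ω - ∫ x, X x ∂μ)) * Real.exp (-(σ ^ 2 * t ^ 2 / 2)) := fun ω => by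
    rw [← Real.exp_add]; congr 1
  simp_rw [h3]
  rw [← ofReal_integral_eq_lintegral_ofReal (h2.mul_const _)
    (Filter.Eventually.of_forall fun _ => by positivity), integral_mul_const]
  rw [← ENNReal.ofReal_one]
  apply ENNReal.ofReal_le_ofReal
  calc _ ≤ Real.exp (σ ^ 2 * t ^ 2 / 2) * Real.exp (-(σ ^ 2 * t ^ 2 / 2)) :=
        mul_le_mul_of_nonneg_right h1 (Real.exp_pos _).le
    _ = 1 := by rw [← Real.exp_add]; simp

section Law

variable {S A : Type*} {M H : ℕ} [MeasurableSpace S] [Fintype S] [MeasurableSingletonClass S]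
  (E : NonstatMDP S A M H)

theorem integral_comp_snd (m : Fin M) (h : Fin H) (s : S) (a : A) (W : S → ℝ) :
    ∫ z, W z.2 ∂(E.law m h s a) = ∑ s', E.trans m h s a s' * W s' := by
  have := E.isProb m h s a
  have hW := measurable_of_finite W
  rw [← integral_map (φ := Prod.snd) (f := W) measurable_snd.aemeasurable
    hW.aestronglyMeasurable]
  have : IsProbabilityMeasure ((E.law m h s a).map Prod.snd) :=
    Measure.isProbabilityMeasure_map measurable_snd.aemeasurable
  rw [integral_fintype (Integrable.of_finite)]
  refine Finset.sum_congr rfl fun s' _ => ?_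
  rw [map_measureReal_apply measurable_snd (measurableSet_singleton s'), smul_eq_mul]
  rfl

theorem integral_reward_add (m : Fin M) (h : Fin H) (s : S) (a : A) (W : S → ℝ) :
    ∫ z, (z.1 + W z.2) ∂(E.law m h s a) = E.lookahead m h W s a := by
  have := E.isProb m h s a
  have hW : Measurable fun z : ℝ × S => W z.2 :=
    (measurable_of_finite W).comp measurable_snd
  rw [integral_add, integral_comp_snd]
  · rfl
  · exact Integrable.of_mem_Icc 0 1 measurable_fst.aemeasurable (E.reward_mem m h s a)
  · obtain ⟨a', ha⟩ := (Set.finite_range W).bddBelow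
    obtain ⟨b', hb⟩ := (Set.finite_range W).bddAbove
    exact Integrable.of_mem_Icc a' b' hW.aemeasurable
      (Filter.Eventually.of_forall fun z => ⟨ha ⟨_, rfl⟩, hb ⟨_, rfl⟩⟩)

end Law

end RestartQ

/-! ### Tail bounds for the stage averages and for the noise along the path. -/

namespace RestartQ

theorem visitCount_congr {vis vis' : ℕ → Prop} {k : ℕ} (h : ∀ i < k, (vis i ↔ vis' i)) :
    visitCount vis k = visitCount vis' k := by
  classical
  unfold visitCount
  congr 1
  exact Finset.filter_congr fun i hi => h i (Finset.mem_range.1 hi)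

theorem sum_range_mul_eq {M H : ℕ} (hH : 0 < H) (F : ℕ → Fin H → ℝ) :
    ∑ t ∈ Finset.range (M * H), F (t / H) ⟨t % H, Nat.mod_lt t hH⟩
      = ∑ m ∈ Finset.range M, ∑ h, F m h := by
  induction M with
  | zero => simp
  | succ M ih =>
    rw [Nat.succ_mul, Finset.sum_range_add, Finset.sum_range_succ, ih,
      ← Fin.sum_univ_eq_sum_range (fun x => F ((M * H + x) / H) ⟨(M * H + x) % H, _⟩)]
    congr 1
    refine Finset.sum_congr rfl fun h _ => ?_
    have h1 : (M * H + (h : ℕ)) / H = M := by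
      rw [mul_comm, Nat.mul_add_div hH, Nat.div_eq_of_lt h.2, add_zero]
    have h2 : (⟨(M * H + (h : ℕ)) % H, Nat.mod_lt _ hH⟩ : Fin H) = h := by
      apply Fin.ext
      simp [Nat.add_mod, Nat.mod_eq_of_lt h.2]
    rw [h1, h2]

section Events

variable {S A : Type*} {M H : ℕ} [MeasurableSpace S] [Fintype S] [MeasurableSingletonClass S]
  [Fintype A] [NeZero M] (E : NonstatMDP S A M H) (rule : ArgmaxRule A) (D : ℕ) (δ : ℝ)
  (s₁ : Fin M → S)

-- The case `m = m'` is included: the decision at step `h` is made before the coordinate of that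
-- step is revealed.
open Classical in
theorem visits_update {h : Fin H} {m m' : ℕ} (hm : m ≤ m') (hm' : m' < M) (s s' : S) (a a' : A)
    (ω : Fin M × Fin H × S × A → ℝ × S) (z : ℝ × S) :
    Visits rule D δ s₁ (Function.update ω (Fin.ofNat M m', h, s', a') z) h s a m
      ↔ Visits rule D δ s₁ ω h s a m := by
  have h1 : ∀ m'' : Fin M, (m'' : ℕ) < m → ∀ h₁ s a,
      Function.update ω (Fin.ofNat M m', h, s', a') z (m'', h₁, s, a) = ω (m'', h₁, s, a) := by
    intro m'' hlt h₁ s a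
    refine Function.update_of_ne ?_ _ _
    intro heq
    rw [ofNat_eq hm', Prod.ext_iff] at heq
    have := heq.1
    dsimp only at this
    rw [this] at hlt
    dsimp only at hlt
    omega
  have hmM : m < M := by omega
  have h2 : ∀ h₁ : Fin H, (h₁ : ℕ) < h → ∀ s a,
      Function.update ω (Fin.ofNat M m', h, s', a') z (⟨m, hmM⟩, h₁, s, a)
        = ω (⟨m, hmM⟩, h₁, s, a) := by
    intro h₁ hlt s a
    refine Function.update_of_ne ?_ _ _
    intro heq
    simp only [Prod.ext_iff] at heq
    rw [heq.2.1] at hlt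
    omega
  unfold Visits runAction
  rw [runState_congr rule D δ s₁ hmM h1 h2, tablesAt_congr rule D δ s₁ m h1]

theorem measurable_visitCount (h : Fin H) (s : S) (a : A) (m₀ k : ℕ) :
    Measurable fun ω : Fin M × Fin H × S × A → ℝ × S =>
      visitCount (fun l => Visits rule D δ s₁ ω h s a (m₀ + l)) k := by
  classical
  induction k with
  | zero => simp
  | succ k ih =>
    simp only [visitCount_succ]
    exact ih.add (Measurable.ite (measurableSet_visits rule D δ s₁ h s a _) measurable_const
      measurable_const)

/-- The choice at each episode is a Boolean: whether it is a visit belonging to stage `i`.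
Unselected episodes contribute the factor 1, so no union over visit times is needed. The sign `θ`
yields both tails. -/
theorem envMeasure_stage_tail_le {m₀ L : ℕ} (hL : 0 < L) (hLM : m₀ + L ≤ M) (hH : 0 < H)
    {ι : ℝ} (hι : 0 ≤ ι) (h : Fin H) (s : S) (a : A) (i : ℕ) {θ : ℝ} (hθ : θ ^ 2 = 1) :
    E.envMeasure {ω | stageLength H i * (H * Real.sqrt (ι / stageLength H i)) <
      θ * ∑ k ∈ stageVisits H (fun k => Visits rule D δ s₁ ω h s a (m₀ + k)) L i,
        ((ω (Fin.ofNat M (m₀ + k), h, s, a)).1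
      + E.lowV m₀ L (h + 1) (ω (Fin.ofNat M (m₀ + k), h, s, a)).2
      - E.lookahead (Fin.ofNat M (m₀ + k)) h (E.lowV m₀ L (h + 1)) s a)}
      ≤ ENNReal.ofReal (Real.exp (-(2 * ι))) := by
  classical
  have hprob : ∀ j : Fin M × Fin H × S × A,
      IsProbabilityMeasure (E.law j.1 j.2.1 j.2.2.1 j.2.2.2) := fun j => E.isProb _ _ _ _
  have hA : Nonempty A := nonempty_action rule
  have hH' : (0 : ℝ) < H := by exact_mod_cast hH
  have hn : (0 : ℝ) < stageLength H i := by exact_mod_cast stageLength_pos hH i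
  set n : ℝ := ((stageLength H i : ℕ) : ℝ) with hn_def
  set r : ℝ := Real.sqrt (ι / n) with hr
  have hr2 : n * r ^ 2 = ι := by
    rw [hr, Real.sq_sqrt (by positivity)]; field_simp
  have hr0 : 0 ≤ r := Real.sqrt_nonneg _
  -- The Chernoff optimum for `n` variables of range `H` and threshold `n H r`: linear term `4ι`,
  -- quadratic term `2ι`.
  set lam : ℝ := 4 * r / H with hlam
  set X : ℕ → ℝ × S → ℝ := fun k z => z.1 + E.lowV m₀ L (h + 1) z.2
    - E.lookahead (Fin.ofNat M (m₀ + k)) h (E.lowV m₀ L (h + 1)) s a with hX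
  let f : ℕ → Bool → ℝ × S → ℝ := fun k b z =>
    if b = true then lam * θ * X k z - (H / 2 : ℝ) ^ 2 * (lam * θ) ^ 2 / 2 else 0
  let c : ℕ → Bool → Fin M × Fin H × S × A := fun k _ => (Fin.ofNat M (m₀ + k), h, s, a)
  let J : ℕ → (Fin M × Fin H × S × A → ℝ × S) → Bool := fun k ω =>
    decide (Visits rule D δ s₁ ω h s a (m₀ + k) ∧
      stageSum H i ≤ visitCount (fun l => Visits rule D δ s₁ ω h s a (m₀ + l)) k ∧
      visitCount (fun l => Visits rule D δ s₁ ω h s a (m₀ + l)) k < stageSum H (i + 1))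
  have hJ : Predictable L J c := by
    refine ⟨?_, ?_, ?_⟩
    · intro t ht b
      have hc := measurable_visitCount rule D δ s₁ h s a m₀ t
      have h1 : MeasurableSet {ω : Fin M × Fin H × S × A → ℝ × S |
          Visits rule D δ s₁ ω h s a (m₀ + t) ∧
          stageSum H i ≤ visitCount (fun l => Visits rule D δ s₁ ω h s a (m₀ + l)) t ∧
          visitCount (fun l => Visits rule D δ s₁ ω h s a (m₀ + l)) t < stageSum H (i + 1)} :=
        (measurableSet_visits rule D δ s₁ h s a _).inter
          ((measurableSet_le measurable_const hc).inter (measurableSet_lt hc measurable_const))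
      cases b
      · simp only [J, decide_eq_false_iff_not]; exact h1.compl
      · simp only [J, decide_eq_true_eq]; exact h1
    · intro t t' htt' ht' b ω z
      have hv : ∀ l ≤ t, (Visits rule D δ s₁ (Function.update ω (c t' b) z) h s a (m₀ + l)
          ↔ Visits rule D δ s₁ ω h s a (m₀ + l)) := fun l hl =>
        visits_update rule D δ s₁ (by omega) (by omega) s s a a ω z
      simp only [J]
      rw [visitCount_congr fun l hl => hv l hl.le, hv t le_rfl]
    · intro t t' htt' ht' _ _ heq
      simp only [c, Prod.mk.injEq, and_true] at heq
      rw [ofNat_eq (by omega), ofNat_eq (by omega), Fin.mk.injEq] at heq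
      omega
  have hlow : Measurable fun z : ℝ × S => z.1 + E.lowV m₀ L (h + 1) z.2 :=
    measurable_fst.add ((measurable_of_finite _).comp measurable_snd)
  have hXm : ∀ k, Measurable (X k) := fun k => hlow.sub_const _
  have hf : ∀ t < L, ∀ b, Measurable (f t b) := by
    intro t _ b
    cases b
    · simp only [f, Bool.false_eq_true, if_false]; exact measurable_const
    · simp only [f, if_true]; exact ((hXm t).const_mul _).sub_const _
  have hf1 : ∀ t < L, ∀ b, ∫⁻ z, ENNReal.ofReal (Real.exp (f t b z))
      ∂(E.law (c t b).1 (c t b).2.1 (c t b).2.2.1 (c t b).2.2.2) ≤ 1 := by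
    intro t _ b
    cases b
    · simp [f]
    · simp only [f, if_true, hX, c]
      have := E.isProb (Fin.ofNat M (m₀ + t)) h s a
      rw [← integral_reward_add]
      refine lintegral_exp_le_one _ hlow (a := 0) (b := H) (by positivity) (by ring) ?_ _
      refine (E.reward_mem (Fin.ofNat M (m₀ + t)) h s a).mono fun z hz => ?_
      have hV := E.lowV_mem m₀ hL (h := h + 1) h.2 z.2
      push_cast at hV
      have : (0 : ℝ) ≤ (h : ℕ) := Nat.cast_nonneg _
      exact ⟨add_nonneg hz.1 hV.1, by linarith [hz.2, hV.2]⟩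
  refine (measure_mono ?_).trans (measure_le_sum_le
    (fun j : Fin M × Fin H × S × A => E.law j.1 j.2.1 j.2.2.1 j.2.2.2) hJ hf hf1 (2 * ι))
  intro ω hω
  rw [Set.mem_ofPred_eq] at hω ⊢
  have hsum : ∑ t ∈ Finset.range L, f t (J t ω) (ω (c t (J t ω)))
      = ∑ t ∈ stageVisits H (fun k => Visits rule D δ s₁ ω h s a (m₀ + k)) L i,
        (lam * θ * X t (ω (Fin.ofNat M (m₀ + t), h, s, a))
          - (H / 2 : ℝ) ^ 2 * (lam * θ) ^ 2 / 2) := by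
    rw [stageVisits, Finset.sum_filter]
    refine Finset.sum_congr rfl fun t _ => ?_
    simp only [f, J, decide_eq_true_eq, c]
  rw [hsum, Finset.sum_sub_distrib, ← Finset.mul_sum, Finset.sum_const, nsmul_eq_mul, mul_pow, hθ,
    mul_assoc lam θ]
  -- A stage may be incomplete; fewer visits only decrease the quadratic term.
  have hcard : ((stageVisits H (fun k => Visits rule D δ s₁ ω h s a (m₀ + k)) L i).card : ℝ) ≤ n :=
    Nat.cast_le.2 (card_stageVisits_le L i)
  have hlam0 : 0 ≤ lam := by positivity
  have h1 := mul_le_mul_of_nonneg_left hω.le hlam0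
  have h2 : lam * (n * (H * r)) = 4 * ι := by rw [hlam, ← hr2]; field_simp
  have h3 : n * ((H / 2 : ℝ) ^ 2 * (lam ^ 2 * 1) / 2) = 2 * ι := by
    rw [hlam, ← hr2]; field_simp; ring
  have h4 := mul_le_mul_of_nonneg_right hcard
    (by positivity : 0 ≤ (H / 2 : ℝ) ^ 2 * (lam ^ 2 * 1) / 2)
  linarith

theorem envMeasure_not_stageConc_le {m₀ L : ℕ} (hL : 0 < L) (hLM : m₀ + L ≤ M) (hH : 0 < H)
    {ι : ℝ} (hι : 0 ≤ ι) (h : Fin H) (s : S) (a : A) (i : ℕ) :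
    E.envMeasure {ω | ¬ |∑ k ∈ stageVisits H (fun k => Visits rule D δ s₁ ω h s a (m₀ + k)) L i,
        ((ω (Fin.ofNat M (m₀ + k), h, s, a)).1
      + E.lowV m₀ L (h + 1) (ω (Fin.ofNat M (m₀ + k), h, s, a)).2
      - E.lookahead (Fin.ofNat M (m₀ + k)) h (E.lowV m₀ L (h + 1)) s a)|
      ≤ stageLength H i * (H * Real.sqrt (ι / stageLength H i))}
      ≤ 2 * ENNReal.ofReal (Real.exp (-(2 * ι))) := by
  rw [two_mul]
  refine (measure_mono ?_).trans ((measure_union_le _ _).trans (add_le_add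
    (envMeasure_stage_tail_le E rule D δ s₁ hL hLM hH hι h s a i (θ := 1) (by norm_num))
    (envMeasure_stage_tail_le E rule D δ s₁ hL hLM hH hι h s a i (θ := -1) (by norm_num))))
  intro ω hω
  rw [Set.mem_ofPred_eq, not_le, lt_abs] at hω
  rw [Set.mem_union, Set.mem_ofPred_eq, Set.mem_ofPred_eq, one_mul, neg_one_mul]
  exact hω

theorem runState_update_of_le (hH : 0 < H) {t t' : ℕ} (htt' : t ≤ t') (ht' : t' < M * H)
    [DecidableEq (Fin M × Fin H × S × A)]
    (s' : S) (a' : A) (ω : Fin M × Fin H × S × A → ℝ × S) (z : ℝ × S) :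
    policyAt rule D δ s₁ (Function.update ω
        (Fin.ofNat M (t' / H), ⟨t' % H, Nat.mod_lt _ hH⟩, s', a') z) (Fin.ofNat M (t / H))
        = policyAt rule D δ s₁ ω (Fin.ofNat M (t / H)) ∧
    runState rule D δ s₁ (Function.update ω
        (Fin.ofNat M (t' / H), ⟨t' % H, Nat.mod_lt _ hH⟩, s', a') z) (t / H) (t % H)
        = runState rule D δ s₁ ω (t / H) (t % H) := by
  have hq' : t' / H < M := (Nat.div_lt_iff_lt_mul hH).2 ht'
  have hq : t / H < M := (Nat.div_lt_iff_lt_mul hH).2 (by omega)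
  have hqq : t / H ≤ t' / H := Nat.div_le_div_right htt'
  have h1 : ∀ m'' : Fin M, (m'' : ℕ) < t / H → ∀ h₁ s a,
      Function.update ω (Fin.ofNat M (t' / H), ⟨t' % H, Nat.mod_lt _ hH⟩, s', a') z (m'', h₁, s, a)
        = ω (m'', h₁, s, a) := by
    intro m'' hlt h₁ s a
    refine Function.update_of_ne ?_ _ _
    intro heq
    rw [ofNat_eq hq', Prod.ext_iff] at heq
    have := heq.1
    dsimp only at this
    rw [this] at hlt
    dsimp only at hlt
    omega
  have h2 : ∀ h₁ : Fin H, (h₁ : ℕ) < t % H → ∀ s a,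
      Function.update ω (Fin.ofNat M (t' / H), ⟨t' % H, Nat.mod_lt _ hH⟩, s', a') z
        (⟨t / H, hq⟩, h₁, s, a) = ω (⟨t / H, hq⟩, h₁, s, a) := by
    intro h₁ hlt s a
    refine Function.update_of_ne ?_ _ _
    intro heq
    rw [ofNat_eq hq'] at heq
    simp only [Prod.mk.injEq, Fin.mk.injEq] at heq
    rw [heq.2.1] at hlt
    dsimp only at hlt
    have e1 := Nat.div_add_mod t H
    have e2 := Nat.div_add_mod t' H
    rw [heq.1] at e1
    omega
  constructor
  · unfold policyAt
    rw [tablesAt_congr rule D δ s₁ _ fun m' hm' => h1 m' (by rwa [ofNat_eq hq] at hm')]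
  · exact runState_congr rule D δ s₁ hq h1 h2

/-- The next-state gap depends on the played policy, which is random but settled before its episode
begins. Thus the predictable choice is the pair of policy and current state, and the gap is a fixed
function once this pair is frozen. -/
theorem envMeasure_pathNoise_le (hH : 0 < H) {ι : ℝ} (hι : 0 ≤ ι) (m₀ L : ℕ → ℕ)
    (hL : ∀ m < M, 0 < L m) :
    E.envMeasure {ω | 2 * (H * Real.sqrt (M * H * ι)) <
      ∑ m ∈ Finset.range M, ∑ h, pathNoise E rule D δ s₁ ω (m₀ m) (L m) m h}
      ≤ ENNReal.ofReal (Real.exp (-(2 * ι))) := by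
  classical
  have hprob : ∀ j : Fin M × Fin H × S × A,
      IsProbabilityMeasure (E.law j.1 j.2.1 j.2.2.1 j.2.2.2) := fun j => E.isProb _ _ _ _
  have hA : Nonempty A := nonempty_action rule
  have hH' : (0 : ℝ) < H := by exact_mod_cast hH
  have hM' : (0 : ℝ) < M := by exact_mod_cast Nat.pos_of_neZero M
  set r : ℝ := Real.sqrt (M * H * ι) with hr
  have hr2 : r ^ 2 = M * H * ι := Real.sq_sqrt (by positivity)
  have hr0 : 0 ≤ r := Real.sqrt_nonneg _
  -- The Chernoff optimum for `M H` increments with values in `[-H,H]`, whose variance proxy is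
  -- `H²`; again the exponent is `4ι - 2ι`.
  set lam : ℝ := 2 * r / (M * H * H) with hlam
  let st : ℕ → Fin H := fun t => ⟨t % H, Nat.mod_lt t hH⟩
  let U : ℕ → (Fin H → S → A) → S → ℝ := fun t π =>
    E.lowGap (m₀ (t / H)) (L (t / H)) (Fin.ofNat M (t / H)) π (st t + 1)
  let f : ℕ → (Fin H → S → A) × S → ℝ × S → ℝ := fun t k z =>
    (-lam) * (U t k.1 z.2 - ∑ s', E.trans (Fin.ofNat M (t / H)) (st t) k.2 (k.1 (st t) k.2) s'
      * U t k.1 s') - (H : ℝ) ^ 2 * (-lam) ^ 2 / 2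
  let c : ℕ → (Fin H → S → A) × S → Fin M × Fin H × S × A := fun t k =>
    (Fin.ofNat M (t / H), st t, k.2, k.1 (st t) k.2)
  let J : ℕ → (Fin M × Fin H × S × A → ℝ × S) → (Fin H → S → A) × S := fun t ω =>
    (policyAt rule D δ s₁ ω (Fin.ofNat M (t / H)), runState rule D δ s₁ ω (t / H) (t % H))
  have hJ : Predictable (M * H) J c := by
    refine ⟨?_, ?_, ?_⟩
    · intro t _ k
      simp only [J, Prod.ext_iff]
      exact (measurableSet_policyAt_eq rule D δ s₁ _ _).inter
        (measurableSet_runState_eq rule D δ s₁ _ _ _)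
    · intro t t' htt' ht' k ω z
      obtain ⟨h1, h2⟩ := runState_update_of_le rule D δ s₁ hH htt' ht' k.2 (k.1 (st t') k.2) ω z
      exact Prod.ext h1 h2
    · intro t t' htt' ht' k k' heq
      have hq' : t' / H < M := (Nat.div_lt_iff_lt_mul hH).2 ht'
      have hq : t / H < M := (Nat.div_lt_iff_lt_mul hH).2 (by omega)
      simp only [c, st, Prod.mk.injEq, Fin.mk.injEq] at heq
      rw [ofNat_eq hq, ofNat_eq hq', Fin.mk.injEq] at heq
      have e1 := Nat.div_add_mod t H
      have e2 := Nat.div_add_mod t' H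
      rw [heq.1, heq.2.1] at e1
      omega
  have hUm : ∀ t π, Measurable fun z : ℝ × S => U t π z.2 := fun t π =>
    (measurable_of_finite (U t π)).comp measurable_snd
  have hf : ∀ t < M * H, ∀ k, Measurable (f t k) := fun t _ k =>
    (((hUm t k.1).sub_const _).const_mul _).sub_const _
  have hf1 : ∀ t < M * H, ∀ k, ∫⁻ z, ENNReal.ofReal (Real.exp (f t k z))
      ∂(E.law (c t k).1 (c t k).2.1 (c t k).2.2.1 (c t k).2.2.2) ≤ 1 := by
    intro t ht k
    have hq : t / H < M := (Nat.div_lt_iff_lt_mul hH).2 ht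
    simp only [f, c]
    have := E.isProb (Fin.ofNat M (t / H)) (st t) k.2 (k.1 (st t) k.2)
    rw [← integral_comp_snd]
    refine lintegral_exp_le_one _ (hUm t k.1) (a := -H) (b := H) (by positivity) (by ring) ?_ _
    exact Filter.Eventually.of_forall fun z =>
      abs_le.1 (E.abs_lowGap_le (m₀ (t / H)) (hL _ hq) _ k.1 (h := st t + 1) (st t).2 z.2)
  refine (measure_mono ?_).trans (measure_le_sum_le
    (fun j : Fin M × Fin H × S × A => E.law j.1 j.2.1 j.2.2.1 j.2.2.2) hJ hf hf1 (2 * ι))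
  intro ω hω
  rw [Set.mem_ofPred_eq] at hω ⊢
  have hsum : ∑ t ∈ Finset.range (M * H), f t (J t ω) (ω (c t (J t ω)))
      = ∑ t ∈ Finset.range (M * H), (lam * pathNoise E rule D δ s₁ ω (m₀ (t / H)) (L (t / H))
        (t / H) (st t) - (H : ℝ) ^ 2 * lam ^ 2 / 2) := by
    refine Finset.sum_congr rfl fun t ht => ?_
    have hq : t / H < M := (Nat.div_lt_iff_lt_mul hH).2 (Finset.mem_range.1 ht)
    have h1 : runAction rule D δ s₁ ω (t / H) (st t)
        = policyAt rule D δ s₁ ω (Fin.ofNat M (t / H)) (st t)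
          (runState rule D δ s₁ ω (t / H) (t % H)) := by
      rw [runAction_eq_policyAt _ _ _ _ _ _ hq, ofNat_eq hq]
    have h2 := runState_succ rule D δ s₁ ω (t / H) (st t)
    rw [h1] at h2
    simp only [f, J, c, U, pathNoise, h1, h2]
    simp only [st]
    ring
  rw [hsum, Finset.sum_sub_distrib, ← Finset.mul_sum, Finset.sum_const, Finset.card_range,
    nsmul_eq_mul, sum_range_mul_eq hH fun m h => pathNoise E rule D δ s₁ ω (m₀ m) (L m) m h]
  have hlam0 : 0 ≤ lam := by positivity
  have h1 := mul_le_mul_of_nonneg_left hω.le hlam0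
  have h2 : lam * (2 * (H * r)) = 4 * ι := by
    rw [hlam, show 2 * r / ((M : ℝ) * H * H) * (2 * (H * r)) = 4 * r ^ 2 / (M * H) by
      field_simp; ring, hr2]
    field_simp
  have h3 : ((M * H : ℕ) : ℝ) * ((H : ℝ) ^ 2 * lam ^ 2 / 2) = 2 * ι := by
    rw [hlam]
    push_cast
    rw [show (M : ℝ) * H * ((H : ℝ) ^ 2 * (2 * r / (M * H * H)) ^ 2 / 2) = 2 * r ^ 2 / (M * H) by
      field_simp, hr2]
    field_simp
  linarith

end Events

end RestartQ

/-! ### The good event and the sum over epochs. -/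

namespace RestartQ

/-- Splitting `M` episodes into `D` epochs of `K` episodes. -/
theorem sum_range_eq_sum_epochs {M K : ℕ} (D : ℕ) (f : ℕ → ℝ) (hM : M ≤ D * K) :
    ∑ m ∈ Finset.range M, f m
      = ∑ d ∈ Finset.range D, ∑ k ∈ Finset.range (min K (M - d * K)), f (d * K + k) := by
  have key : ∀ n, ∑ m ∈ Finset.range (min M (n * K)), f m
      = ∑ d ∈ Finset.range n, ∑ k ∈ Finset.range (min K (M - d * K)), f (d * K + k) := by
    intro n
    induction n with
    | zero => simp
    | succ n ih =>
      rw [Finset.sum_range_succ, ← ih, Nat.succ_mul]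
      rcases le_total M (n * K) with h | h
      · have h1 : min M (n * K + K) = M := by omega
        have h2 : min K (M - n * K) = 0 := by omega
        rw [h1, h2, min_eq_left h]; simp
      · have h1 : min M (n * K + K) = n * K + min K (M - n * K) := by omega
        rw [h1, min_eq_right h, Finset.sum_range_add]
  rw [← key D, min_eq_left hM]

section Final

variable {S A : Type*} {M H : ℕ} [MeasurableSpace S] [Fintype S] [MeasurableSingletonClass S]
  [Fintype A] [NeZero M]

theorem epochLength_pos {D : ℕ} (hD : 0 < D) : 0 < epochLength M D := by
  refine Nat.ceil_pos.2 (div_pos ?_ ?_)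
  · exact_mod_cast Nat.pos_of_neZero M
  · exact_mod_cast hD

theorem le_mul_epochLength {D : ℕ} (hD : 0 < D) : M ≤ D * epochLength M D := by
  have hD' : (0 : ℚ) < D := by exact_mod_cast hD
  have h := Nat.le_ceil ((M : ℚ) / D)
  rw [div_le_iff₀ hD'] at h
  have : (M : ℚ) ≤ (D * epochLength M D : ℕ) := by
    push_cast; rw [mul_comm]; exact h
  exact_mod_cast this

theorem epochLength_le_of_two_le {D : ℕ} (hK : 2 ≤ epochLength M D) :
    (epochLength M D : ℝ) ≤ 2 * (M / D) := by
  have h1 : (1 : ℚ) < (M : ℚ) / D := by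
    have : 1 < ⌈(M : ℚ) / D⌉₊ := hK
    rw [Nat.lt_ceil] at this
    exact_mod_cast this
  have h2 : ((epochLength M D : ℕ) : ℚ) < (M : ℚ) / D + 1 :=
    Nat.ceil_lt_add_one (by positivity)
  have h3 : ((epochLength M D : ℕ) : ℚ) ≤ 2 * ((M : ℚ) / D) := by linarith
  have h4 := (Rat.cast_le (K := ℝ)).2 h3
  push_cast at h4
  exact h4

/-- The number of episodes of the epoch which starts at `m₀`. -/
def epochCard (M D m₀ : ℕ) : ℕ := min (epochLength M D) (M - m₀)

/-- All random fluctuations are within their bounds. -/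
structure GoodEvent (E : NonstatMDP S A M H) (rule : ArgmaxRule A) (D : ℕ) (δ : ℝ)
    (s₁ : Fin M → S) (ω : Fin M × Fin H × S × A → ℝ × S) : Prop where
  conc : ∀ m₀ < M, EpochConc E rule D δ s₁ ω m₀ (epochCard M D m₀)
  noise : ∑ m ∈ Finset.range M, ∑ h, pathNoise E rule D δ s₁ ω (m / epochLength M D * epochLength M D)
    (epochCard M D (m / epochLength M D * epochLength M D)) m h
      ≤ 2 * (H * Real.sqrt (M * H * Real.log (2 / δ)))

/-- The union bound runs over all possible starts `m₀ < M`, not just epoch starts, and over stage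
indices below `M`, which suffice because stages are nonempty. The extra factors are affordable since
each tail is quadratic in `δ`. -/
theorem envMeasure_not_goodEvent_le (E : NonstatMDP S A M H) (rule : ArgmaxRule A) {D : ℕ}
    (hD : 0 < D) (δ : ℝ) (s₁ : Fin M → S) (hH : 0 < H) (hι : 0 ≤ Real.log (2 / δ)) :
    E.envMeasure {ω | ¬ GoodEvent E rule D δ s₁ ω} ≤
      (M * H * Fintype.card S * Fintype.card A * M * 2 + 1 : ℕ)
        * ENNReal.ofReal (Real.exp (-(2 * Real.log (2 / δ)))) := by
  have hK := epochLength_pos (M := M) hD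
  let B : Fin M × Fin H × S × A × Fin M → Set (Fin M × Fin H × S × A → ℝ × S) := fun x =>
    {ω | ¬ |∑ k ∈ stageVisits H (fun k => Visits rule D δ s₁ ω x.2.1 x.2.2.1 x.2.2.2.1 (x.1 + k))
        (epochCard M D x.1) x.2.2.2.2,
        ((ω (Fin.ofNat M (x.1 + k), x.2.1, x.2.2.1, x.2.2.2.1)).1
      + E.lowV x.1 (epochCard M D x.1) (x.2.1 + 1)
          (ω (Fin.ofNat M (x.1 + k), x.2.1, x.2.2.1, x.2.2.2.1)).2
      - E.lookahead (Fin.ofNat M (x.1 + k)) x.2.1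
          (E.lowV x.1 (epochCard M D x.1) (x.2.1 + 1)) x.2.2.1 x.2.2.2.1)|
      ≤ stageLength H x.2.2.2.2
        * (H * Real.sqrt (Real.log (2 / δ) / stageLength H x.2.2.2.2))}
  let N : Set (Fin M × Fin H × S × A → ℝ × S) := {ω | 2 * (H * Real.sqrt (M * H * Real.log (2 / δ)))
    < ∑ m ∈ Finset.range M, ∑ h, pathNoise E rule D δ s₁ ω (m / epochLength M D * epochLength M D)
    (epochCard M D (m / epochLength M D * epochLength M D)) m h}
  have hsub : {ω | ¬ GoodEvent E rule D δ s₁ ω} ⊆ (⋃ x, B x) ∪ N := by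
    intro ω hω
    by_contra hc
    rw [Set.mem_union, not_or, Set.mem_iUnion, not_exists] at hc
    refine hω ⟨?_, not_lt.1 hc.2⟩
    intro m₀ hm₀ h s a i hi
    have hiM : i < M := by
      have : epochCard M D m₀ ≤ M - m₀ := min_le_right _ _
      omega
    exact not_not.1 (hc.1 (⟨m₀, hm₀⟩, h, s, a, ⟨i, hiM⟩))
  refine (measure_mono hsub).trans ((measure_union_le _ _).trans ?_)
  have h1 : E.envMeasure (⋃ x, B x) ≤ ∑ x : Fin M × Fin H × S × A × Fin M,
      2 * ENNReal.ofReal (Real.exp (-(2 * Real.log (2 / δ)))) := by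
    refine (measure_iUnion_fintype_le _ _).trans (Finset.sum_le_sum fun x _ => ?_)
    have hx := x.1.2
    refine envMeasure_not_stageConc_le E rule D δ s₁ (m₀ := x.1) ?_ ?_ hH hι _ _ _ _
    · rw [epochCard, lt_min_iff]; omega
    · have : epochCard M D x.1 ≤ M - x.1 := min_le_right _ _
      omega
  have h2 : E.envMeasure N ≤ ENNReal.ofReal (Real.exp (-(2 * Real.log (2 / δ)))) := by
    refine envMeasure_pathNoise_le E rule D δ s₁ hH hι
      (fun m => m / epochLength M D * epochLength M D)
      (fun m => epochCard M D (m / epochLength M D * epochLength M D)) ?_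
    intro m hm
    have : m / epochLength M D * epochLength M D ≤ m := Nat.div_mul_le_self _ _
    rw [epochCard, lt_min_iff]; omega
  refine (add_le_add h1 h2).trans_eq ?_
  rw [Finset.sum_const, Finset.card_univ, nsmul_eq_mul]
  simp only [Fintype.card_prod, Fintype.card_fin]
  push_cast
  ring

/-- The total variation between the episodes `m` and `m + 1`, if these exist. -/
noncomputable def episodeVariation (E : NonstatMDP S A M H) (m : ℕ) : ℝ :=
  if m + 1 < M then ∑ h, E.stepVariation m h else 0

theorem episodeVariation_nonneg (E : NonstatMDP S A M H) (m : ℕ) : 0 ≤ episodeVariation E m := by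
  unfold episodeVariation
  split_ifs
  · exact Finset.sum_nonneg fun h _ => E.stepVariation_nonneg m h
  · exact le_rfl

/-- The weight `H` on the transitions is extended to the rewards, at no loss in the stated rate. -/
theorem sum_episodeVariation_le (E : NonstatMDP S A M H) (hH : 0 < H) :
    ∑ m ∈ Finset.range M, episodeVariation E m ≤ H * E.variation := by
  have hH' : (1 : ℝ) ≤ H := by exact_mod_cast hH
  rw [← Fin.sum_univ_eq_sum_range, NonstatMDP.variation, NonstatMDP.rewardVariation,
    NonstatMDP.transVariation, ← Finset.sum_add_distrib, Finset.mul_sum]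
  refine Finset.sum_le_sum fun m _ => ?_
  unfold episodeVariation
  split_ifs with hm
  · have e1 : Fin.ofNat M m = m := ofNat_eq m.2
    have e2 : Fin.ofNat M (m + 1) = ⟨m + 1, hm⟩ := ofNat_eq hm
    simp only [NonstatMDP.stepVariation, e1, e2]
    rw [Finset.sum_add_distrib, ← Finset.mul_sum, mul_add]
    have : 0 ≤ ∑ h : Fin H, ⨆ x : S × A, |E.meanReward m h x.1 x.2
        - E.meanReward ⟨m + 1, hm⟩ h x.1 x.2| :=
      Finset.sum_nonneg fun h _ => Real.iSup_nonneg fun _ => abs_nonneg _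
    nlinarith
  · simp

/-- Rounding up at most doubles the epoch length when it is at least 2. Epochs of one episode may be
much longer than `M / D`, but they contain no variation. -/
theorem epochCard_mul_variation_le (E : NonstatMDP S A M H) (D m₀ : ℕ) :
    epochCard M D m₀ * ∑ h, E.epochVariation m₀ (epochCard M D m₀) h
      ≤ 2 * (M / D) * ∑ k ∈ Finset.range (epochCard M D m₀), episodeVariation E (m₀ + k) := by
  set L := epochCard M D m₀ with hL
  have hLK : L ≤ epochLength M D := min_le_left _ _
  have hLM : L ≤ M - m₀ := min_le_right _ _
  have h1 : ∑ h, E.epochVariation m₀ L h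
      = ∑ k ∈ Finset.range (L - 1), episodeVariation E (m₀ + k) := by
    simp only [NonstatMDP.epochVariation]
    rw [Finset.sum_comm]
    refine Finset.sum_congr rfl fun k hk => ?_
    rw [Finset.mem_range] at hk
    rw [episodeVariation, if_pos (by omega)]
  have h2 : ∑ k ∈ Finset.range (L - 1), episodeVariation E (m₀ + k)
      ≤ ∑ k ∈ Finset.range L, episodeVariation E (m₀ + k) :=
    Finset.sum_le_sum_of_subset_of_nonneg (Finset.range_mono (Nat.sub_le _ _))
      fun _ _ _ => episodeVariation_nonneg E _
  have h0 : 0 ≤ ∑ k ∈ Finset.range L, episodeVariation E (m₀ + k) :=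
    Finset.sum_nonneg fun _ _ => episodeVariation_nonneg E _
  rw [h1]
  by_cases hK : 2 ≤ epochLength M D
  · have h3 : (L : ℝ) ≤ 2 * (M / D) :=
      le_trans (by exact_mod_cast hLK) (epochLength_le_of_two_le hK)
    calc _ ≤ (L : ℝ) * ∑ k ∈ Finset.range L, episodeVariation E (m₀ + k) :=
          mul_le_mul_of_nonneg_left h2 (Nat.cast_nonneg _)
      _ ≤ _ := mul_le_mul_of_nonneg_right h3 h0
  · have : L - 1 = 0 := by omega
    rw [this, Finset.range_zero, Finset.sum_empty, mul_zero]
    positivity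

theorem GoodEvent.dynamicRegret_le {E : NonstatMDP S A M H} {rule : ArgmaxRule A} {D : ℕ} {δ : ℝ}
    {s₁ : Fin M → S} {ω : Fin M × Fin H × S × A → ℝ × S} (G : GoodEvent E rule D δ s₁ ω)
    (hD : 0 < D) (hH : 0 < H) (hι : 0 ≤ Real.log (2 / δ)) :
    dynamicRegret E rule D δ s₁ ω ≤
      8 * (M / D * (H * E.variation)) + 3 * (D * (Fintype.card S * Fintype.card A * H ^ 3))
        + 42 * (H ^ 2 * Real.sqrt H * Real.sqrt (Real.log (2 / δ)))
            * Real.sqrt (D * (Fintype.card S * Fintype.card A * M))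
        + 2 * (H * Real.sqrt (M * H * Real.log (2 / δ))) := by
  set K := epochLength M D with hKdef
  have hK : 0 < K := epochLength_pos hD
  have hMD : M ≤ D * K := le_mul_epochLength hD
  have hsplit := fun f => sum_range_eq_sum_epochs (M := M) (K := K) D f hMD
  change ∀ f : ℕ → ℝ, _ = ∑ d ∈ Finset.range D, ∑ k ∈ Finset.range (epochCard M D (d * K)), _
    at hsplit
  have hreg : dynamicRegret E rule D δ s₁ ω = ∑ m ∈ Finset.range M,
      (E.optValue (Fin.ofNat M m) (s₁ (Fin.ofNat M m))
        - E.value (Fin.ofNat M m) (policyAt rule D δ s₁ ω (Fin.ofNat M m))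
          (s₁ (Fin.ofNat M m))) := by
    rw [dynamicRegret, ← Fin.sum_univ_eq_sum_range (fun m =>
      E.optValue (Fin.ofNat M m) (s₁ (Fin.ofNat M m))
        - E.value (Fin.ofNat M m) (policyAt rule D δ s₁ ω (Fin.ofNat M m))
          (s₁ (Fin.ofNat M m)))]
    refine Finset.sum_congr rfl fun m _ => ?_
    have : Fin.ofNat M m = m := ofNat_eq m.2
    rw [this]
  rw [hreg, hsplit]
  set ι := Real.log (2 / δ)
  set b : ℝ := 42 * (H ^ 2 * Real.sqrt H * Real.sqrt ι) with hb
  have hb0 : 0 ≤ b := by positivity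
  have hepoch : ∀ d ∈ Finset.range D, ∑ k ∈ Finset.range (epochCard M D (d * K)),
      (E.optValue (Fin.ofNat M (d * K + k)) (s₁ (Fin.ofNat M (d * K + k)))
        - E.value (Fin.ofNat M (d * K + k)) (policyAt rule D δ s₁ ω (Fin.ofNat M (d * K + k)))
          (s₁ (Fin.ofNat M (d * K + k)))) ≤
      8 * (M / D) * ∑ k ∈ Finset.range (epochCard M D (d * K)), episodeVariation E (d * K + k)
        + 3 * (Fintype.card S * Fintype.card A * H ^ 3)
        + b * Real.sqrt (Fintype.card S * Fintype.card A * epochCard M D (d * K))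
        + ∑ k ∈ Finset.range (epochCard M D (d * K)), ∑ h,
          pathNoise E rule D δ s₁ ω ((d * K + k) / K * K) (epochCard M D ((d * K + k) / K * K))
            (d * K + k) h := by
    intro d _
    have hLK : epochCard M D (d * K) ≤ K := min_le_left _ _
    by_cases hdM : d * K < M
    · have hLM : d * K + epochCard M D (d * K) ≤ M := by
        have : epochCard M D (d * K) ≤ M - d * K := min_le_right _ _
        omega
      have h1 := epoch_regret_le (E := E) (rule := rule) (D := D) (δ := δ) (s₁ := s₁) (ω := ω) hH
        (Nat.mul_mod_left d K) hLK hLM hι (G.conc _ hdM)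
      have h2 := epochCard_mul_variation_le E D (d * K)
      have h3 : ∑ k ∈ Finset.range (epochCard M D (d * K)), ∑ h,
          pathNoise E rule D δ s₁ ω ((d * K + k) / K * K) (epochCard M D ((d * K + k) / K * K))
            (d * K + k) h = ∑ k ∈ Finset.range (epochCard M D (d * K)), ∑ h,
          pathNoise E rule D δ s₁ ω (d * K) (epochCard M D (d * K)) (d * K + k) h := by
        refine Finset.sum_congr rfl fun k hk => ?_
        rw [Finset.mem_range] at hk
        have : (d * K + k) / K = d := by
          rw [mul_comm, Nat.mul_add_div hK, Nat.div_eq_of_lt (by omega), add_zero]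
        rw [this]
      rw [h3]
      linarith
    -- Because of the rounding, the last of the `D` epochs may lie beyond episode `M` and be empty.
    · have h0 : epochCard M D (d * K) = 0 := by
        rw [epochCard]; omega
      rw [h0]
      simp only [Finset.range_zero, Finset.sum_empty, mul_zero, zero_add, add_zero, Nat.cast_zero,
        Real.sqrt_zero]
      positivity
  refine (Finset.sum_le_sum hepoch).trans ?_
  simp only [Finset.sum_add_distrib, ← Finset.mul_sum]
  rw [← hsplit, ← hsplit (fun m => ∑ h, pathNoise E rule D δ s₁ ω (m / K * K)
      (epochCard M D (m / K * K)) m h)]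
  simp only [Finset.sum_const, Finset.card_range, nsmul_eq_mul]
  have h1 := mul_le_mul_of_nonneg_left (sum_episodeVariation_le E hH)
    (by positivity : (0 : ℝ) ≤ 8 * (M / D))
  have h2 : ∑ m ∈ Finset.range M, ∑ h, pathNoise E rule D δ s₁ ω (m / K * K)
      (epochCard M D (m / K * K)) m h ≤ 2 * (H * Real.sqrt (M * H * ι)) := G.noise
  -- Cauchy–Schwarz over the epochs, whose lengths add up to `M`.
  have h3 : ∑ d ∈ Finset.range D,
      Real.sqrt (Fintype.card S * Fintype.card A * epochCard M D (d * K))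
      ≤ Real.sqrt (D * (Fintype.card S * Fintype.card A * M)) := by
    apply Real.le_sqrt_of_sq_le
    have h4 := sq_sum_le_card_mul_sum_sq (s := Finset.range D)
      (f := fun d => Real.sqrt (Fintype.card S * Fintype.card A * epochCard M D (d * K)))
    have h5 : ∑ d ∈ Finset.range D, (epochCard M D (d * K) : ℝ) = M := by
      have := hsplit fun _ => 1
      simpa using this.symm
    have h6 : ∀ d, Real.sqrt (Fintype.card S * Fintype.card A * epochCard M D (d * K)) ^ 2
        = Fintype.card S * Fintype.card A * (epochCard M D (d * K) : ℝ) := fun d =>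
      Real.sq_sqrt (by positivity)
    simp only [h6, ← Finset.mul_sum, h5, Finset.card_range] at h4
    exact h4
  have h4 := mul_le_mul_of_nonneg_left h3 hb0
  linarith

end Final

/-! ### The choice of the number of epochs -/

/-- With cube roots as variables, all fractional powers in the rate become integral powers and the
estimates become algebra. -/
theorem exists_cube_root {x : ℝ} (hx : 0 < x) : ∃ y : ℝ, 0 < y ∧ y ^ 3 = x ∧
    x ^ (1 / 3 : ℝ) = y ∧ x ^ (2 / 3 : ℝ) = y ^ 2 ∧ x ^ (5 / 3 : ℝ) = y ^ 5 ∧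
    x ^ (-(1 / 3) : ℝ) = y⁻¹ ∧ x ^ (-(2 / 3) : ℝ) = (y ^ 2)⁻¹ := by
  refine ⟨x ^ (1 / 3 : ℝ), Real.rpow_pos_of_pos hx _, ?_, rfl, ?_, ?_, ?_, ?_⟩
  · rw [← Real.rpow_natCast, ← Real.rpow_mul hx.le]; norm_num
  · rw [← Real.rpow_natCast, ← Real.rpow_mul hx.le]; norm_num
  · rw [← Real.rpow_natCast, ← Real.rpow_mul hx.le]; norm_num
  · rw [← Real.rpow_neg hx.le]
  · rw [← Real.rpow_natCast, ← Real.rpow_mul hx.le, ← Real.rpow_neg hx.le]; norm_num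

/-- The error terms are all bounded by the claimed rate. -/
theorem error_terms_le {c nS nA Δ h T D : ℝ} {D' : ℕ} (hc : 0 < c) (hS : 1 ≤ nS) (hA : 1 ≤ nA)
    (hΔ : 0 < Δ) (hh : 1 ≤ h) (hT : 0 < T) (hD : D = epochNumber nS nA Δ h T) (hD1 : 1 ≤ D)
    (hcT : c * (nS * nA * Δ * h ^ 2) ≤ T) (hD' : (D' : ℝ) ≤ 2 * D) (hDD' : D ≤ D') :
    let B := nS ^ (1 / 3 : ℝ) * nA ^ (1 / 3 : ℝ) * Δ ^ (1 / 3 : ℝ) * h ^ (5 / 3 : ℝ)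
      * T ^ (2 / 3 : ℝ)
    0 ≤ B ∧ T / D' * Δ ≤ B ∧ D' * (nS * nA * h ^ 3) ≤ 2 / c ^ (1 / 3 : ℝ) * B ∧
      h ^ 2 * Real.sqrt (D' * (nS * nA * T)) ≤ 3 / 2 * B ∧ h * Real.sqrt T ≤ 3 / 2 * B := by
  obtain ⟨c₁, hc1, hc3, ec, -⟩ := exists_cube_root hc
  obtain ⟨s, hs, hs3, es1, -, -, es2, -⟩ := exists_cube_root (zero_lt_one.trans_le hS)
  obtain ⟨a, ha, ha3, ea1, -, -, ea2, -⟩ := exists_cube_root (zero_lt_one.trans_le hA)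
  obtain ⟨d, hd, hd3, ed1, ed2, -⟩ := exists_cube_root hΔ
  obtain ⟨η, hη, hη3, -, -, eh5, -, eh2⟩ := exists_cube_root (zero_lt_one.trans_le hh)
  obtain ⟨τ, hτ, hτ3, et1, et2, -⟩ := exists_cube_root hT
  intro B
  have hη1 : 1 ≤ η := by
    by_contra hlt
    have : η ^ 3 < 1 := pow_lt_one₀ hη.le (not_le.1 hlt) (by norm_num)
    linarith
  have hB : B = s * a * d * η ^ 5 * τ ^ 2 := by
    simp only [B]; rw [es1, ea1, ed1, eh5, et2]
  have hDv : D = d ^ 2 * τ / (s * a * η ^ 2) := by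
    rw [hD, epochNumber, es2, ea2, ed2, eh2, et1]; field_simp
  have hB0 : 0 ≤ B := by rw [hB]; positivity
  have hD0 : 0 < D := by linarith
  have hsa : nS * nA * T = (s * a * τ) ^ 3 := by rw [← hs3, ← ha3, ← hτ3]; ring
  have hsq : h ^ 2 * Real.sqrt (D' * (nS * nA * T)) ≤ 3 / 2 * B := by
    -- The 2 comes from rounding `D` up; 3/2 is a rational bound for `√2`.
    have h1 : D' * (nS * nA * T) ≤ (3 / 2 * (d * τ ^ 2 * s * a / η)) ^ 2 := by
      have h2 : D' * (nS * nA * T) ≤ 2 * D * (nS * nA * T) :=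
        mul_le_mul_of_nonneg_right hD' (by positivity)
      have h3 : 2 * D * (nS * nA * T) = 2 * (d * τ ^ 2 * s * a / η) ^ 2 := by
        rw [hDv, hsa]; field_simp
      have h4 : 0 ≤ (d * τ ^ 2 * s * a / η) ^ 2 := by positivity
      nlinarith
    have h2 := Real.sqrt_le_sqrt h1
    rw [Real.sqrt_sq (by positivity)] at h2
    calc _ ≤ h ^ 2 * (3 / 2 * (d * τ ^ 2 * s * a / η)) := by gcongr
      _ = 3 / 2 * B := by rw [hB, ← hη3]; field_simp
  refine ⟨hB0, ?_, ?_, hsq, ?_⟩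
  · have h1 : T / D' * Δ ≤ T / D * Δ := by gcongr
    have h2 : T / D * Δ = s * a * d * η ^ 2 * τ ^ 2 := by
      rw [hDv, ← hτ3, ← hd3]; field_simp
    rw [h2] at h1
    refine h1.trans ?_
    rw [hB]
    have : η ^ 2 ≤ η ^ 5 := pow_le_pow_right₀ hη1 (by norm_num)
    gcongr
  · have h1 : D' * (nS * nA * h ^ 3) ≤ 2 * D * (nS * nA * h ^ 3) :=
      mul_le_mul_of_nonneg_right hD' (by positivity)
    have h2 : 2 * D * (nS * nA * h ^ 3) = 2 * (d ^ 2 * τ * s ^ 2 * a ^ 2 * η ^ 7) := by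
      rw [hDv, ← hs3, ← ha3, ← hη3]; field_simp
    -- The cube root of the assumption `c S A Δ H² ≤ T`, exactly what compares the first-stage cost
    -- `D S A H³` with the rate.
    have h3 : c₁ * (s * a * d * η ^ 2) ≤ τ := by
      refine le_of_pow_le_pow_left₀ (n := 3) (by norm_num) hτ.le ?_
      calc _ = c * (nS * nA * Δ * h ^ 2) := by
            rw [← hc3, ← hs3, ← ha3, ← hd3, ← hη3]; ring
        _ ≤ τ ^ 3 := by rw [hτ3]; exact hcT
    rw [ec, div_mul_eq_mul_div, le_div_iff₀ hc1]
    refine (mul_le_mul_of_nonneg_right h1 hc1.le).trans ?_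
    rw [h2, hB]
    have h4 := mul_le_mul_of_nonneg_left h3 (by positivity : 0 ≤ 2 * (s * a * d * η ^ 5 * τ))
    calc 2 * (d ^ 2 * τ * s ^ 2 * a ^ 2 * η ^ 7) * c₁
        = 2 * (s * a * d * η ^ 5 * τ) * (c₁ * (s * a * d * η ^ 2)) := by ring
      _ ≤ 2 * (s * a * d * η ^ 5 * τ) * τ := h4
      _ = 2 * (s * a * d * η ^ 5 * τ ^ 2) := by ring
  · refine le_trans ?_ hsq
    have h1 : (1 : ℝ) ≤ D' * (nS * nA) :=
      one_le_mul_of_one_le_of_one_le (hD1.trans hDD') (one_le_mul_of_one_le_of_one_le hS hA)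
    have h2 : T ≤ D' * (nS * nA * T) := by
      rw [← mul_assoc]; exact le_mul_of_one_le_left hT.le h1
    have h3 : h ≤ h ^ 2 := le_self_pow₀ hh (by norm_num)
    exact mul_le_mul h3 (Real.sqrt_le_sqrt h2) (Real.sqrt_nonneg _) (by positivity)

/-- The number of events is at most `3X²`, which the square of `δ / (16 X)` absorbs. -/
theorem failure_probability_le {m X δ : ℝ} (hmX : m ≤ X) (hX : 1 ≤ X) (hδ : 0 < δ)
    (hδ1 : δ ≤ 1) : (m * X * 2 + 1) * (δ / (16 * X)) ^ 2 ≤ δ := by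
  have hX0 : 0 < X := by linarith
  rw [div_pow, mul_div_assoc', div_le_iff₀ (by positivity)]
  have h3 : m * X ≤ X * X := mul_le_mul_of_nonneg_right hmX hX0.le
  have h4 : 1 ≤ X * X := one_le_mul_of_one_le_of_one_le hX hX
  have h5 : δ ^ 2 ≤ δ := by nlinarith
  calc (m * X * 2 + 1) * δ ^ 2 ≤ 3 * (X * X) * δ :=
        mul_le_mul (by linarith) h5 (sq_nonneg δ) (by positivity)
    _ ≤ δ * (16 * X) ^ 2 := by nlinarith [mul_nonneg hδ.le (sq_nonneg X)]

theorem one_lt_of_variation_pos {S A : Type*} [Fintype S] [MeasurableSpace S] {M H : ℕ}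
    {E : NonstatMDP S A M H} (h : 0 < E.variation) : 1 < M ∧ 0 < H := by
  constructor
  · by_contra hM
    have h0 : ∀ m : Fin M, ¬ (m.1 + 1 < M) := fun m => by omega
    simp [NonstatMDP.variation, NonstatMDP.rewardVariation, NonstatMDP.transVariation, h0] at h
  · by_contra hH
    obtain rfl : H = 0 := by omega
    simp [NonstatMDP.variation, NonstatMDP.rewardVariation, NonstatMDP.transVariation] at h

/-- Subadditivity suffices, so measurability of the regret event need not be shown. -/
theorem one_sub_le_of_compl_le {Ω : Type*} [MeasurableSpace Ω] {μ : Measure Ω}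
    [IsProbabilityMeasure μ] {s : Set Ω} {δ : ℝ} (hδ : 0 ≤ δ) (h : μ sᶜ ≤ ENNReal.ofReal δ) :
    1 - δ ≤ μ.real s := by
  have h1 : μ.real sᶜ ≤ δ := ENNReal.toReal_le_of_le_ofReal hδ h
  have h2 : μ.real (s ∪ sᶜ) ≤ μ.real s + μ.real sᶜ := measureReal_union_le _ _
  rw [Set.union_compl_self, probReal_univ] at h2
  linarith

end RestartQ

/-! ### Assembly of the theorem. -/

open RestartQ in
theorem mainTheorem3 :
    ∃ p : ℕ, ∀ c : ℝ, 0 < c → ∃ C : ℝ, 0 < C ∧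
      ∀ (S A : Type*) [Fintype S] [MeasurableSpace S] [MeasurableSingletonClass S] [Fintype A]
        (M H : ℕ) (E : NonstatMDP S A M H) (s₁ : Fin M → S) (rule : ArgmaxRule A)
        (nS nA T Δ D δ : ℝ),
        nS = Fintype.card S → nA = Fintype.card A → T = M * H → Δ = E.variation →
        D = RestartQ.epochNumber nS nA Δ H T →
        0 < Δ → 1 ≤ D → c * (nS * nA * Δ * (H : ℝ) ^ 2) ≤ T → 0 < δ → δ < 1 →
        1 - δ ≤ E.envMeasure.real
          {ω | RestartQ.dynamicRegret E rule ⌈D⌉₊ (δ / (8 * nS * nA * T)) s₁ ω ≤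
            C * Real.log (nS * nA * T / δ) ^ p *
              (nS ^ (1 / 3 : ℝ) * nA ^ (1 / 3 : ℝ) * Δ ^ (1 / 3 : ℝ) * (H : ℝ) ^ (5 / 3 : ℝ) *
                T ^ (2 / 3 : ℝ))} := by
  -- The constant 250 covers `16 + 42·(3/2)·(7/2) + 2·(3/2)·(7/2) = 247` from variation, deviations
  -- and noise. The first-stage cost `3·2/c^(1/3)` is doubled by `1 ≤ 2ℓ`.
  refine ⟨1, fun c hc => ⟨250 + 12 / c ^ (1 / 3 : ℝ), by positivity, ?_⟩⟩
  intro S A _ _ _ _ M H E s₁ rule nS nA T Δ D δ hnS hnA hT hΔ hD hΔ0 hD1 hcT hδ0 hδ1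
  obtain ⟨hM, hH⟩ := one_lt_of_variation_pos (hΔ ▸ hΔ0)
  have : NeZero M := ⟨by omega⟩
  have hprob : ∀ j : Fin M × Fin H × S × A,
      IsProbabilityMeasure (E.law j.1 j.2.1 j.2.2.1 j.2.2.2) := fun j => E.isProb _ _ _ _
  have hmeas : IsProbabilityMeasure E.envMeasure := by
    unfold NonstatMDP.envMeasure; infer_instance
  have hA : Nonempty A := nonempty_action rule
  have hS : Nonempty S := ⟨s₁ ⟨0, by omega⟩⟩
  have hS1 : 1 ≤ nS := by rw [hnS]; exact_mod_cast Fintype.card_pos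
  have hA1 : 1 ≤ nA := by rw [hnA]; exact_mod_cast Fintype.card_pos
  have hH1 : (1 : ℝ) ≤ H := by exact_mod_cast hH
  have hM2 : (2 : ℝ) ≤ M := by exact_mod_cast hM
  have hMT : (M : ℝ) ≤ T := by rw [hT]; nlinarith
  have hT0 : 0 < T := by linarith
  have hSA1 : 1 ≤ nS * nA := one_le_mul_of_one_le_of_one_le hS1 hA1
  set X : ℝ := nS * nA * T with hX
  have hTX : T ≤ X := by rw [hX]; nlinarith
  have hX2 : 2 ≤ X := by linarith
  set δ' : ℝ := δ / (8 * nS * nA * T) with hδ'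
  have hδ'X : δ' = δ / (8 * X) := by rw [hδ', hX]; congr 1; ring
  -- Positive variation forces `M ≥ 2`, so the logarithm `ℓ` is at least `log 2 > 1/2`; this absorbs
  -- every constant into a multiple of `ℓ`.
  have hXδ : 2 ≤ X / δ := by rw [le_div_iff₀ hδ0]; nlinarith
  have h2δ' : 2 / δ' = 2 ^ 4 * (X / δ) := by rw [hδ'X]; field_simp; norm_num
  have hι : Real.log (2 / δ') = 4 * Real.log 2 + Real.log (X / δ) := by
    rw [h2δ', Real.log_mul (by norm_num) (by positivity), Real.log_pow]; norm_num
  have hlog2 : Real.log 2 ≤ Real.log (X / δ) := Real.log_le_log (by norm_num) hXδ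
  have hl2 := Real.log_two_gt_d9
  set ℓ : ℝ := Real.log (X / δ) with hℓ
  set ι : ℝ := Real.log (2 / δ') with hιdef
  have hι0 : 0 ≤ ι := by linarith
  have hD0 : 0 < ⌈D⌉₊ := Nat.ceil_pos.2 (by linarith)
  have hDD' : D ≤ (⌈D⌉₊ : ℕ) := Nat.le_ceil D
  have hD' : ((⌈D⌉₊ : ℕ) : ℝ) ≤ 2 * D := by
    have := Nat.ceil_lt_add_one (by linarith : 0 ≤ D)
    linarith
  refine one_sub_le_of_compl_le hδ0.le ?_
  refine (measure_mono (t := {ω | ¬ GoodEvent E rule ⌈D⌉₊ δ' s₁ ω}) ?_).trans ?_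
  · intro ω hω G
    refine hω ?_
    rw [Set.mem_ofPred_eq]
    have hR := G.dynamicRegret_le hD0 hH hι0
    obtain ⟨hB0, b1, b2, b3, b4⟩ := error_terms_le hc hS1 hA1 hΔ0 hH1 hT0 hD hD1 hcT hD' hDD'
    set B := nS ^ (1 / 3 : ℝ) * nA ^ (1 / 3 : ℝ) * Δ ^ (1 / 3 : ℝ) * (H : ℝ) ^ (5 / 3 : ℝ)
      * T ^ (2 / 3 : ℝ) with hB
    -- From `√ι ≤ (ι + 1)/2` with `ι ≤ 5ℓ` and `1 ≤ 2ℓ`. A linear bound is enough, so the power of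
    -- the logarithm is 1.
    have hsι : Real.sqrt ι ≤ 7 / 2 * ℓ := by
      have h1 := Real.sq_sqrt hι0
      nlinarith [sq_nonneg (Real.sqrt ι - 1)]
    have hsι0 := Real.sqrt_nonneg ι
    rw [← hnS, ← hnA, ← hΔ] at hR
    have e1 : (M : ℝ) / (⌈D⌉₊ : ℕ) * (H * Δ) = T / (⌈D⌉₊ : ℕ) * Δ := by rw [hT]; ring
    have e2 : (H : ℝ) ^ 2 * Real.sqrt H * Real.sqrt ι * Real.sqrt ((⌈D⌉₊ : ℕ) * (nS * nA * M))
        = Real.sqrt ι * ((H : ℝ) ^ 2 * Real.sqrt ((⌈D⌉₊ : ℕ) * (nS * nA * T))) := by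
      rw [show ((⌈D⌉₊ : ℕ) : ℝ) * (nS * nA * T) = H * ((⌈D⌉₊ : ℕ) * (nS * nA * M)) by
        rw [hT]; ring, Real.sqrt_mul (Nat.cast_nonneg H)]
      ring
    have e3 : (H : ℝ) * Real.sqrt (M * H * ι) = Real.sqrt ι * (H * Real.sqrt T) := by
      rw [← hT, Real.sqrt_mul hT0.le]; ring
    rw [e1, mul_assoc 42, e2, e3] at hR
    have b3' := mul_le_mul_of_nonneg_left b3 hsι0
    have b4' := mul_le_mul_of_nonneg_left b4 hsι0
    have b5 := mul_le_mul_of_nonneg_right hsι hB0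
    have b6 : B ≤ 2 * ℓ * B := le_mul_of_one_le_left hB0 (by linarith)
    have hc1 : 0 < 1 / c ^ (1 / 3 : ℝ) := by positivity
    have b7 := mul_le_mul_of_nonneg_left b6 hc1.le
    have hℓB : 0 ≤ ℓ * B := mul_nonneg (by linarith) hB0
    have e4 : 2 / c ^ (1 / 3 : ℝ) * B = 2 * (1 / c ^ (1 / 3 : ℝ) * B) := by ring
    have e5 : (250 + 12 / c ^ (1 / 3 : ℝ)) * ℓ ^ 1 * B
        = 250 * (ℓ * B) + 6 * (1 / c ^ (1 / 3 : ℝ) * (2 * ℓ * B)) := by ring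
    rw [e5]
    rw [e4] at b2
    linarith
  · refine (envMeasure_not_goodEvent_le E rule hD0 δ' s₁ hH hι0).trans ?_
    rw [← ENNReal.ofReal_natCast, ← ENNReal.ofReal_mul (Nat.cast_nonneg _)]
    apply ENNReal.ofReal_le_ofReal
    have h2 : 0 < 2 / δ' := by rw [h2δ']; positivity
    have e1 : Real.exp (-(2 * Real.log (2 / δ'))) = (δ / (16 * X)) ^ 2 := by
      rw [Real.exp_neg, two_mul, Real.exp_add, Real.exp_log h2, h2δ']
      field_simp
      norm_num
    rw [e1]
    push_cast
    rw [← hnS, ← hnA]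
    have e2 : (M : ℝ) * H * nS * nA * M * 2 + 1 = M * X * 2 + 1 := by rw [hX, hT]; ring
    rw [e2]
    exact failure_probability_le (by linarith) (by linarith) hδ0 hδ1.le
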